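/- **Setting.** Let $j_\ell,n_\ell\ge 2$ ($\ell\ge1$) be integers, $J_i=\prod_{\ell=1}^i j_\ell$, $N_i=\prod_{\ell=1}^i n_\ell$, $L_i=\pi/J_i$, $[n]=\{1,\dots,n\}$. Let $F_0=\mathbb R/2\pi\mathbb Z$ be the circle and, for $i\ge1$, let $F_i=F_{i-1}\times[n_i]/\!\sim$, where the $n_i$ copies of a point $x\in F_{i-1}$ are identified if and only if the angle of $x$ is a multiple of $L_i$. Points of $F_i$ are written as words $\eta w_1\dots w_i$ with angle $\eta$ and letters $w_\ell\in[n_\ell]$; $\phi_i\colon F_i\to F_{i-1}$ drops the last letter. An $i$-cell is the set of points with given letters $w_1,\dots,w_i$ and angle in $\vartheta+[0,L_i]$ for a given multiple $\vartheta$ of $L_i$; two $i$-cells are in the same bundle if they have the same $\vartheta$ and the same letters $w_1,\dots,w_{i-1}$. For $x\in F_i$ let $\theta_x\in[0,L_i)$ be its angle modulo $L_i$. The measure $\mu_i$ on $F_i$ is $1/N_i$ times the length on each $i$-cell. The diamond fractal $(F_\infty,\mu_\infty,\{\Phi_i\}_{i\ge0})$ is the inverse limit of the $(F_i,\mu_i,\phi_i)$.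 Its nonnegative Laplacian $\Delta$ is determined by $\Delta(g\circ\Phi_i)=(\Delta_{F_i}g)\circ\Phi_i$, where $\Delta_{F_i}g=-g''$ on the cells of the metric graph $F_i$, with continuity and Kirchhoff conditions at the vertices. The heat equation is $\partial_tu=-\Delta u$ and the free Schrödinger equation is $\partial_tu=-\mathrm i\Delta u$ (solutions: continuous $u\colon[0,\infty)\to L^2(F_\infty,\mu_\infty)$, the equation holding weakly on $(0,\infty)$ against the functions $g\circ\Phi_i$ above). For $\operatorname{Re}z>0$ let $$p_z^{F_0}(a,b)=\frac1{2\pi}+\frac1\pi\sum_{k=1}^\infty e^{-k^2z}\cos(k(b-a)),$$ $$D_{i,z}(\theta,\theta')=J_i\big(p^{F_0}_{J_i^2z}(J_i\theta,J_i\theta')-p^{F_0}_{J_i^2z}(J_i\theta,-J_i\theta')\big),$$ and for $i\ge1$, $x,y\in F_i$, let $p_z^{F_i}(x,y)$ be $p_z^{F_{i-1}}(\phi_i(x),\phi_i(y))$ plus $N_{i-1}(n_i-1)D_{i,z}(\theta_x,\theta_y)$ if $x,y$ lie in the same $i$-cell, plus $-N_{i-1}D_{i,z}(\theta_x,\theta_y)$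 if they lie in different $i$-cells of the same bundle, and plus $0$ otherwise. For $x\ne y$ in $F_\infty$ let $i_*=i_*(x,y)$ be the largest $i\ge1$ such that $\Phi_i(x)$ and $\Phi_i(y)$ belong to $i$-cells in the same bundle ($i_*=0$ if there is no such $i$). **Corollary.** Suppose that for some $\varepsilon_0>0$ the limit $\lim_{i\to\infty}N_ie^{-J_i^2t}$ exists and is finite for every $t\in(0,\varepsilon_0)$. Then $i_*(x,y)<\infty$ for $x\neq y$, and the fundamental solution of the free Schrödinger equation on $F_\infty$ is obtained from the heat kernel by Wick rotation: $$\psi_t^{F_\infty}(x,y)=p^{F_{i_*}}_{\mathrm it}\big(\Phi_{i_*}(x),\Phi_{i_*}(y)\big)\qquad(x\ne y),$$ where $p_{\mathrm it}$ denotes the boundary value at $\mathrm it$, $t>0$, of the function $z\mapsto p_z$ holomorphic in $\operatorname{Re}z>0$, taken for fixed $x,y$ in the sense of distributions in $t\in(0,\infty)$. In detail: 1. For $\operatorname{Re}z>0$ and all $x,y\in F_\infty$ the limit $p_z^{F_\infty}(x,y)=\lim_ip_z^{F_i}(\Phi_i(x),\Phi_i(y))$ exists and is holomorphic in $z$; for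 real $z=t>0$ it is the heat kernel of $F_\infty$ (fundamental solution of the heat equation); and $p_z^{F_\infty}(x,y)=p_z^{F_{i_*}}(\Phi_{i_*}(x),\Phi_{i_*}(y))$ if $x\neq y$. 2. There are distributions $\psi(x,y)\in\mathcal D'((0,\infty))$, $x,y\in F_\infty$, such that for $x\ne y$ and every $\eta\in C_c^\infty((0,\infty))$ $$\langle\psi(x,y),\eta\rangle=\lim_{\varepsilon\downarrow0}\int_0^\infty\eta(t)\,p^{F_{i_*}}_{\varepsilon+\mathrm it}\big(\Phi_{i_*}(x),\Phi_{i_*}(y)\big)\,dt,$$ and such that $\psi$ is the free Schrödinger kernel: for each $f\in L^2(F_\infty,\mu_\infty)$ the free Schrödinger equation has a unique solution $u$ with $u(0)=f$, and for every such $\eta$ and almost every $x$, the function $\langle\psi(x,\cdot),\eta\rangle f$ is integrable and $$\Big(\int_0^\infty\eta(t)u(t)\,dt\Big)(x)=\int_{F_\infty}\langle\psi(x,y),\eta\rangle f(y)\,\mu_\infty(dy).$$ Any other $\psi'$ that is a free Schrödinger kernel in this sense satisfies, for every $\eta$, $\langle\psi'(x,y),\eta\rangle=\langle\psi(x,y),\eta\rangle$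 for almost every $x$ and almost every $y$. 3. For each fixed $t>0$ and each solution $u$ of the free Schrödinger equation with $u(0)=f\in L^2(F_\infty,\mu_\infty)$, $$u(t)=\lim_{\varepsilon\downarrow0}\int_{F_\infty}p^{F_{i_*}}_{\varepsilon+\mathrm it}\big(\Phi_{i_*}(\cdot),\Phi_{i_*}(y)\big)f(y)\,\mu_\infty(dy)\quad\text{in }L^2(F_\infty,\mu_\infty),$$ where for each $\varepsilon>0$ the integrand is integrable in $y$ for every $x\in F_\infty$. -/

import Mathlib

open MeasureTheory Filter Topology Set
open scoped Distributions

noncomputable section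

namespace DiamondFractal

/-- The circle `𝕊¹`, identified with `ℝ / 2πℤ`. -/
abbrev Circ : Type := AddCircle (2 * Real.pi)

/-- The branching parameters of a diamond fractal. Only the values at indices `l ≥ 1` are used. -/
structure Parameters where
  j : ℕ → ℕ
  n : ℕ → ℕ
  two_le_j : ∀ l, 1 ≤ l → 2 ≤ j l
  two_le_n : ∀ l, 1 ≤ l → 2 ≤ n l

/-- Data carried along the inductive construction of the metric graphs: the underlying set, its
Borel σ-algebra, and the angle `η` of a point `η w₁ … w_l`. -/
structure Level where
  carrier : Type
  meas : MeasurableSpace carrier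
  angle : carrier → Circ

namespace Parameters

/-- `J_i = j_1 ⋯ j_i`. -/
def J (P : Parameters) (i : ℕ) : ℕ := ∏ l ∈ Finset.Icc 1 i, P.j l

/-- `N_i = n_1 ⋯ n_i`. -/
def N (P : Parameters) (i : ℕ) : ℕ := ∏ l ∈ Finset.Icc 1 i, P.n l

/-- `L_i = π / J_i`, the length of an `i`-cell. -/
def L (P : Parameters) (i : ℕ) : ℝ := Real.pi / P.J i

/-- The standing growth assumption: for some `ε > 0` the limit of `N_i exp (-J_i² t)` exists and is
finite for every `t ∈ (0, ε)`. -/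
def Growth (P : Parameters) : Prop :=
  ∃ ε : ℝ, 0 < ε ∧ ∀ t ∈ Ioo 0 ε, ∃ l : ℝ,
    Tendsto (fun i => (P.N i : ℝ) * Real.exp (-(P.J i : ℝ) ^ 2 * t)) atTop (𝓝 l)

/-- The angles of the branching points up to stage `i`. The angles `π k / J_i` with `k` not
divisible by `j_i` are new at stage `i`; together with those of the earlier stages they are all the
multiples of `π / J_i`. -/
def vertexAngles (P : Parameters) (i : ℕ) : Set Circ :=
  {η | ∃ k : ℕ, k < 2 * P.J i ∧ η = ((P.L i * k : ℝ) : Circ)}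

/-- The gluing relation on `F_i × [n_{i+1}]`: the copies of a branching point are identified. -/
def gluing (P : Parameters) (i : ℕ) (S : Level) : Setoid (S.carrier × Fin (P.n (i + 1))) where
  r a b := a = b ∨ (a.1 = b.1 ∧ S.angle a.1 ∈ P.vertexAngles (i + 1))
  iseqv :=
    { refl := fun _ => Or.inl rfl
      symm := by
        rintro a b (h | ⟨h, h'⟩)
        · exact Or.inl h.symm
        · exact Or.inr ⟨h.symm, h ▸ h'⟩
      trans := by
        rintro a b c (rfl | ⟨h, h'⟩) (rfl | ⟨k, k'⟩)
        · exact Or.inl rfl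
        · exact Or.inr ⟨k, k'⟩
        · exact Or.inr ⟨h, h'⟩
        · exact Or.inr ⟨h.trans k, h'⟩ }

/-- `F_0 = 𝕊¹` and `F_{i+1} = F_i × [n_{i+1}] / ∼`, with the quotient σ-algebra. -/
def level (P : Parameters) : ℕ → Level
  | 0 => ⟨Circ, inferInstance, id⟩
  | i + 1 =>
    { carrier := Quotient (P.gluing i (P.level i))
      meas :=
        letI : MeasurableSpace (P.level i).carrier := (P.level i).meas
        MeasurableSpace.map (Quotient.mk (P.gluing i (P.level i))) inferInstance
      angle := Quotient.lift (fun a => (P.level i).angle a.1) (by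
        rintro a b (h | ⟨h, -⟩)
        · rw [h]
        · rw [h]) }

/-- The finite approximation `F_i`. -/
def F (P : Parameters) (i : ℕ) : Type := (P.level i).carrier

instance (P : Parameters) (i : ℕ) : MeasurableSpace (P.F i) := (P.level i).meas

/-- The quotient map `F_i × [n_{i+1}] → F_{i+1}`. -/
def glue (P : Parameters) (i : ℕ) (a : P.F i × Fin (P.n (i + 1))) : P.F (i + 1) :=
  Quotient.mk (P.gluing i (P.level i)) a

/-- The map `φ_{i+1} : F_{i+1} → F_i`, `x w ↦ x`. -/
def proj (P : Parameters) (i : ℕ) : P.F (i + 1) → P.F i :=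
  Quotient.lift (fun a : (P.level i).carrier × Fin (P.n (i + 1)) => a.1) (by
    rintro a b (h | ⟨h, -⟩)
    · rw [h]
    · exact h)

/-- The words `w₁ … w_i ∈ [n_1] × ⋯ × [n_i]`. -/
abbrev Word (P : Parameters) (i : ℕ) : Type := (l : Fin i) → Fin (P.n (l + 1))

/-- The point of `F_i` represented by the word `η w₁ … w_i`. -/
def point (P : Parameters) : (i : ℕ) → Circ → P.Word i → P.F i
  | 0, η, _ => η
  | i + 1, η, w => P.glue i (P.point i η (fun l => w l.castSucc), w (Fin.last i))

/-- The index set of the `i`-cells; `(k, w)` stands for the word `ϑ w₁ … w_i` with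
`ϑ = π k / J_i`. -/
abbrev Cell (P : Parameters) (i : ℕ) : Type := Fin (2 * P.J i) × P.Word i

/-- The parametrization `φ_α : [0, L_i] → F_i` of the cell with index `α`. -/
def cellMap (P : Parameters) (i : ℕ) (α : P.Cell i) (θ : ℝ) : P.F i :=
  P.point i ((P.L i * (α.1 : ℕ) + θ : ℝ) : Circ) α.2

/-- The closed cell `I_α`. -/
def cell (P : Parameters) (i : ℕ) (α : P.Cell i) : Set (P.F i) :=
  P.cellMap i α '' Icc 0 (P.L i)

/-- The position `θ_x ∈ [0, L_i)` of a point `x ∈ F_i` in an `i`-cell. It does not depend on the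
cell. -/
def offset (P : Parameters) (i : ℕ) (x : P.F i) : ℝ :=
  Classical.epsilon fun θ : ℝ => θ ∈ Ico 0 (P.L i) ∧ ∃ α : P.Cell i, P.cellMap i α θ = x

/-- Two cells belong to the same bundle: their words agree up to the last letter. -/
def Bundled (P : Parameters) (i : ℕ) (α β : P.Cell i) : Prop :=
  α.1 = β.1 ∧ ∀ l : Fin i, (l : ℕ) + 1 < i → α.2 l = β.2 l

/-- `x` and `y` belong to `i`-cells in the same bundle. -/
def SameBundle (P : Parameters) (i : ℕ) (x y : P.F i) : Prop :=
  ∃ α β : P.Cell i, P.Bundled i α β ∧ x ∈ P.cell i α ∧ y ∈ P.cell i β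

/-- `x` and `y` belong to the same `i`-cell. -/
def SameCell (P : Parameters) (i : ℕ) (x y : P.F i) : Prop :=
  ∃ α : P.Cell i, x ∈ P.cell i α ∧ y ∈ P.cell i α

/-- The measure `μ_i` on `F_i`: on each `i`-cell it is `1 / N_i` times the image of the Lebesgue
measure on `[0, L_i]`. For `i = 0` the two cells are half circles, and `μ_0` is the arc length. -/
def mu (P : Parameters) (i : ℕ) : Measure (P.F i) :=
  ∑ α : P.Cell i, ((P.N i : ENNReal)⁻¹) •
    Measure.map (P.cellMap i α) (volume.restrict (Icc 0 (P.L i)))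

/-- The diamond fractal `F_∞`: the inverse limit of the `F_i`. -/
def FInf (P : Parameters) : Type :=
  {x : (i : ℕ) → P.F i // ∀ i, P.proj i (x (i + 1)) = x i}

instance (P : Parameters) : MeasurableSpace P.FInf :=
  inferInstanceAs (MeasurableSpace {x : (i : ℕ) → P.F i // ∀ i, P.proj i (x (i + 1)) = x i})

/-- The canonical map `Φ_i : F_∞ → F_i`. -/
def Phi (P : Parameters) (i : ℕ) (x : P.FInf) : P.F i := x.1 i

/-- The point of `F_∞` represented by the infinite word `η w₁ w₂ …`. -/
def pointInf (P : Parameters) (η : Circ) (w : (l : ℕ) → Fin (P.n (l + 1))) : P.FInf :=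
  ⟨fun i => P.point i η (fun l => w l), fun _ => rfl⟩

instance (P : Parameters) (l : ℕ) : Nonempty (Fin (P.n (l + 1))) :=
  ⟨⟨0, lt_of_lt_of_le two_pos (P.two_le_n (l + 1) (Nat.le_add_left 1 l))⟩⟩

/-- The measure `μ_∞` on `F_∞`: the image of the Lebesgue measure in the angle times the uniform
measure in every letter. It is the measure with `μ_∞ (Φ_i⁻¹ A) = μ_i A`, see `map_Phi_muInf`. -/
def muInf (P : Parameters) : Measure P.FInf :=
  Measure.map (fun a : ℝ × ((l : ℕ) → Fin (P.n (l + 1))) => P.pointInf (a.1 : Circ) a.2)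
    ((volume.restrict (Ico 0 (2 * Real.pi))).prod
      (Measure.infinitePi fun l => ProbabilityTheory.uniformOn (univ : Set (Fin (P.n (l + 1))))))

theorem measurable_point (P : Parameters) (i : ℕ) :
    Measurable fun a : Circ × P.Word i => P.point i a.1 a.2 := by
  induction i with
  | zero => exact measurable_fst
  | succ i ih =>
    have h1 : Measurable (P.glue i) := fun s hs => hs
    have h2 : Measurable fun a : Circ × P.Word (i + 1) =>
        ((a.1, fun l => a.2 l.castSucc) : Circ × P.Word i) :=
      measurable_fst.prodMk (measurable_pi_lambda _ fun l =>
        (measurable_pi_apply l.castSucc).comp measurable_snd)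
    have h3 : Measurable fun a : Circ × P.Word (i + 1) => a.2 (Fin.last i) :=
      (measurable_pi_apply (Fin.last i)).comp measurable_snd
    exact h1.comp ((ih.comp h2).prodMk h3)

theorem measurable_Phi (P : Parameters) (i : ℕ) : Measurable (P.Phi i) :=
  (measurable_pi_apply i).comp measurable_subtype_coe

theorem measurable_coe_circ : Measurable fun θ : ℝ => (θ : Circ) :=
  AddCircle.measurable_mk'

theorem measurable_pointInf (P : Parameters) :
    Measurable fun a : ℝ × ((l : ℕ) → Fin (P.n (l + 1))) => P.pointInf (a.1 : Circ) a.2 := by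
  refine Measurable.subtype_mk (measurable_pi_lambda _ fun i => ?_)
  refine (P.measurable_point i).comp (f := fun a : ℝ × ((l : ℕ) → Fin (P.n (l + 1))) =>
    ((a.1 : Circ), fun l : Fin i => a.2 l)) ?_
  exact (measurable_coe_circ.comp measurable_fst).prodMk (measurable_pi_lambda _ fun l =>
    (measurable_pi_apply (l : ℕ)).comp measurable_snd)

theorem L_mul (P : Parameters) (i : ℕ) : 0 < P.L i ∧ P.L i * (2 * P.J i : ℕ) = 2 * Real.pi := by
  have hJ : (0 : ℝ) < P.J i := by
    have : 0 < P.J i := Finset.prod_pos fun l hl =>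
      lt_of_lt_of_le two_pos (P.two_le_j l (Finset.mem_Icc.1 hl).1)
    exact_mod_cast this
  refine ⟨div_pos Real.pi_pos hJ, ?_⟩
  unfold L
  push_cast
  field_simp

theorem volume_arcs (L : ℝ) (hL : 0 < L) (S : Set ℝ) (hS : MeasurableSet S) (m : ℕ) :
    ∑ k ∈ Finset.range m, volume ((fun θ : ℝ => L * k + θ) ⁻¹' S ∩ Icc 0 L) =
      volume (S ∩ Ico 0 (L * m)) := by
  induction m with
  | zero => simp
  | succ m ih =>
    have h0 : (0 : ℝ) ≤ L * m := by positivity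
    have h1 : Ico 0 (L * (m + 1 : ℕ)) = Ico 0 (L * m) ∪ Ico (L * m) (L * m + L) := by
      rw [Ico_union_Ico_eq_Ico h0 (by linarith)]
      push_cast
      ring_nf
    have h2 : volume ((fun θ : ℝ => L * m + θ) ⁻¹' S ∩ Icc 0 L) =
        volume (S ∩ Ico (L * m) (L * m + L)) := by
      rw [← measure_preimage_add volume (L * m) (S ∩ Ico (L * m) (L * m + L)), preimage_inter,
        preimage_const_add_Ico, sub_self, add_sub_cancel_left]
      exact measure_congr (Filter.EventuallyEq.rfl.inter Ico_ae_eq_Icc.symm)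
    rw [Finset.sum_range_succ, ih, h1, inter_union_distrib_left, measure_union _
      (hS.inter measurableSet_Ico), h2]
    refine Disjoint.mono inter_subset_right inter_subset_right ?_
    exact Set.disjoint_left.2 fun x hx hy => absurd hx.2 (not_lt.2 hy.1)

theorem infinitePi_word (P : Parameters) (i : ℕ) (v : P.Word i) :
    (Measure.infinitePi fun l =>
      ProbabilityTheory.uniformOn (univ : Set (Fin (P.n (l + 1)))))
        {w | (fun l : Fin i => w l) = v} = (P.N i : ENNReal)⁻¹ := by
  have h : {w : (l : ℕ) → Fin (P.n (l + 1)) | (fun l : Fin i => w l) = v} =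
      Set.pi (Finset.range i : Set ℕ)
        (fun l => {a | ∀ h : l < i, a = v ⟨l, h⟩}) := by
    ext w
    simp only [mem_ofPred_eq, Set.mem_pi, Finset.coe_range, mem_Iio]
    constructor
    · rintro rfl l hl _
      rfl
    · intro h
      funext l
      exact h l l.2 l.2
  rw [h, Measure.infinitePi_pi _ (fun l _ => MeasurableSet.of_discrete)]
  have hN : (P.N i : ENNReal)⁻¹ = ∏ l ∈ Finset.range i, (P.n (l + 1) : ENNReal)⁻¹ := by
    have hN' : P.N i = ∏ l ∈ Finset.range i, P.n (l + 1) := by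
      rw [Finset.range_eq_Ico, Finset.prod_Ico_add' (fun l => P.n l) 0 i 1]
      rfl
    rw [hN', Nat.cast_prod, ENNReal.prod_inv_distrib]
    intro a _ b _ _
    exact Or.inr (ENNReal.natCast_ne_top _)
  rw [hN]
  refine Finset.prod_congr rfl fun l hl => ?_
  have hl' : l < i := Finset.mem_range.1 hl
  have hs : {a : Fin (P.n (l + 1)) | ∀ h : l < i, a = v ⟨l, h⟩} = {v ⟨l, hl'⟩} := by
    ext a
    simp [hl']
  rw [hs, ProbabilityTheory.uniformOn_univ, Measure.count_singleton, Fintype.card_fin, one_div]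

/-- `μ_∞` is the inverse limit of the measures `μ_i`. -/
theorem map_Phi_muInf (P : Parameters) (i : ℕ) : Measure.map (P.Phi i) P.muInf = P.mu i := by
  ext A hA
  set S : P.Word i → Set ℝ := fun v => {θ | P.point i (θ : Circ) v ∈ A} with hSdef
  have hS : ∀ v, MeasurableSet (S v) := fun v =>
    ((P.measurable_point i).comp (f := fun θ : ℝ => ((θ : Circ), v))
      (measurable_coe_circ.prodMk measurable_const)) hA
  obtain ⟨hL, hL2⟩ := P.L_mul i
  have hmu : P.mu i A =
      ∑ v : P.Word i, (P.N i : ENNReal)⁻¹ * volume (S v ∩ Ico 0 (2 * Real.pi)) := by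
    simp only [mu, Measure.finsetSum_apply, Measure.smul_apply, smul_eq_mul]
    rw [Fintype.sum_prod_type_right]
    refine Finset.sum_congr rfl fun v _ => ?_
    rw [← hL2, ← volume_arcs _ hL _ (hS v), Finset.mul_sum, ← Fin.sum_univ_eq_sum_range
      (fun k => (P.N i : ENNReal)⁻¹ *
        volume ((fun θ : ℝ => P.L i * k + θ) ⁻¹' S v ∩ Icc 0 (P.L i)))]
    refine Finset.sum_congr rfl fun k _ => ?_
    have hm : Measurable (P.cellMap i (k, v)) :=
      (P.measurable_point i).comp (f := fun θ : ℝ => (((P.L i * (k : ℕ) + θ : ℝ) : Circ), v))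
        ((measurable_coe_circ.comp (measurable_const.add measurable_id)).prodMk measurable_const)
    rw [Measure.map_apply hm hA, Measure.restrict_apply (hm hA)]
    rfl
  rw [hmu, muInf, Measure.map_map (P.measurable_Phi i) P.measurable_pointInf,
    Measure.map_apply ((P.measurable_Phi i).comp P.measurable_pointInf) hA]
  have hset : (P.Phi i ∘ fun a : ℝ × ((l : ℕ) → Fin (P.n (l + 1))) =>
      P.pointInf (a.1 : Circ) a.2) ⁻¹' A =
      ⋃ v : P.Word i, S v ×ˢ {w | (fun l : Fin i => w l) = v} := by
    ext a
    simp only [mem_iUnion, mem_prod, mem_ofPred_eq, mem_preimage, Function.comp]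
    constructor
    · intro h
      exact ⟨_, h, rfl⟩
    · rintro ⟨v, h, rfl⟩
      exact h
  have hW : ∀ v : P.Word i, MeasurableSet
      {w : (l : ℕ) → Fin (P.n (l + 1)) | (fun l : Fin i => w l) = v} := fun v =>
    (measurable_pi_lambda (fun w : (l : ℕ) → Fin (P.n (l + 1)) => fun l : Fin i => w l)
      fun l => measurable_pi_apply (l : ℕ)) (measurableSet_singleton v)
  rw [hset, measure_iUnion _ fun v => (hS v).prod (hW v), tsum_fintype]
  · refine Finset.sum_congr rfl fun v _ => ?_
    rw [Measure.prod_prod, P.infinitePi_word, Measure.restrict_apply (hS v), mul_comm]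
  · intro v v' h
    refine Set.disjoint_left.2 fun a ha hb => h ?_
    exact (show _ = v from ha.2).symm.trans hb.2

/-- The indices `i ≥ 1` for which `x` and `y` belong to `i`-cells in the same bundle. -/
def bundleLevels (P : Parameters) (x y : P.FInf) : Set ℕ :=
  {i | 1 ≤ i ∧ P.SameBundle i (P.Phi i x) (P.Phi i y)}

/-- `i_*(x, y)`, the largest index for which `x` and `y` belong to cells in the same bundle, and `0`
if there is none. It is meaningful for `x ≠ y`; on the diagonal all indices qualify. -/
def iStar (P : Parameters) (x y : P.FInf) : ℕ := sSup (P.bundleLevels x y)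

end Parameters

/-- The heat kernel of the circle at complex time `z`, `Re z > 0`:
`1 / (2π) + (1 / π) ∑_{k ≥ 1} exp (-k² z) cos (k (b - a))`. -/
def circleKernel (z : ℂ) (a b : Circ) : ℂ :=
  1 / (2 * Real.pi) + 1 / Real.pi * ∑' k : ℕ, Complex.exp (-((k : ℂ) + 1) ^ 2 * z) *
    (Real.Angle.cos ((k + 1) • (show Real.Angle from b - a)) : ℝ)

/-- The open half line `(0, ∞)` of times. -/
def posTimes : TopologicalSpace.Opens ℝ := ⟨Ioi 0, isOpen_Ioi⟩

/-- The distribution `T` on `(0, ∞)` is `t ↦ K(i t)` for a function `K` on the half plane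
`Re z > 0`, that is, `T` is the boundary value of `K` on the imaginary half axis:
`T = lim_{ε ↓ 0} K(ε + i t)` in the sense of distributions. -/
def IsWickRotation (K : ℂ → ℂ) (T : 𝓓'(posTimes, ℂ)) : Prop :=
  ∀ η : 𝓓(posTimes, ℝ),
    Tendsto (fun ε : ℝ => ∫ t : ℝ, (η t : ℂ) * K (ε + Complex.I * t)) (𝓝[>] 0) (𝓝 (T η))

namespace Parameters

/-- `J_i (p^{F_0}_{J_i² z} (J_i θ, J_i θ') - p^{F_0}_{J_i² z} (J_i θ, -J_i θ'))`. -/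
def cellKernel (P : Parameters) (i : ℕ) (z : ℂ) (θ θ' : ℝ) : ℂ :=
  (P.J i : ℂ) *
    (circleKernel ((P.J i : ℂ) ^ 2 * z) ((P.J i * θ : ℝ) : Circ) ((P.J i * θ' : ℝ) : Circ) -
      circleKernel ((P.J i : ℂ) ^ 2 * z) ((P.J i * θ : ℝ) : Circ) ((-(P.J i * θ') : ℝ) : Circ))

open Classical in
/-- The heat kernel `p_z^{F_i}` at complex time `z`, `Re z > 0`, given by the recursive formula. -/
def p (P : Parameters) : (i : ℕ) → ℂ → P.F i → P.F i → ℂ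
  | 0, z, x, y => circleKernel z x y
  | i + 1, z, x, y =>
    P.p i z (P.proj i x) (P.proj i y) +
      if P.SameCell (i + 1) x y then
        (P.N i : ℂ) * ((P.n (i + 1) : ℂ) - 1) *
          P.cellKernel (i + 1) z (P.offset (i + 1) x) (P.offset (i + 1) y)
      else if P.SameBundle (i + 1) x y then
        -((P.N i : ℂ) * P.cellKernel (i + 1) z (P.offset (i + 1) x) (P.offset (i + 1) y))
      else 0

/-- `p_z^{F_{i_*}} (Φ_{i_*} x, Φ_{i_*} y)` with `i_* = i_*(x, y)`. -/
def pStar (P : Parameters) (z : ℂ) (x y : P.FInf) : ℂ :=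
  P.p (P.iStar x y) z (P.Phi (P.iStar x y) x) (P.Phi (P.iStar x y) y)

/-- The limit `p_z^{F_∞} (x, y) = lim_i p_z^{F_i} (Φ_i x, Φ_i y)`. -/
def pInf (P : Parameters) (z : ℂ) (x y : P.FInf) : ℂ :=
  limUnder atTop fun i => P.p i z (P.Phi i x) (P.Phi i y)

/-- `g` belongs to the domain of the (nonnegative) Kirchhoff Laplacian of the metric graph `F_i`,
with classical regularity, and `h` is the Laplacian of `g`: on every closed cell `g` is of class
`C²`, on every open cell `h = -g''`, and at every point of `F_i` the sum of the derivatives along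
the cells that start there equals the sum of the derivatives along the cells that end there.
Continuity of `g` at the vertices is automatic, as `g` is a function on `F_i`; the values of `h` at
the vertices play no role. -/
def IsLaplacian (P : Parameters) (i : ℕ) (g h : P.F i → ℂ) : Prop :=
  ∃ G : P.Cell i → ℝ → ℂ,
    (∀ α, ContDiff ℝ 2 (G α)) ∧
    (∀ α, ∀ θ ∈ Icc 0 (P.L i), g (P.cellMap i α θ) = G α θ) ∧
    (∀ α, ∀ θ ∈ Ioo 0 (P.L i), h (P.cellMap i α θ) = -deriv (deriv (G α)) θ) ∧
    ∀ v : P.F i,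
      (∑ᶠ α ∈ {α : P.Cell i | P.cellMap i α 0 = v}, deriv (G α) 0) =
        ∑ᶠ α ∈ {α : P.Cell i | P.cellMap i α (P.L i) = v}, deriv (G α) (P.L i)

/-- The complex Hilbert space `L²(F_∞, μ_∞)`. -/
abbrev L2 (P : Parameters) : Type := Lp ℂ 2 P.muInf

/-- `u : [0, ∞) → L²(F_∞, μ_∞)` is a (continuous, weak) solution of `∂u/∂t = -c Δ u` with initial
value `f`. The nonnegative Laplacian `Δ` of `F_∞` acts on functions `g ∘ Φ_i` by
`Δ (g ∘ Φ_i) = (Δ_{F_i} g) ∘ Φ_i`, and these are the test functions. For `c = 1` this is the heat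
equation, and for `c = i` the free Schrödinger equation. Only the values of `u` on `[0, ∞)`
matter. -/
def IsSolution (P : Parameters) (c : ℂ) (f : P.L2) (u : ℝ → P.L2) : Prop :=
  ContinuousOn u (Ici 0) ∧ u 0 = f ∧
    ∀ (i : ℕ) (g h : P.F i → ℂ), P.IsLaplacian i g h → ∀ t : ℝ, 0 < t →
      HasDerivAt (fun s => ∫ x, u s x * g (P.Phi i x) ∂P.muInf)
        (-c * ∫ x, u t x * h (P.Phi i x) ∂P.muInf) t

/-- `u` is the unique solution of `∂u/∂t = -c Δ u` on `[0, ∞)` with initial value `f`. -/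
def IsUniqueSolution (P : Parameters) (c : ℂ) (f : P.L2) (u : ℝ → P.L2) : Prop :=
  P.IsSolution c f u ∧ ∀ v, P.IsSolution c f v → EqOn v u (Ici 0)

/-- `q_t(x, y)` is the heat kernel, that is, the fundamental solution of the heat equation, of
`F_∞`. -/
def IsHeatKernel (P : Parameters) (q : ℝ → P.FInf → P.FInf → ℂ) : Prop :=
  ∀ f : P.L2, ∃ u : ℝ → P.L2, P.IsUniqueSolution 1 f u ∧ ∀ t : ℝ, 0 < t →
    ∀ᵐ x ∂P.muInf, Integrable (fun y => q t x y * f y) P.muInf ∧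
      u t x = ∫ y, q t x y * f y ∂P.muInf

/-- `ψ` is the free Schrödinger kernel, that is, the fundamental solution of the free Schrödinger
equation, of `F_∞`. As a function of time the kernel `ψ(x, y) = ψ_t(x, y)` is a distribution on
`(0, ∞)`, and the representation `u(t)(x) = ∫ ψ_t(x, y) f(y) μ_∞(dy)` of the solution with initial
value `f` is understood in the sense of distributions in `t`. -/
def IsSchrodingerKernel (P : Parameters) (ψ : P.FInf → P.FInf → 𝓓'(posTimes, ℂ)) : Prop :=
  ∀ f : P.L2, ∃ u : ℝ → P.L2, P.IsUniqueSolution Complex.I f u ∧ ∀ η : 𝓓(posTimes, ℝ),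
    ∀ᵐ x ∂P.muInf, Integrable (fun y => ψ x y η * f y) P.muInf ∧
      (∫ t : ℝ, η t • u t : P.L2) x = ∫ y, ψ x y η * f y ∂P.muInf

end Parameters
end DiamondFractal
end

/-! ### Words, cells and the measurable structure of the finite graphs -/

noncomputable section

namespace DiamondFractal
namespace Parameters

variable (P : Parameters)

/-! The proof rests on one explicit diagonalization of the Laplacian. In the coordinates (angle,
letters), `L²(F_∞)` is the `L²` space of the product of the circle with the infinite words. A
function splits into its martingale differences in the letters. Its mean over all letters lives on
the circle and is expanded in exponentials. The part that is new at stage `i + 1` has mean zero over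
every bundle. When it is continuous it vanishes at the ends of the `(i + 1)`-cells, where the cells
of a bundle meet. On this part the Laplacian decouples into Dirichlet problems on arcs of length
`L_{i+1}`, with eigenfunctions `sin (k J_{i+1} θ)` and eigenvalues `(k J_{i+1})²`. The vectors of
mean zero over a bundle have no canonical orthonormal basis, so the projections of the unit vectors
are used. The result is a Parseval frame (`tsum_enorm_frame`, `parsevalFrame`), which is enough for
operators that multiply coefficients.

The frame functions are admissible test functions. Green's identity therefore turns `∂u/∂t = -c Δ u`
into scalar equations for the coefficients, which gives existence and uniqueness for `Re c ≥ 0`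
(`isUniqueSolution_solution`).

For a sequence `c` of quadratic decay, the function `c(√Δ)` of the Laplacian is the integral
operator with kernel `∑ c(freq n) conj(e_n(x)) e_n(y)`: for fixed `k` the frame functions of one
stage contribute a bounded amount to the `L¹` norm in `x`, uniformly in `y`, the stage and `k`
(`sum_lintegral_mul_sineFun_le`). A frame function that is new at some stage lives on a single
bundle. Hence for `x ≠ y` the stages after `i_*` contribute nothing, and the kernel is the finite
sum `starKernel` (`tsum_frameFun`, `multiplier_eq_integral_starKernel`).

The choice `c(k) = exp(-k² z)` reproduces the recursion that defines `p` (`p_succ`). The Schrödinger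
kernel tested against `η` is the same expression with `c(k) = ∫ η(t) exp(-i k² t) dt`, and one
integration by parts in time gives the quadratic decay (`quadDecay_timeCoeff`). Wick rotation is
then a dominated limit in finitely many absolutely convergent series.

The growth assumption enters through `exists_bound_levelTerm`: the sum over the stages converges
uniformly for `Re z ≥ δ`, on the diagonal too. This yields the limit kernel, its holomorphy and its
boundedness. -/

theorem J_pos (i : ℕ) : 0 < P.J i :=
  Finset.prod_pos fun l hl => lt_of_lt_of_le two_pos (P.two_le_j l (Finset.mem_Icc.1 hl).1)

theorem N_pos (i : ℕ) : 0 < P.N i :=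
  Finset.prod_pos fun l hl => lt_of_lt_of_le two_pos (P.two_le_n l (Finset.mem_Icc.1 hl).1)

theorem n_pos (i : ℕ) : 0 < P.n (i + 1) :=
  lt_of_lt_of_le two_pos (P.two_le_n (i + 1) (Nat.le_add_left 1 i))

theorem j_pos (i : ℕ) : 0 < P.j (i + 1) :=
  lt_of_lt_of_le two_pos (P.two_le_j (i + 1) (Nat.le_add_left 1 i))

theorem J_zero : P.J 0 = 1 := by simp [J]

theorem N_zero : P.N 0 = 1 := by simp [N]

theorem J_succ (i : ℕ) : P.J (i + 1) = P.J i * P.j (i + 1) :=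
  Finset.prod_Icc_succ_top (Nat.le_add_left 1 i) _

theorem N_succ (i : ℕ) : P.N (i + 1) = P.N i * P.n (i + 1) :=
  Finset.prod_Icc_succ_top (Nat.le_add_left 1 i) _

theorem two_pow_le_J (i : ℕ) : 2 ^ i ≤ P.J i := by
  induction i with
  | zero => simp [J_zero]
  | succ i ih =>
    rw [J_succ, pow_succ]
    exact Nat.mul_le_mul ih (P.two_le_j _ (Nat.le_add_left 1 i))

theorem L_pos (i : ℕ) : 0 < P.L i := (P.L_mul i).1

theorem J_mul_L (i : ℕ) : (P.J i : ℝ) * P.L i = Real.pi := by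
  have : (0 : ℝ) < P.J i := by exact_mod_cast P.J_pos i
  unfold L
  field_simp

theorem L_succ (i : ℕ) : P.L i = P.L (i + 1) * P.j (i + 1) := by
  have h1 : (0 : ℝ) < P.J i := by exact_mod_cast P.J_pos i
  have h2 : (0 : ℝ) < P.j (i + 1) := by exact_mod_cast P.j_pos i
  unfold L
  rw [J_succ]
  push_cast
  field_simp

/-- The angle of a point of `F_i`. -/
def angle (i : ℕ) (x : P.F i) : Circ := (P.level i).angle x

variable {P}

theorem angle_proj {i : ℕ} (x : P.F (i + 1)) : P.angle i (P.proj i x) = P.angle (i + 1) x := by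
  induction x using Quotient.inductionOn with
  | h a => rfl

@[simp]
theorem angle_glue {i : ℕ} (a : P.F i × Fin (P.n (i + 1))) :
    P.angle (i + 1) (P.glue i a) = P.angle i a.1 := rfl

@[simp]
theorem angle_point {i : ℕ} (η : Circ) (w : P.Word i) : P.angle i (P.point i η w) = η := by
  induction i with
  | zero => rfl
  | succ i ih => exact ih _

@[simp]
theorem proj_point {i : ℕ} (η : Circ) (w : P.Word (i + 1)) :
    P.proj i (P.point (i + 1) η w) = P.point i η (fun l => w l.castSucc) := rfl

theorem glue_eq_iff {i : ℕ} {a b : P.F i × Fin (P.n (i + 1))} :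
    P.glue i a = P.glue i b ↔ a = b ∨ (a.1 = b.1 ∧ P.angle i a.1 ∈ P.vertexAngles (i + 1)) :=
  Quotient.eq (r := P.gluing i (P.level i))

theorem glue_surjective (i : ℕ) : Function.Surjective (P.glue i) := Quotient.mk_surjective

/-- Reduction modulo `2 J_i` removes the range restriction on `k`. In this form passing to the next
stage only multiplies `k` by `j_{i+1}`, whence `vertexAngles_mono`. -/
theorem mem_vertexAngles {i : ℕ} {η : Circ} :
    η ∈ P.vertexAngles i ↔ ∃ k : ℤ, η = ((P.L i * k : ℝ) : Circ) := by
  constructor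
  · rintro ⟨k, -, h⟩
    exact ⟨k, by simpa using h⟩
  · rintro ⟨k, rfl⟩
    have hJ : (0 : ℤ) < 2 * P.J i := by have := P.J_pos i; omega
    refine ⟨(k % (2 * P.J i)).toNat, ?_, ?_⟩
    · have h1 := Int.emod_lt_of_pos k hJ
      have h2 := Int.emod_nonneg k hJ.ne'
      omega
    · have h2 := Int.emod_nonneg k hJ.ne'
      have h3 : (((k % (2 * P.J i)).toNat : ℕ) : ℝ) = ((k % (2 * P.J i) : ℤ) : ℝ) := by
        exact_mod_cast Int.toNat_of_nonneg h2
      rw [h3]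
      refine QuotientAddGroup.eq_iff_sub_mem.2 (AddSubgroup.mem_zmultiples_iff.2
        ⟨k / (2 * P.J i), ?_⟩)
      have h4 : (k : ℝ) = ((k % (2 * P.J i) : ℤ) : ℝ) + 2 * P.J i * ((k / (2 * P.J i) : ℤ) : ℝ) := by
        exact_mod_cast (Int.emod_add_mul_ediv k (2 * P.J i)).symm
      have h5 := (P.L_mul i).2
      push_cast at h5
      rw [← h5, zsmul_eq_mul]
      nth_rewrite 1 [h4]
      ring

theorem vertexAngles_mono : Monotone P.vertexAngles := by
  refine monotone_nat_of_le_succ fun i η h => ?_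
  rw [mem_vertexAngles] at h ⊢
  obtain ⟨k, rfl⟩ := h
  refine ⟨P.j (i + 1) * k, ?_⟩
  rw [L_succ]
  push_cast
  ring_nf

/-- This replaces the iterated quotient by a comparison of words. Each gluing identifies only copies
of one and the same point, so the letters can be compared one at a time; the index `l` carries
letter number `l + 1`, glued over the multiples of `L_{l+1}`. -/
theorem point_eq_iff {i : ℕ} {η η' : Circ} {w w' : P.Word i} :
    P.point i η w = P.point i η' w' ↔
      η = η' ∧ ∀ l : Fin i, w l = w' l ∨ η ∈ P.vertexAngles (l + 1) := by
  induction i with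
  | zero => exact ⟨fun h => ⟨h, fun l => l.elim0⟩, fun h => h.1⟩
  | succ i ih =>
    simp only [point, glue_eq_iff, Prod.mk.injEq, ih, angle_point]
    constructor
    · rintro (⟨⟨h, h1⟩, h2⟩ | ⟨⟨h, h1⟩, h2⟩)
      · refine ⟨h, fun l => ?_⟩
        cases l using Fin.lastCases with
        | last => exact Or.inl h2
        | cast l => exact h1 l
      · refine ⟨h, fun l => ?_⟩
        cases l using Fin.lastCases with
        | last => exact Or.inr h2
        | cast l => exact h1 l
    · rintro ⟨h, h1⟩
      have h2 : ∀ l : Fin i, w l.castSucc = w' l.castSucc ∨ η ∈ P.vertexAngles (l + 1) :=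
        fun l => h1 l.castSucc
      rcases h1 (Fin.last i) with h3 | h3
      · exact Or.inl ⟨⟨h, h2⟩, h3⟩
      · exact Or.inr ⟨⟨h, h2⟩, h3⟩

theorem exists_point {i : ℕ} (x : P.F i) : ∃ w, P.point i (P.angle i x) w = x := by
  induction i with
  | zero => exact ⟨fun l => l.elim0, rfl⟩
  | succ i ih =>
    obtain ⟨⟨y, a⟩, rfl⟩ := glue_surjective i x
    obtain ⟨w, hw⟩ := ih y
    refine ⟨Fin.snoc (α := fun l : Fin (i + 1) => Fin (P.n (l + 1))) w a, ?_⟩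
    simp only [point, angle_glue, Fin.snoc_last, Fin.snoc_castSucc, hw]

theorem cellMap_eq (i : ℕ) (α : P.Cell i) (θ : ℝ) :
    P.cellMap i α θ = P.point i ((P.L i * (α.1 : ℕ) + θ : ℝ) : Circ) α.2 := rfl

theorem arc_mem_Ico {i : ℕ} (q : Fin (2 * P.J i)) {θ : ℝ} (hθ : θ ∈ Ico 0 (P.L i)) :
    P.L i * (q : ℕ) + θ ∈ Ico 0 (2 * Real.pi) := by
  obtain ⟨hL, hL2⟩ := P.L_mul i
  have h1 : ((q : ℕ) : ℝ) + 1 ≤ (2 * P.J i : ℕ) := by exact_mod_cast q.2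
  have h2 : (0 : ℝ) ≤ ((q : ℕ) : ℝ) := Nat.cast_nonneg _
  refine ⟨add_nonneg (mul_nonneg hL.le h2) hθ.1, ?_⟩
  rw [← hL2]
  nlinarith [hθ.2, mul_le_mul_of_nonneg_left h1 hL.le]

theorem coe_arc_injective {i : ℕ} {q q' : Fin (2 * P.J i)} {θ θ' : ℝ} (hθ : θ ∈ Ico 0 (P.L i))
    (hθ' : θ' ∈ Ico 0 (P.L i))
    (h : ((P.L i * (q : ℕ) + θ : ℝ) : Circ) = ((P.L i * (q' : ℕ) + θ' : ℝ) : Circ)) :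
    q = q' ∧ θ = θ' := by
  obtain ⟨hL, hL2⟩ := P.L_mul i
  have : Fact (0 < 2 * Real.pi) := ⟨Real.two_pi_pos⟩
  have h1 := (AddCircle.coe_eq_coe_iff_of_mem_Ico (a := 0) (by simpa using arc_mem_Ico q hθ)
    (by simpa using arc_mem_Ico q' hθ')).1 h
  have h2 : (q : ℕ) = q' := by
    by_contra hne
    rcases lt_or_gt_of_ne hne with hlt | hlt
    · have h3 : ((q : ℕ) : ℝ) + 1 ≤ (q' : ℕ) := by exact_mod_cast hlt
      nlinarith [mul_le_mul_of_nonneg_left h3 hL.le, hθ.2, hθ'.1]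
    · have h3 : ((q' : ℕ) : ℝ) + 1 ≤ (q : ℕ) := by exact_mod_cast hlt
      nlinarith [mul_le_mul_of_nonneg_left h3 hL.le, hθ.1, hθ'.2]
  refine ⟨Fin.ext h2, ?_⟩
  rw [h2] at h1
  linarith

theorem exists_arc (i : ℕ) (η : Circ) : ∃ q : Fin (2 * P.J i), ∃ θ ∈ Ico 0 (P.L i),
    η = ((P.L i * (q : ℕ) + θ : ℝ) : Circ) := by
  obtain ⟨hL, hL2⟩ := P.L_mul i
  have : Fact (0 < 2 * Real.pi) := ⟨Real.two_pi_pos⟩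
  obtain ⟨x, hx, rfl⟩ := (AddCircle.eq_coe_Ico η)
  have h0 : 0 ≤ x / P.L i := div_nonneg hx.1 hL.le
  have hfl : ⌊x / P.L i⌋₊ < 2 * P.J i := by
    rw [Nat.floor_lt h0, div_lt_iff₀ hL, mul_comm, hL2]
    exact hx.2
  refine ⟨⟨_, hfl⟩, x - P.L i * ⌊x / P.L i⌋₊, ⟨?_, ?_⟩, by simp⟩
  · have := Nat.floor_le h0
    rw [le_div_iff₀ hL] at this
    linarith
  · have := Nat.lt_floor_add_one (x / P.L i)
    rw [div_lt_iff₀ hL] at this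
    linarith

theorem exists_arc_real (i : ℕ) {x : ℝ} (hx : x ∈ Ico 0 (2 * Real.pi)) :
    ∃ q : Fin (2 * P.J i), ∃ θ ∈ Ico 0 (P.L i), x = P.L i * (q : ℕ) + θ := by
  obtain ⟨q, θ, hθ, h⟩ := P.exists_arc i x
  have : Fact (0 < 2 * Real.pi) := ⟨Real.two_pi_pos⟩
  exact ⟨q, θ, hθ, (AddCircle.coe_eq_coe_iff_of_mem_Ico (a := 0) (by simpa using hx)
    (by simpa using arc_mem_Ico q hθ)).1 h⟩

theorem exists_cellMap {i : ℕ} (x : P.F i) :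
    ∃ α, ∃ θ ∈ Ico 0 (P.L i), P.cellMap i α θ = x := by
  obtain ⟨w, hw⟩ := exists_point x
  obtain ⟨q, θ, hθ, h⟩ := P.exists_arc i (P.angle i x)
  exact ⟨(q, w), θ, hθ, by rw [cellMap_eq, ← h, hw]⟩

theorem arc_notMem_vertexAngles {i : ℕ} {q : Fin (2 * P.J i)} {θ : ℝ} (hθ : θ ∈ Ioo 0 (P.L i)) :
    ((P.L i * (q : ℕ) + θ : ℝ) : Circ) ∉ P.vertexAngles i := by
  rintro ⟨k, hk, h⟩
  have := coe_arc_injective (q := q) (q' := ⟨k, hk⟩) (θ' := 0) ⟨hθ.1.le, hθ.2⟩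
    ⟨le_rfl, P.L_pos i⟩ (by simpa using h)
  exact hθ.1.ne' this.2

/-- The arc which follows a given arc of length `L_i` on the circle. -/
def nextArc (i : ℕ) (q : Fin (2 * P.J i)) : Fin (2 * P.J i) :=
  ⟨(q + 1) % (2 * P.J i), Nat.mod_lt _ (Nat.mul_pos two_pos (P.J_pos i))⟩

theorem cellMap_L (i : ℕ) (α : P.Cell i) :
    P.cellMap i α (P.L i) = P.cellMap i (nextArc i α.1, α.2) 0 := by
  rw [cellMap_eq, cellMap_eq]
  congr 1
  have hq := α.1.2
  obtain ⟨-, hL2⟩ := P.L_mul i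
  simp only [nextArc, add_zero]
  rcases Nat.lt_or_ge ((α.1 : ℕ) + 1) (2 * P.J i) with h | h
  · rw [Nat.mod_eq_of_lt h]
    push_cast
    ring_nf
  · have h' : (α.1 : ℕ) + 1 = 2 * P.J i := by omega
    have h3 : P.L i * (α.1 : ℕ) + P.L i = 2 * Real.pi := by
      have h4 : (((α.1 : ℕ) : ℝ) + 1) = (2 * P.J i : ℕ) := by exact_mod_cast h'
      rw [← hL2, ← h4]
      ring
    rw [h3, h', Nat.mod_self]
    simp [AddCircle.coe_period]

/-- The choice hidden in `offset` is harmless: the angle alone determines the position modulo `L_i`,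
whichever cell serves as a witness. -/
theorem offset_cellMap {i : ℕ} (α : P.Cell i) {θ : ℝ} (hθ : θ ∈ Ico 0 (P.L i)) :
    P.offset i (P.cellMap i α θ) = θ := by
  have h : ∃ θ' : ℝ, θ' ∈ Ico 0 (P.L i) ∧ ∃ β : P.Cell i, P.cellMap i β θ' = P.cellMap i α θ :=
    ⟨θ, hθ, α, rfl⟩
  obtain ⟨h1, β, h2⟩ := Classical.epsilon_spec h
  exact (coe_arc_injective h1 hθ (point_eq_iff.1 h2).1).2

theorem offset_cellMap_L (i : ℕ) (α : P.Cell i) :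
    P.offset i (P.cellMap i α (P.L i)) = 0 := by
  rw [cellMap_L]
  exact offset_cellMap _ ⟨le_rfl, P.L_pos i⟩

/-- The angle of an interior point is not a multiple of `L_i`, hence not of any coarser `L_l`, so no
letter of it can be changed by a gluing. -/
theorem cellMap_injective {i : ℕ} {α β : P.Cell i} {θ θ' : ℝ} (hθ : θ ∈ Ioo 0 (P.L i))
    (hθ' : θ' ∈ Ico 0 (P.L i)) (h : P.cellMap i α θ = P.cellMap i β θ') : α = β ∧ θ = θ' := by
  obtain ⟨h1, h2⟩ := point_eq_iff.1 h
  obtain ⟨h3, h4⟩ := coe_arc_injective ⟨hθ.1.le, hθ.2⟩ hθ' h1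
  refine ⟨Prod.ext h3 (funext fun l => (h2 l).resolve_right fun h5 => ?_), h4⟩
  exact arc_notMem_vertexAngles hθ (vertexAngles_mono (show (l : ℕ) + 1 ≤ i from l.2) h5)

theorem cellMap_mem_cell {i : ℕ} {α β : P.Cell i} {θ : ℝ} (hθ : θ ∈ Ioo 0 (P.L i)) :
    P.cellMap i α θ ∈ P.cell i β ↔ α = β := by
  constructor
  · rintro ⟨θ', hθ', h⟩
    rcases hθ'.2.lt_or_eq with h1 | h1
    · exact (cellMap_injective hθ ⟨hθ'.1, h1⟩ h.symm).1
    · rw [h1, cellMap_L] at h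
      exact absurd (cellMap_injective hθ ⟨le_rfl, P.L_pos i⟩ h.symm).2 hθ.1.ne'
  · rintro rfl
    exact ⟨θ, ⟨hθ.1.le, hθ.2.le⟩, rfl⟩

theorem sameCell_cellMap {i : ℕ} {α β : P.Cell i} {θ θ' : ℝ} (hθ : θ ∈ Ioo 0 (P.L i))
    (hθ' : θ' ∈ Ioo 0 (P.L i)) :
    P.SameCell i (P.cellMap i α θ) (P.cellMap i β θ') ↔ α = β := by
  simp only [SameCell, cellMap_mem_cell hθ, cellMap_mem_cell hθ']
  exact ⟨fun ⟨γ, h1, h2⟩ => h1.trans h2.symm, fun h => ⟨β, h, rfl⟩⟩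

theorem sameBundle_cellMap {i : ℕ} {α β : P.Cell i} {θ θ' : ℝ} (hθ : θ ∈ Ioo 0 (P.L i))
    (hθ' : θ' ∈ Ioo 0 (P.L i)) :
    P.SameBundle i (P.cellMap i α θ) (P.cellMap i β θ') ↔ P.Bundled i α β := by
  simp only [SameBundle, cellMap_mem_cell hθ, cellMap_mem_cell hθ']
  exact ⟨fun ⟨γ, δ, h, h1, h2⟩ => by rwa [h1, h2], fun h => ⟨α, β, h, rfl, rfl⟩⟩

theorem bundled_iff {i : ℕ} {α β : P.Cell (i + 1)} :
    P.Bundled (i + 1) α β ↔ α.1 = β.1 ∧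
      (fun l : Fin i => α.2 l.castSucc) = fun l : Fin i => β.2 l.castSucc := by
  refine and_congr_right fun _ => ⟨fun h => funext fun l => h l.castSucc ?_, fun h l hl => ?_⟩
  · simp
  · have := congr_fun h (⟨l, by omega⟩ : Fin i)
    exact this

/-- Cells of the same bundle have the same starting point. -/
theorem Bundled.cellMap_zero {i : ℕ} {α β : P.Cell i} (h : P.Bundled i α β) :
    P.cellMap i α 0 = P.cellMap i β 0 := by
  rw [cellMap_eq, cellMap_eq, point_eq_iff, h.1]
  refine ⟨rfl, fun l => ?_⟩
  by_cases hl : (l : ℕ) + 1 < i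
  · exact Or.inl (h.2 l hl)
  · have : (l : ℕ) + 1 = i := by omega
    exact Or.inr ⟨β.1, by rw [this]; exact β.1.2, by simp [this]⟩

/-- Cells of the same bundle have the same end point. -/
theorem Bundled.cellMap_L {i : ℕ} {α β : P.Cell i} (h : P.Bundled i α β) :
    P.cellMap i α (P.L i) = P.cellMap i β (P.L i) := by
  rw [Parameters.cellMap_L, Parameters.cellMap_L]
  exact Bundled.cellMap_zero ⟨congr_arg (nextArc i) h.1, h.2⟩

/-! ### Measurability and integration on the finite approximations -/

theorem measurable_angle (i : ℕ) : Measurable (P.angle i) := by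
  induction i with
  | zero => exact measurable_id
  | succ i ih =>
    intro s hs
    exact (ih.comp measurable_fst) hs

theorem measurableSet_iff_point {i : ℕ} {s : Set (P.F i)} :
    MeasurableSet s ↔ ∀ w, MeasurableSet {η | P.point i η w ∈ s} := by
  constructor
  · intro hs w
    exact ((P.measurable_point i).comp (measurable_id.prodMk measurable_const)) hs
  · induction i with
    | zero => exact fun h => h (fun l => l.elim0)
    | succ i ih =>
      intro h
      change MeasurableSet (P.glue i ⁻¹' s)
      have h1 : P.glue i ⁻¹' s =
          ⋃ a : Fin (P.n (i + 1)), {y | P.glue i (y, a) ∈ s} ×ˢ {a} := by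
        ext ⟨y, a⟩
        simp
      rw [h1]
      refine MeasurableSet.iUnion fun a => MeasurableSet.prod (ih fun w => ?_)
        (measurableSet_singleton a)
      have h2 := h (Fin.snoc (α := fun l : Fin (i + 1) => Fin (P.n (l + 1))) w a)
      simpa [point] using h2

theorem measurable_cellMap (i : ℕ) (α : P.Cell i) : Measurable (P.cellMap i α) :=
  (P.measurable_point i).comp (f := fun θ : ℝ => (((P.L i * (α.1 : ℕ) + θ : ℝ) : Circ), α.2))
    ((measurable_coe_circ.comp (measurable_const.add measurable_id)).prodMk measurable_const)

/-- There are finitely many vertices, so the open cells decide. The half-open arcs inject into the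
circle, and injective measurable images of Borel sets of reals are Borel. -/
theorem measurableSet_of_cellMap {i : ℕ} {s : Set (P.F i)}
    (hs : ∀ α, MeasurableSet (P.cellMap i α ⁻¹' s ∩ Ioo 0 (P.L i))) : MeasurableSet s := by
  rw [measurableSet_iff_point]
  intro w
  have h1 : {η | P.point i η w ∈ s} = ⋃ q : Fin (2 * P.J i),
      (fun θ : ℝ => ((P.L i * (q : ℕ) + θ : ℝ) : Circ)) ''
        (P.cellMap i (q, w) ⁻¹' s ∩ Ico 0 (P.L i)) := by
    ext η
    simp only [mem_ofPred_eq, mem_iUnion, mem_image, mem_inter_iff, mem_preimage]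
    constructor
    · intro h
      obtain ⟨q, θ, hθ, rfl⟩ := P.exists_arc i η
      exact ⟨q, θ, ⟨h, hθ⟩, rfl⟩
    · rintro ⟨q, θ, ⟨h, hθ⟩, rfl⟩
      exact h
  have : Fact (0 < 2 * Real.pi) := ⟨Real.two_pi_pos⟩
  rw [h1]
  refine MeasurableSet.iUnion fun q => MeasurableSet.image_of_measurable_injOn ?_
    (measurable_coe_circ.comp (measurable_const.add measurable_id)) ?_
  · rcases em (P.cellMap i (q, w) 0 ∈ s) with h0 | h0
    · have : P.cellMap i (q, w) ⁻¹' s ∩ Ico 0 (P.L i) =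
          (P.cellMap i (q, w) ⁻¹' s ∩ Ioo 0 (P.L i)) ∪ {0} := by
        ext θ
        simp only [mem_inter_iff, mem_preimage, mem_Ico, mem_union, mem_Ioo, mem_singleton_iff]
        constructor
        · rintro ⟨h, h1, h2⟩
          rcases h1.lt_or_eq with h3 | h3
          · exact Or.inl ⟨h, h3, h2⟩
          · exact Or.inr h3.symm
        · rintro (⟨h, h1, h2⟩ | rfl)
          · exact ⟨h, h1.le, h2⟩
          · exact ⟨h0, le_rfl, P.L_pos i⟩
      rw [this]
      exact (hs _).union (measurableSet_singleton 0)
    · have : P.cellMap i (q, w) ⁻¹' s ∩ Ico 0 (P.L i) =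
          P.cellMap i (q, w) ⁻¹' s ∩ Ioo 0 (P.L i) := by
        ext θ
        simp only [mem_inter_iff, mem_preimage, mem_Ico, mem_Ioo]
        constructor
        · rintro ⟨h, h1, h2⟩
          rcases h1.lt_or_eq with h3 | h3
          · exact ⟨h, h3, h2⟩
          · rw [← h3] at h
            exact absurd h h0
        · rintro ⟨h, h1, h2⟩
          exact ⟨h, h1.le, h2⟩
      rw [this]
      exact hs _
  · intro θ hθ θ' hθ' h
    exact (coe_arc_injective hθ.2 hθ'.2 h).2

theorem measurable_of_cellMap {i : ℕ} {E : Type*} [MeasurableSpace E] {f : P.F i → E}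
    {G : P.Cell i → ℝ → E} (hG : ∀ α, Measurable (G α))
    (h : ∀ α, ∀ θ ∈ Ioo 0 (P.L i), f (P.cellMap i α θ) = G α θ) : Measurable f := by
  intro s hs
  refine measurableSet_of_cellMap fun α => ?_
  have : P.cellMap i α ⁻¹' (f ⁻¹' s) ∩ Ioo 0 (P.L i) = G α ⁻¹' s ∩ Ioo 0 (P.L i) := by
    ext θ
    simp only [mem_inter_iff, mem_preimage, and_congr_left_iff]
    intro hθ
    rw [h α θ hθ]
  rw [this]
  exact (hG α hs).inter measurableSet_Ioo

theorem integral_mu {i : ℕ} {f : P.F i → ℂ} (hf : Measurable f) {C : ℝ}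
    (hC : ∀ α, ∀ θ ∈ Ioo 0 (P.L i), ‖f (P.cellMap i α θ)‖ ≤ C) :
    ∫ x, f x ∂P.mu i = (P.N i : ℂ)⁻¹ * ∑ α : P.Cell i, ∫ θ in 0..P.L i, f (P.cellMap i α θ) := by
  have hN : (P.N i : ENNReal)⁻¹ ≠ ⊤ := by
    simp [(P.N_pos i).ne']
  have hint : ∀ α, Integrable f (Measure.map (P.cellMap i α) (volume.restrict (Icc 0 (P.L i)))) := by
    intro α
    rw [integrable_map_measure hf.aestronglyMeasurable (measurable_cellMap i α).aemeasurable,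
      ← Measure.restrict_congr_set Ioo_ae_eq_Icc]
    refine Measure.integrableOn_of_bounded (M := C) (by simp)
      (hf.comp (measurable_cellMap i α)).aestronglyMeasurable ?_
    exact (ae_restrict_iff' measurableSet_Ioo).2 (ae_of_all _ (hC α))
  rw [mu, integral_finsetSum_measure fun α _ => (hint α).smul_measure hN, Finset.mul_sum]
  refine Finset.sum_congr rfl fun α _ => ?_
  rw [integral_smul_measure, integral_map (measurable_cellMap i α).aemeasurable
    hf.aestronglyMeasurable, intervalIntegral.integral_of_le (P.L_pos i).le,
    integral_Icc_eq_integral_Ioc]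
  simp [Complex.real_smul]

end Parameters
end DiamondFractal
end

/-! ### Martingale decomposition over the letters -/

noncomputable section

namespace DiamondFractal

theorem eLpNorm_two_sq {Ω E : Type*} [MeasurableSpace Ω] [NormedAddCommGroup E] (μ : Measure Ω)
    (f : Ω → E) : eLpNorm f 2 μ ^ 2 = ∫⁻ x, ‖f x‖ₑ ^ 2 ∂μ := by
  have h := eLpNorm_nnreal_pow_eq_lintegral (μ := μ) (f := f) (p := 2) two_ne_zero
  have h2 : ((2 : NNReal) : ℝ) = ((2 : ℕ) : ℝ) := by norm_num
  rw [h2] at h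
  simp only [ENNReal.rpow_natCast] at h
  exact_mod_cast h

namespace Parameters

variable (P : Parameters)

/-- The space of infinite words. -/
abbrev InfWord : Type := (l : ℕ) → Fin (P.n (l + 1))

/-- The uniform distribution on infinite words. -/
def wordMeasure : Measure P.InfWord :=
  Measure.infinitePi fun l => ProbabilityTheory.uniformOn (univ : Set (Fin (P.n (l + 1))))

instance : IsProbabilityMeasure P.wordMeasure := by
  unfold wordMeasure
  infer_instance

/-- The first `i` letters of an infinite word. -/
def prefixWord (i : ℕ) (ω : P.InfWord) : P.Word i := fun l => ω l

theorem measurable_prefixWord (i : ℕ) : Measurable (P.prefixWord i) :=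
  measurable_pi_lambda _ fun l => measurable_pi_apply (l : ℕ)

/-- The infinite words with given first letters. -/
def cylinder (i : ℕ) (v : P.Word i) : Set P.InfWord := P.prefixWord i ⁻¹' {v}

theorem measurableSet_cylinder (i : ℕ) (v : P.Word i) : MeasurableSet (P.cylinder i v) :=
  P.measurable_prefixWord i (measurableSet_singleton v)

theorem wordMeasure_cylinder (i : ℕ) (v : P.Word i) :
    P.wordMeasure (P.cylinder i v) = (P.N i : ENNReal)⁻¹ := P.infinitePi_word i v

theorem wordMeasure_real_cylinder (i : ℕ) (v : P.Word i) :
    P.wordMeasure.real (P.cylinder i v) = (P.N i : ℝ)⁻¹ := by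
  simp [measureReal_def, wordMeasure_cylinder]

/-- The filtration of the first letters. -/
def wordFiltration : Filtration ℕ (inferInstance : MeasurableSpace P.InfWord) where
  seq i := MeasurableSpace.comap (P.prefixWord i) inferInstance
  mono' := by
    intro i j h
    have : P.prefixWord i = (fun (w : P.Word j) (l : Fin i) => w (Fin.castLE h l)) ∘
      P.prefixWord j := rfl
    dsimp only
    rw [this, ← MeasurableSpace.comap_comp]
    exact MeasurableSpace.comap_mono
      (measurable_pi_lambda _ fun l => measurable_pi_apply (Fin.castLE h l)).comap_le
  le' i := (P.measurable_prefixWord i).comap_le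

theorem iSup_wordFiltration :
    ⨆ i, P.wordFiltration i = (inferInstance : MeasurableSpace P.InfWord) := by
  refine le_antisymm (iSup_le fun i => P.wordFiltration.le i) ?_
  refine iSup_le fun l => ?_
  refine le_trans ?_ (le_iSup _ (l + 1))
  have : (fun ω : P.InfWord => ω l) =
      (fun w : P.Word (l + 1) => w (Fin.last l)) ∘ P.prefixWord (l + 1) := rfl
  rw [this, ← MeasurableSpace.comap_comp]
  exact MeasurableSpace.comap_mono (measurable_pi_apply (Fin.last l)).comap_le

section Mean

variable {E : Type*} [NormedAddCommGroup E] [NormedSpace ℝ E]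

/-- The mean of a function over the words with the same first letters. -/
def cylinderMean (g : P.InfWord → E) (i : ℕ) (ω : P.InfWord) : E :=
  (P.N i : ℝ) • ∫ ω' in P.cylinder i (P.prefixWord i ω), g ω' ∂P.wordMeasure

/-- The σ-algebra of the first `i` letters has finitely many atoms, the cylinders, each of mass `1 /
N_i`; conditioning is averaging over the atoms. -/
theorem cylinderMean_ae_eq_condExp [CompleteSpace E] {g : P.InfWord → E}
    (hg : Integrable g P.wordMeasure) (i : ℕ) :
    P.cylinderMean g i =ᵐ[P.wordMeasure] P.wordMeasure[g | P.wordFiltration i] := by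
  have hF : ∀ v : P.Word i, ∀ ω ∈ P.cylinder i v, P.cylinderMean g i ω =
      (P.N i : ℝ) • ∫ ω' in P.cylinder i v, g ω' ∂P.wordMeasure := by
    rintro v ω rfl
    rfl
  have hmeas : StronglyMeasurable[P.wordFiltration i] (P.cylinderMean g i) := by
    have h1 : StronglyMeasurable fun v : P.Word i =>
        (P.N i : ℝ) • ∫ ω' in P.cylinder i v, g ω' ∂P.wordMeasure := StronglyMeasurable.of_discrete
    exact h1.comp_measurable (comap_measurable (P.prefixWord i))
  have hint : Integrable (P.cylinderMean g i) P.wordMeasure := by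
    have h1 : Integrable (fun v : P.Word i =>
        (P.N i : ℝ) • ∫ ω' in P.cylinder i v, g ω' ∂P.wordMeasure)
        (Measure.map (P.prefixWord i) P.wordMeasure) := by
      have : IsFiniteMeasure (Measure.map (P.prefixWord i) P.wordMeasure) :=
        Measure.isFiniteMeasure_map _ _
      exact Integrable.of_finite
    exact h1.comp_measurable (P.measurable_prefixWord i)
  refine ae_eq_condExp_of_forall_setIntegral_eq (P.wordFiltration.le i) hg
    (fun s _ _ => hint.integrableOn) ?_ hmeas.aestronglyMeasurable
  rintro s ⟨S, -, rfl⟩ -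
  classical
  have hS : P.prefixWord i ⁻¹' S = ⋃ v ∈ S.toFinset, P.cylinder i v := by
    ext ω
    simp [cylinder]
  have hd : (S.toFinset : Set (P.Word i)).Pairwise (Function.onFun Disjoint (P.cylinder i)) := by
    intro v _ v' _ h
    exact Set.disjoint_left.2 fun ω h1 h2 => h (h1.symm.trans h2)
  rw [hS, integral_biUnion_finset _ (fun v _ => P.measurableSet_cylinder i v) hd
    (fun v _ => hint.integrableOn), integral_biUnion_finset _
    (fun v _ => P.measurableSet_cylinder i v) hd (fun v _ => hg.integrableOn)]
  refine Finset.sum_congr rfl fun v _ => ?_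
  rw [setIntegral_congr_fun (P.measurableSet_cylinder i v) (hF v), setIntegral_const,
    wordMeasure_real_cylinder, smul_smul, inv_mul_cancel₀, one_smul]
  exact_mod_cast (P.N_pos i).ne'

end Mean

/-- Lévy's upward theorem, since the finite prefixes generate the full product σ-algebra. -/
theorem tendsto_cylinderMean_real {g : P.InfWord → ℝ} (hg : Integrable g P.wordMeasure) :
    ∀ᵐ ω ∂P.wordMeasure, Tendsto (fun i => P.cylinderMean g i ω) atTop (𝓝 (g ω)) := by
  have h1 := tendsto_ae_condExp (μ := P.wordMeasure) (ℱ := P.wordFiltration) g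
  have h2 : P.wordMeasure[g | ⨆ i, P.wordFiltration i] =ᵐ[P.wordMeasure] g := by
    rw [iSup_wordFiltration]
    exact condExp_of_aestronglyMeasurable' le_rfl hg.aestronglyMeasurable hg
  filter_upwards [h1, h2, ae_all_iff.2 (P.cylinderMean_ae_eq_condExp hg)] with ω h1 h2 h3
  simp only [h3, ← h2]
  exact h1

theorem tendsto_cylinderMean {g : P.InfWord → ℂ} (hg : Integrable g P.wordMeasure) :
    ∀ᵐ ω ∂P.wordMeasure, Tendsto (fun i => P.cylinderMean g i ω) atTop (𝓝 (g ω)) := by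
  filter_upwards [P.tendsto_cylinderMean_real hg.re, P.tendsto_cylinderMean_real hg.im]
    with ω h1 h2
  have h3 : ∀ i, P.cylinderMean g i ω =
      ((P.cylinderMean (E := ℝ) (fun ω => RCLike.re (g ω)) i ω : ℝ) : ℂ) +
        ((P.cylinderMean (E := ℝ) (fun ω => RCLike.im (g ω)) i ω : ℝ) : ℂ) * Complex.I := by
    intro i
    simp only [cylinderMean]
    rw [integral_re hg.integrableOn, integral_im hg.integrableOn]
    apply Complex.ext <;> simp
  simp only [h3]
  have h4 := ((Complex.continuous_ofReal.tendsto _).comp h1).add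
    (((Complex.continuous_ofReal.tendsto _).comp h2).mul_const Complex.I)
  simpa only [Function.comp_def, RCLike.re_to_complex, RCLike.im_to_complex, Complex.re_add_im]
    using h4

/-- The sum of the squared means over the words of length `i`. -/
def energy (g : P.InfWord → ℂ) (i : ℕ) : ℝ :=
  P.N i * ∑ v, ‖∫ ω in P.cylinder i v, g ω ∂P.wordMeasure‖ ^ 2

theorem lintegral_prefixWord (i : ℕ) (F : P.Word i → ENNReal) :
    ∫⁻ ω, F (P.prefixWord i ω) ∂P.wordMeasure = (P.N i : ENNReal)⁻¹ * ∑ v, F v := by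
  rw [← lintegral_map (f := F) Measurable.of_discrete (P.measurable_prefixWord i),
    lintegral_fintype, Finset.mul_sum]
  refine Finset.sum_congr rfl fun v _ => ?_
  rw [Measure.map_apply (P.measurable_prefixWord i) (measurableSet_singleton v), mul_comm]
  exact congr_arg (· * F v) (P.wordMeasure_cylinder i v)

theorem lintegral_cylinderMean_sq (g : P.InfWord → ℂ) (i : ℕ) :
    ∫⁻ ω, ‖P.cylinderMean g i ω‖ₑ ^ 2 ∂P.wordMeasure = ENNReal.ofReal (P.energy g i) := by
  have hN : (0 : ℝ) < P.N i := by exact_mod_cast P.N_pos i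
  unfold cylinderMean
  rw [P.lintegral_prefixWord i
    (fun v => ‖(P.N i : ℝ) • ∫ ω' in P.cylinder i v, g ω' ∂P.wordMeasure‖ₑ ^ 2)]
  have h1 : ∀ v : P.Word i, ‖(P.N i : ℝ) • ∫ ω' in P.cylinder i v, g ω' ∂P.wordMeasure‖ₑ ^ 2 =
      ENNReal.ofReal (P.N i ^ 2 * ‖∫ ω in P.cylinder i v, g ω ∂P.wordMeasure‖ ^ 2) := by
    intro v
    rw [← ofReal_norm, ← ENNReal.ofReal_pow (norm_nonneg _), norm_smul, mul_pow]
    simp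
  have h2 : (P.N i : ENNReal)⁻¹ = ENNReal.ofReal ((P.N i : ℝ)⁻¹) := by
    rw [ENNReal.ofReal_inv_of_pos hN, ENNReal.ofReal_natCast]
  simp only [h1]
  rw [h2, ← ENNReal.ofReal_sum_of_nonneg fun v _ => by positivity,
    ← ENNReal.ofReal_mul (by positivity), energy, ← Finset.mul_sum]
  congr 1
  field_simp

/-- Conditional expectation contracts the `L²` norm, which bounds the upper limit; almost sure
convergence and Fatou's lemma bound the lower limit. -/
theorem tendsto_energy {g : P.InfWord → ℂ} (hg : MemLp g 2 P.wordMeasure) :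
    Tendsto (fun i => ENNReal.ofReal (P.energy g i)) atTop
      (𝓝 (∫⁻ ω, ‖g ω‖ₑ ^ 2 ∂P.wordMeasure)) := by
  have hi : Integrable g P.wordMeasure := hg.integrable one_le_two
  have h1 : ∀ i, eLpNorm (P.cylinderMean g i) 2 P.wordMeasure ≤ eLpNorm g 2 P.wordMeasure := by
    intro i
    rw [eLpNorm_congr_ae (P.cylinderMean_ae_eq_condExp hi i)]
    exact eLpNorm_condExp_le_eLpNorm g one_le_two
  have h2 : eLpNorm g 2 P.wordMeasure ≤
      liminf (fun i => eLpNorm (P.cylinderMean g i) 2 P.wordMeasure) atTop := by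
    refine Lp.eLpNorm_lim_le_liminf_eLpNorm (fun i => ?_) g (P.tendsto_cylinderMean hi)
    exact (stronglyMeasurable_condExp.mono
      (P.wordFiltration.le i)).aestronglyMeasurable.congr
        (P.cylinderMean_ae_eq_condExp hi i).symm
  have h3 : Tendsto (fun i => eLpNorm (P.cylinderMean g i) 2 P.wordMeasure) atTop
      (𝓝 (eLpNorm g 2 P.wordMeasure)) :=
    tendsto_of_le_liminf_of_limsup_le h2 (limsup_le_of_le (h := .of_forall h1))
  have h4 := (ENNReal.continuous_pow 2).tendsto _ |>.comp h3
  simpa only [Function.comp_def, eLpNorm_two_sq, lintegral_cylinderMean_sq] using h4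

/-- The function of the word which belongs to the letters `v`: a multiple of the indicator of the
cylinder of `v` minus its mean over the last letter. -/
def wordFun (i : ℕ) (v : P.Word (i + 1)) (ω : P.InfWord) : ℝ :=
  (P.cylinder (i + 1) v).indicator 1 ω -
    (P.n (i + 1) : ℝ)⁻¹ * (P.cylinder i (fun l => v l.castSucc)).indicator 1 ω

theorem measurable_wordFun (i : ℕ) (v : P.Word (i + 1)) : Measurable (P.wordFun i v) :=
  (measurable_one.indicator (P.measurableSet_cylinder _ _)).sub
    ((measurable_one.indicator (P.measurableSet_cylinder _ _)).const_mul _)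

theorem integral_wordFun_mul {g : P.InfWord → ℂ} (hg : Integrable g P.wordMeasure) (i : ℕ)
    (v : P.Word (i + 1)) :
    ∫ ω, P.wordFun i v ω * g ω ∂P.wordMeasure =
      ∫ ω in P.cylinder (i + 1) v, g ω ∂P.wordMeasure - (P.n (i + 1) : ℂ)⁻¹ *
        ∫ ω in P.cylinder i (fun l => v l.castSucc), g ω ∂P.wordMeasure := by
  have h1 : ∀ ω, P.wordFun i v ω * g ω = (P.cylinder (i + 1) v).indicator g ω -
      (P.n (i + 1) : ℂ)⁻¹ * (P.cylinder i (fun l => v l.castSucc)).indicator g ω := by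
    intro ω
    by_cases ha : ω ∈ P.cylinder (i + 1) v <;>
      by_cases hb : ω ∈ P.cylinder i (fun l => v l.castSucc) <;>
      simp [wordFun, ha, hb, sub_mul]
  simp only [h1]
  rw [integral_sub (hg.indicator (P.measurableSet_cylinder _ _))
    ((hg.indicator (P.measurableSet_cylinder _ _)).const_mul _), integral_const_mul,
    integral_indicator (P.measurableSet_cylinder _ _),
    integral_indicator (P.measurableSet_cylinder _ _)]

/-- Words of length `i + 1` are words of length `i` with one more letter. -/
def wordEquiv (i : ℕ) : Fin (P.n (i + 1)) × P.Word i ≃ P.Word (i + 1) :=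
  Fin.snocEquiv fun l : Fin (i + 1) => Fin (P.n (l + 1))

theorem wordEquiv_castSucc (i : ℕ) (a : Fin (P.n (i + 1))) (v : P.Word i) (l : Fin i) :
    P.wordEquiv i (a, v) l.castSucc = v l :=
  Fin.snoc_castSucc (α := fun l : Fin (i + 1) => Fin (P.n (l + 1))) a v l

theorem wordEquiv_last (i : ℕ) (a : Fin (P.n (i + 1))) (v : P.Word i) :
    P.wordEquiv i (a, v) (Fin.last i) = a :=
  Fin.snoc_last (α := fun l : Fin (i + 1) => Fin (P.n (l + 1))) a v

theorem sum_cylinder {g : P.InfWord → ℂ} (hg : Integrable g P.wordMeasure) (i : ℕ)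
    (v : P.Word i) :
    ∑ a, ∫ ω in P.cylinder (i + 1) (P.wordEquiv i (a, v)), g ω ∂P.wordMeasure =
      ∫ ω in P.cylinder i v, g ω ∂P.wordMeasure := by
  have h : P.cylinder i v = ⋃ a ∈ (Finset.univ : Finset (Fin (P.n (i + 1)))),
      P.cylinder (i + 1) (P.wordEquiv i (a, v)) := by
    ext ω
    simp only [cylinder, mem_preimage, mem_singleton_iff, Finset.mem_univ, iUnion_true, mem_iUnion]
    constructor
    · rintro rfl
      refine ⟨ω i, funext fun l => ?_⟩
      cases l using Fin.lastCases with
      | last => rw [wordEquiv_last]; rfl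
      | cast l => rw [wordEquiv_castSucc]; rfl
    · rintro ⟨a, h⟩
      funext l
      rw [← P.wordEquiv_castSucc i a v l, ← h]
      rfl
  rw [h, integral_biUnion_finset _ (fun a _ => P.measurableSet_cylinder _ _) ?_
    (fun a _ => hg.integrableOn)]
  intro a _ b _ hab
  refine Set.disjoint_left.2 fun ω h1 h2 => hab ?_
  have h3 := (show P.wordEquiv i (a, v) = P.wordEquiv i (b, v) from
    (show _ = _ from h1).symm.trans h2)
  simpa using h3

/-- The variance identity, that is, Pythagoras for the projection of `ℂⁿ` along the constants. -/
theorem sum_norm_sub_mean_sq {n : ℕ} (hn : 0 < n) (a : Fin n → ℂ) :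
    ∑ w, ‖a w - (n : ℂ)⁻¹ * ∑ u, a u‖ ^ 2 = ∑ w, ‖a w‖ ^ 2 - (n : ℝ)⁻¹ * ‖∑ u, a u‖ ^ 2 := by
  have hn' : (n : ℝ) ≠ 0 := by exact_mod_cast hn.ne'
  have h1 : ∀ w, ‖a w - (n : ℂ)⁻¹ * ∑ u, a u‖ ^ 2 = ‖a w‖ ^ 2 -
      2 * (n : ℝ)⁻¹ * ((a w).re * (∑ u, a u).re + (a w).im * (∑ u, a u).im) +
        (n : ℝ)⁻¹ ^ 2 * ‖∑ u, a u‖ ^ 2 := by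
    intro w
    have h2 : (n : ℂ)⁻¹ = (((n : ℝ)⁻¹ : ℝ) : ℂ) := by push_cast; rfl
    rw [h2]
    simp only [Complex.sq_norm, Complex.normSq_apply, Complex.sub_re, Complex.sub_im,
      Complex.re_ofReal_mul, Complex.im_ofReal_mul]
    ring
  simp only [h1]
  rw [Finset.sum_add_distrib, Finset.sum_sub_distrib, ← Finset.mul_sum, Finset.sum_add_distrib,
    ← Finset.sum_mul, ← Finset.sum_mul, ← Complex.re_sum, ← Complex.im_sum]
  simp only [Finset.sum_const, Finset.card_univ, Fintype.card_fin, nsmul_eq_mul, Complex.sq_norm,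
    Complex.normSq_apply]
  field_simp
  ring

/-- Orthogonality of martingale differences. A cylinder splits according to the next letter, and the
factor `1 / n_{i+1}` in the variance identity turns `N_{i+1}` back into `N_i`. -/
theorem energy_succ {g : P.InfWord → ℂ} (hg : Integrable g P.wordMeasure) (i : ℕ) :
    P.energy g (i + 1) = P.energy g i +
      P.N (i + 1) * ∑ v, ‖∫ ω, P.wordFun i v ω * g ω ∂P.wordMeasure‖ ^ 2 := by
  have hn : (P.n (i + 1) : ℝ) ≠ 0 := by exact_mod_cast (P.n_pos i).ne'
  simp only [energy, P.integral_wordFun_mul hg]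
  rw [← (P.wordEquiv i).sum_comp, ← (P.wordEquiv i).sum_comp, Fintype.sum_prod_type_right,
    Fintype.sum_prod_type_right]
  have h1 : ∀ (v : P.Word i) (a : Fin (P.n (i + 1))),
      (fun l : Fin i => P.wordEquiv i (a, v) l.castSucc) = v :=
    fun v a => funext fun l => P.wordEquiv_castSucc i a v l
  simp only [h1]
  simp only [← P.sum_cylinder hg i, sum_norm_sub_mean_sq (P.n_pos i)]
  rw [Finset.sum_sub_distrib, ← Finset.mul_sum, N_succ]
  push_cast
  field_simp
  ring

/-- Parseval's identity on the space of infinite words. -/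
theorem parseval_word {g : P.InfWord → ℂ} (hg : MemLp g 2 P.wordMeasure) :
    ‖∫ ω, g ω ∂P.wordMeasure‖ₑ ^ 2 + ∑' i, ∑ v, (P.N (i + 1) : ENNReal) *
      ‖∫ ω, P.wordFun i v ω * g ω ∂P.wordMeasure‖ₑ ^ 2 = ∫⁻ ω, ‖g ω‖ₑ ^ 2 ∂P.wordMeasure := by
  have hi : Integrable g P.wordMeasure := hg.integrable one_le_two
  refine tendsto_nhds_unique ?_ (P.tendsto_energy hg)
  have h0 : ∀ i, ∑ v, (P.N (i + 1) : ENNReal) *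
      ‖∫ ω, P.wordFun i v ω * g ω ∂P.wordMeasure‖ₑ ^ 2 = ENNReal.ofReal (P.N (i + 1) *
        ∑ v, ‖∫ ω, P.wordFun i v ω * g ω ∂P.wordMeasure‖ ^ 2) := by
    intro i
    rw [Finset.mul_sum, ENNReal.ofReal_sum_of_nonneg fun v _ => by positivity]
    refine Finset.sum_congr rfl fun v _ => ?_
    rw [ENNReal.ofReal_mul (by positivity), ENNReal.ofReal_natCast,
      ENNReal.ofReal_pow (norm_nonneg _), ofReal_norm]
  have hnn : ∀ i, 0 ≤ P.energy g i := fun i => by unfold energy; positivity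
  -- The energies telescope. They start at the squared mean, because the cylinder of the empty word
  -- is the whole space.
  have h1 : ∀ i, ENNReal.ofReal (P.energy g i) = ‖∫ ω, g ω ∂P.wordMeasure‖ₑ ^ 2 +
      ∑ k ∈ Finset.range i, ∑ v, (P.N (k + 1) : ENNReal) *
        ‖∫ ω, P.wordFun k v ω * g ω ∂P.wordMeasure‖ₑ ^ 2 := by
    intro i
    induction i with
    | zero =>
      have h2 : ∀ v : P.Word 0, P.cylinder 0 v = univ := fun v => by
        ext ω
        simp only [cylinder, mem_preimage, mem_singleton_iff, mem_univ, iff_true]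
        exact Subsingleton.elim _ _
      simp [energy, h2, N_zero]
    | succ i ih =>
      rw [P.energy_succ hi, ENNReal.ofReal_add (hnn i) (by positivity), ih,
        Finset.sum_range_succ, h0 i, add_assoc]
  simp only [h1]
  exact (ENNReal.tendsto_nat_tsum _).const_add _

end Parameters
end DiamondFractal
end

/-! ### Parseval's identity for Fourier and sine series -/

noncomputable section

namespace DiamondFractal

theorem enorm_sq_eq_ofReal {E : Type*} [NormedAddCommGroup E] (x : E) :
    ‖x‖ₑ ^ 2 = ENNReal.ofReal (‖x‖ ^ 2) := by
  rw [ENNReal.ofReal_pow (norm_nonneg _), ofReal_norm]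

theorem lintegral_enorm_sq {Ω E : Type*} [MeasurableSpace Ω] [NormedAddCommGroup E]
    {μ : Measure Ω} {f : Ω → E} (hf : MemLp f 2 μ) :
    ∫⁻ x, ‖f x‖ₑ ^ 2 ∂μ = ENNReal.ofReal (∫ x, ‖f x‖ ^ 2 ∂μ) := by
  rw [ofReal_integral_eq_lintegral_ofReal (by simpa using hf.integrable_norm_pow two_ne_zero)
    (ae_of_all _ fun x => by positivity)]
  simp only [enorm_sq_eq_ofReal]

/-- Parseval's identity for Fourier series on an interval. -/
theorem parseval_interval {a b : ℝ} (hab : a < b) {f : ℝ → ℂ}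
    (hf : MemLp f 2 (volume.restrict (Ioc a b))) :
    ∑' m : ℤ, ‖∫ x in a..b, fourier (-m) (x : AddCircle (b - a)) * f x‖ₑ ^ 2 =
      ENNReal.ofReal (b - a) * ∫⁻ x in Ioc a b, ‖f x‖ₑ ^ 2 := by
  have h := hasSum_sq_fourierCoeffOn hab hf
  have hba : 0 < b - a := sub_pos.2 hab
  have h1 : ∀ m : ℤ, ‖∫ x in a..b, fourier (-m) (x : AddCircle (b - a)) * f x‖ₑ ^ 2 =
      ENNReal.ofReal ((b - a) ^ 2 * ‖fourierCoeffOn hab f m‖ ^ 2) := by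
    intro m
    rw [enorm_sq_eq_ofReal, fourierCoeffOn_eq_integral]
    congr 1
    simp only [smul_eq_mul, norm_smul, mul_pow, Real.norm_eq_abs, sq_abs]
    field_simp
  simp only [h1]
  rw [← ENNReal.ofReal_tsum_of_nonneg (fun m => by positivity) (h.summable.mul_left _),
    tsum_mul_left, h.tsum_eq, lintegral_enorm_sq hf, ← ENNReal.ofReal_mul hba.le,
    intervalIntegral.integral_of_le hab.le, smul_eq_mul]
  congr 1
  field_simp

theorem tsum_int_of_even {F : ℤ → ENNReal} (h : ∀ m, F (-m) = F m) :
    ∑' m, F m = F 0 + 2 * ∑' k : ℕ, F (k + 1) := by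
  have h1 := tsum_of_nat_of_neg_add_one (f := F) ENNReal.summable ENNReal.summable
  have h2 := tsum_eq_zero_add' (f := fun k : ℕ => F k) ENNReal.summable
  simp only [h] at h1
  rw [h1, h2, two_mul, add_assoc]
  simp

/-- Parseval's identity for the sine series on an interval. -/
theorem parseval_sine {l : ℝ} (hl : 0 < l) {f : ℝ → ℂ}
    (hf : MemLp f 2 (volume.restrict (Ioo 0 l))) :
    ∑' k : ℕ, ‖∫ x in Ioo 0 l, (Real.sin ((k + 1) * (Real.pi / l) * x) : ℂ) * f x‖ₑ ^ 2 =
      ENNReal.ofReal (l / 2) * ∫⁻ x in Ioo 0 l, ‖f x‖ₑ ^ 2 := by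
  -- Odd reflection: `g x - g (-x)` lives on `(-l, l)`, its cosine parts cancel, and its `m`-th
  -- Fourier coefficient is `-2i` times the sine coefficient `S m`, up to the normalization by the
  -- length.
  set g : ℝ → ℂ := (Ioo 0 l).indicator f with hgdef
  have hg : MemLp g 2 volume := (memLp_indicator_iff_restrict measurableSet_Ioo).2 hf
  have hg0 : ∀ x, x ∉ Ioo 0 l → g x = 0 := fun x hx => indicator_of_notMem hx f
  have hgn : MemLp (fun x => g (-x)) 2 volume :=
    hg.comp_measurePreserving (Measure.measurePreserving_neg volume)
  have hll : -l < l := by linarith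
  have hp := parseval_interval hll (f := fun x => g x - g (-x)) ((hg.sub hgn).restrict _)
  have hint : Integrable g (volume.restrict (Ioc (-l) l)) :=
    (hg.restrict (Ioc (-l) l)).integrable one_le_two
  have hintn : Integrable (fun x => g (-x)) (volume.restrict (Ioc (-l) l)) :=
    (hgn.restrict (Ioc (-l) l)).integrable one_le_two
  set S : ℤ → ℂ := fun m => ∫ x in Ioo 0 l, (Real.sin (m * (Real.pi / l) * x) : ℂ) * f x with hS
  have hcoef : ∀ m : ℤ, ∫ x in (-l)..l, fourier (-m) (x : AddCircle (l - -l)) * (g x - g (-x)) =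
      -(2 * Complex.I) * S m := by
    intro m
    have hb : ∀ (φ : ℝ → ℂ), Integrable φ (volume.restrict (Ioc (-l) l)) →
        Integrable (fun x : ℝ => fourier (-m) (x : AddCircle (l - -l)) * φ x)
          (volume.restrict (Ioc (-l) l)) := by
      intro φ hφ
      have : Fact (0 < l - -l) := ⟨by linarith⟩
      refine hφ.bdd_mul (c := 1) ?_ (ae_of_all _ fun x => ?_)
      · exact ((fourier (-m)).continuous.comp
          (AddCircle.continuous_mk' (l - -l))).aestronglyMeasurable
      · rw [fourier_apply]
        exact (Circle.norm_coe _).le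
    simp only [mul_sub]
    rw [intervalIntegral.integral_sub
      ((intervalIntegrable_iff_integrableOn_Ioc_of_le hll.le).2 (hb _ hint))
      ((intervalIntegrable_iff_integrableOn_Ioc_of_le hll.le).2 (hb _ hintn))]
    have h1 : ∫ x in (-l)..l, fourier (-m) (x : AddCircle (l - -l)) * g (-x) =
        ∫ x in (-l)..l, fourier (-m) ((-x : ℝ) : AddCircle (l - -l)) * g x := by
      have := intervalIntegral.integral_comp_neg (a := -l) (b := l)
        (fun x => fourier (-m) ((-x : ℝ) : AddCircle (l - -l)) * g x)
      simp only [neg_neg] at this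
      exact this
    have hintn' : IntervalIntegrable (fun x : ℝ =>
        fourier (-m) ((-x : ℝ) : AddCircle (l - -l)) * g x) volume (-l) l := by
      refine (intervalIntegrable_iff_integrableOn_Ioc_of_le hll.le).2 ?_
      have : Fact (0 < l - -l) := ⟨by linarith⟩
      refine hint.bdd_mul (c := 1) ?_ (ae_of_all _ fun x => ?_)
      · exact ((fourier (-m)).continuous.comp
          ((AddCircle.continuous_mk' (l - -l)).comp continuous_neg)).aestronglyMeasurable
      · rw [fourier_apply]
        exact (Circle.norm_coe _).le
    rw [h1, ← intervalIntegral.integral_sub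
      ((intervalIntegrable_iff_integrableOn_Ioc_of_le hll.le).2 (hb _ hint)) hintn']
    rw [intervalIntegral.integral_of_le hll.le, ← integral_indicator measurableSet_Ioc, hS]
    simp only
    rw [← integral_indicator measurableSet_Ioo, ← integral_const_mul]
    refine integral_congr_ae (ae_of_all _ fun x => ?_)
    by_cases hx : x ∈ Ioo 0 l
    · have hx' : x ∈ Ioc (-l) l := ⟨by linarith [hx.1], hx.2.le⟩
      simp only [indicator_of_mem hx, indicator_of_mem hx', hgdef, fourier_coe_apply]
      rw [← sub_mul, ← mul_assoc]
      congr 1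
      have e1 : 2 * (Real.pi : ℂ) * Complex.I * ((-m : ℤ) : ℂ) * x / ((l - -l : ℝ) : ℂ) =
          -((m * (Real.pi / l) * x : ℝ) : ℂ) * Complex.I := by
        have : (l : ℂ) ≠ 0 := by exact_mod_cast hl.ne'
        push_cast
        field_simp
        ring
      have e2 : 2 * (Real.pi : ℂ) * Complex.I * ((-m : ℤ) : ℂ) * ((-x : ℝ) : ℂ) /
          ((l - -l : ℝ) : ℂ) = ((m * (Real.pi / l) * x : ℝ) : ℂ) * Complex.I := by
        have : (l : ℂ) ≠ 0 := by exact_mod_cast hl.ne'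
        push_cast
        field_simp
        ring
      rw [e1, e2, Complex.ofReal_sin, Complex.sin]
      ring_nf
      simp only [Complex.I_sq]
      ring
    · by_cases hx' : x ∈ Ioc (-l) l <;> simp [hg0 x hx, hx, hx']
  -- The two halves have disjoint supports, so there is no cross term.
  have hnorm : ∫⁻ x in Ioc (-l) l, ‖g x - g (-x)‖ₑ ^ 2 =
      2 * ∫⁻ x in Ioo 0 l, ‖f x‖ₑ ^ 2 := by
    have h1 : ∀ x, (Ioc (-l) l).indicator (fun x => ‖g x - g (-x)‖ₑ ^ 2) x =
        ‖g x‖ₑ ^ 2 + ‖g (-x)‖ₑ ^ 2 := by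
      intro x
      by_cases hx : x ∈ Ioo 0 l
      · have hx' : x ∈ Ioc (-l) l := ⟨by linarith [hx.1], hx.2.le⟩
        have hxn : -x ∉ Ioo 0 l := fun h => by linarith [h.1, hx.1]
        simp [hx', hg0 _ hxn]
      · by_cases hxn : -x ∈ Ioo 0 l
        · have hx' : x ∈ Ioc (-l) l := ⟨by linarith [hxn.2], by linarith [hxn.1]⟩
          simp [hx', hg0 _ hx]
        · by_cases hx' : x ∈ Ioc (-l) l <;> simp [hg0 _ hx, hg0 _ hxn, hx']
    have hm : AEMeasurable (fun x => ‖g x‖ₑ ^ 2) := by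
      have := hg.1.enorm
      fun_prop
    have h2 : ∫⁻ x, ‖g (-x)‖ₑ ^ 2 = ∫⁻ x, ‖g x‖ₑ ^ 2 :=
      lintegral_neg_eq_self (fun x => ‖g x‖ₑ ^ 2)
    rw [← lintegral_indicator measurableSet_Ioc, lintegral_congr h1, lintegral_add_left' hm,
      h2, two_mul, ← lintegral_indicator measurableSet_Ioo]
    have h3 : ∀ x, ‖g x‖ₑ ^ 2 = (Ioo 0 l).indicator (fun x => ‖f x‖ₑ ^ 2) x := by
      intro x
      by_cases hx : x ∈ Ioo 0 l <;> simp [hgdef, hx]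
    simp only [h3]
  have hneg : ∀ m : ℤ, ‖S (-m)‖ₑ = ‖S m‖ₑ := by
    intro m
    have : S (-m) = -S m := by
      rw [hS]
      simp only
      rw [← integral_neg]
      refine integral_congr_ae (ae_of_all _ fun x => ?_)
      simp
    rw [this, enorm_neg]
  have hzero : S 0 = 0 := by simp [hS]
  have h2 : ‖-(2 * Complex.I)‖ₑ ^ 2 = 4 := by
    rw [enorm_sq_eq_ofReal]
    norm_num
  have hll2 : ENNReal.ofReal (l - -l) = 4 * ENNReal.ofReal (l / 2) := by
    rw [show (4 : ENNReal) = ENNReal.ofReal 4 by norm_num, ← ENNReal.ofReal_mul (by norm_num)]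
    congr 1
    ring
  simp only [hcoef, enorm_mul, mul_pow, h2, ENNReal.tsum_mul_left] at hp
  rw [hnorm, hll2, mul_assoc,
    ENNReal.mul_right_inj (by norm_num) (by norm_num)] at hp
  -- `S` is odd, hence vanishes at `0`. The factor `2` cancels the doubling of the norm under
  -- reflection.
  have h4 : ∑' m : ℤ, ‖S m‖ₑ ^ 2 = 2 * ∑' k : ℕ, ‖S (k + 1)‖ₑ ^ 2 := by
    have h5 := tsum_int_of_even (F := fun m => ‖S m‖ₑ ^ 2) fun m => by rw [hneg]
    simpa only [hzero, enorm_zero, ne_eq, OfNat.ofNat_ne_zero, not_false_eq_true, zero_pow,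
      zero_add] using h5
  rw [h4, mul_left_comm, ENNReal.mul_right_inj (by norm_num) (by norm_num)] at hp
  rw [← hp]
  simp [hS]

end DiamondFractal
end

/-! ### Parseval's identity on the product of angles and words -/

noncomputable section

namespace DiamondFractal

/-- Lebesgue measure on `[0, 2π)`. -/
def arcLength : Measure ℝ := volume.restrict (Ico 0 (2 * Real.pi))

instance : IsFiniteMeasure arcLength := by
  unfold arcLength
  infer_instance

theorem parseval_circle {f : ℝ → ℂ} (hf : MemLp f 2 arcLength) :
    ∑' m : ℤ, ‖∫ x, fourier m (x : Circ) * f x ∂arcLength‖ₑ ^ 2 =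
      ENNReal.ofReal (2 * Real.pi) * ∫⁻ x, ‖f x‖ₑ ^ 2 ∂arcLength := by
  have hr : arcLength = volume.restrict (Ioc 0 (2 * Real.pi)) :=
    Measure.restrict_congr_set Ico_ae_eq_Ioc
  rw [hr] at hf ⊢
  have h := parseval_interval Real.two_pi_pos hf
  rw [sub_zero] at h
  rw [← h, ← (Equiv.neg ℤ).tsum_eq]
  refine tsum_congr fun m => ?_
  rw [intervalIntegral.integral_of_le Real.two_pi_pos.le]
  congr 2

namespace Parameters

variable (P : Parameters)

/-- The `k`-th Dirichlet eigenfunction of an arc of length `L_i`, without normalization. -/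
def arcFun (i : ℕ) (q : Fin (2 * P.J i)) (k : ℕ) : ℝ → ℝ :=
  (Ioo (P.L i * (q : ℕ)) (P.L i * (q : ℕ) + P.L i)).indicator
    fun η => Real.sin ((k + 1) * P.J i * (η - P.L i * (q : ℕ)))

theorem measurable_arcFun (i : ℕ) (q : Fin (2 * P.J i)) (k : ℕ) : Measurable (P.arcFun i q k) := by
  unfold arcFun
  refine Measurable.indicator ?_ measurableSet_Ioo
  fun_prop

theorem abs_arcFun_le (i : ℕ) (q : Fin (2 * P.J i)) (k : ℕ) (η : ℝ) : |P.arcFun i q k η| ≤ 1 := by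
  unfold arcFun
  by_cases h : η ∈ Ioo (P.L i * (q : ℕ)) (P.L i * (q : ℕ) + P.L i)
  · rw [indicator_of_mem h]
    exact Real.abs_sin_le_one _
  · simp [indicator_of_notMem h]

theorem arc_subset (i : ℕ) (q : Fin (2 * P.J i)) :
    Ico (P.L i * (q : ℕ)) (P.L i * (q : ℕ) + P.L i) ⊆ Ico 0 (2 * Real.pi) := by
  intro x hx
  have := arc_mem_Ico q (θ := x - P.L i * (q : ℕ)) ⟨by linarith [hx.1], by linarith [hx.2]⟩
  simpa using this

theorem pi_div_L (i : ℕ) : Real.pi / P.L i = P.J i := by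
  rw [← P.J_mul_L i]
  field_simp [(P.L_pos i).ne']

theorem parseval_arc (i : ℕ) (q : Fin (2 * P.J i)) {f : ℝ → ℂ} (hf : MemLp f 2 arcLength) :
    ∑' k : ℕ, ‖∫ x, (P.arcFun i q k x : ℂ) * f x ∂arcLength‖ₑ ^ 2 =
      ENNReal.ofReal (P.L i / 2) *
        ∫⁻ x in Ico (P.L i * (q : ℕ)) (P.L i * (q : ℕ) + P.L i), ‖f x‖ₑ ^ 2 := by
  set c : ℝ := P.L i * (q : ℕ) with hc
  set I : Set ℝ := Ioo c (c + P.L i) with hI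
  have hIs : I ⊆ Ico 0 (2 * Real.pi) := Ioo_subset_Ico_self.trans (P.arc_subset i q)
  set g : ℝ → ℂ := I.indicator f with hg
  have hgm : MemLp g 2 volume := by
    rw [memLp_indicator_iff_restrict measurableSet_Ioo]
    exact hf.mono_measure (Measure.restrict_mono hIs le_rfl)
  have hgc : MemLp (fun θ => g (θ + c)) 2 (volume.restrict (Ioo 0 (P.L i))) :=
    (hgm.comp_measurePreserving (measurePreserving_add_right volume c)).restrict _
  have hmem : ∀ θ, θ + c ∈ I ↔ θ ∈ Ioo 0 (P.L i) := by
    intro θ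
    simp only [hI, mem_Ioo]
    constructor <;> rintro ⟨h1, h2⟩ <;> constructor <;> linarith
  have h := parseval_sine (P.L_pos i) hgc
  rw [pi_div_L] at h
  have h1 : ∀ k : ℕ, ∫ x, (P.arcFun i q k x : ℂ) * f x ∂arcLength =
      ∫ θ in Ioo 0 (P.L i), (Real.sin ((k + 1) * P.J i * θ) : ℂ) * g (θ + c) := by
    intro k
    rw [arcLength, ← integral_indicator measurableSet_Ico, ← integral_indicator measurableSet_Ioo,
      ← integral_add_right_eq_self _ c]
    refine integral_congr_ae (ae_of_all _ fun θ => ?_)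
    by_cases hθ : θ ∈ Ioo 0 (P.L i)
    · have h2 := (hmem θ).2 hθ
      simp only [indicator_of_mem (hIs h2), indicator_of_mem hθ, hg, indicator_of_mem h2, arcFun,
        ← hc, ← hI, add_sub_cancel_right]
    · have h2 := mt (hmem θ).1 hθ
      simp only [indicator_of_notMem hθ]
      by_cases h3 : θ + c ∈ Ico 0 (2 * Real.pi)
      · simp only [indicator_of_mem h3, arcFun, ← hc, ← hI, indicator_of_notMem h2]
        simp
      · simp [indicator_of_notMem h3]
  simp only [h1]
  rw [h]
  congr 1
  rw [Measure.restrict_congr_set (Ioo_ae_eq_Ico (a := c) (b := c + P.L i)).symm,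
    ← lintegral_indicator measurableSet_Ioo, ← lintegral_indicator measurableSet_Ioo,
    ← lintegral_add_right_eq_self (fun x => (Ioo c (c + P.L i)).indicator
      (fun x => ‖f x‖ₑ ^ 2) x) c]
  refine lintegral_congr fun θ => ?_
  by_cases hθ : θ ∈ Ioo 0 (P.L i)
  · have h2 := (hmem θ).2 hθ
    simp only [indicator_of_mem hθ, hg, indicator_of_mem h2, ← hI]
  · have h2 := mt (hmem θ).1 hθ
    simp only [indicator_of_notMem hθ, ← hI, indicator_of_notMem h2]

theorem sum_lintegral_arc (i : ℕ) (F : ℝ → ENNReal) :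
    ∑ q : Fin (2 * P.J i), ∫⁻ x in Ico (P.L i * (q : ℕ)) (P.L i * (q : ℕ) + P.L i), F x =
      ∫⁻ x, F x ∂arcLength := by
  have h : Ico 0 (2 * Real.pi) = ⋃ q ∈ (Finset.univ : Finset (Fin (2 * P.J i))),
      Ico (P.L i * (q : ℕ)) (P.L i * (q : ℕ) + P.L i) := by
    refine Subset.antisymm (fun x hx => ?_)
      (iUnion_subset fun q => iUnion_subset fun _ => P.arc_subset i q)
    obtain ⟨q, θ, hθ, rfl⟩ := P.exists_arc_real i hx
    simp only [Finset.mem_univ, iUnion_true, mem_iUnion]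
    exact ⟨q, by linarith [hθ.1], by linarith [hθ.2]⟩
  rw [arcLength, h, lintegral_biUnion_finset _ (fun q _ => measurableSet_Ico)]
  intro q _ q' _ hq
  refine Set.disjoint_left.2 fun x hx hx' => hq ?_
  refine (coe_arc_injective (θ := x - P.L i * (q : ℕ)) (θ' := x - P.L i * (q' : ℕ))
    ⟨by linarith [hx.1], by linarith [hx.2]⟩ ⟨by linarith [hx'.1], by linarith [hx'.2]⟩ ?_).1
  simp

theorem parseval_arcs (i : ℕ) {f : ℝ → ℂ} (hf : MemLp f 2 arcLength) :
    ∑ q, ∑' k : ℕ, ‖∫ x, (P.arcFun i q k x : ℂ) * f x ∂arcLength‖ₑ ^ 2 =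
      ENNReal.ofReal (P.L i / 2) * ∫⁻ x, ‖f x‖ₑ ^ 2 ∂arcLength := by
  simp only [P.parseval_arc i _ hf]
  rw [← Finset.mul_sum, sum_lintegral_arc]

/-- The product of the arc length and the uniform distribution of the letters. -/
def wordProd : Measure (ℝ × P.InfWord) := arcLength.prod P.wordMeasure

instance : IsFiniteMeasure P.wordProd := by
  unfold wordProd
  infer_instance

/-- The coefficient of a function with respect to a function of the letters. -/
def letterCoeff (χ : P.InfWord → ℝ) (f : ℝ × P.InfWord → ℂ) (η : ℝ) : ℂ :=
  ∫ ω, χ ω * f (η, ω) ∂P.wordMeasure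

theorem abs_wordFun_le (i : ℕ) (v : P.Word (i + 1)) (ω : P.InfWord) : |P.wordFun i v ω| ≤ 2 := by
  have h1 : (P.n (i + 1) : ℝ)⁻¹ ≤ 1 :=
    inv_le_one_of_one_le₀ (by exact_mod_cast P.n_pos i)
  have h2 : (0 : ℝ) ≤ (P.n (i + 1) : ℝ)⁻¹ := by positivity
  unfold wordFun
  rw [abs_le]
  by_cases ha : ω ∈ P.cylinder (i + 1) v <;>
    by_cases hb : ω ∈ P.cylinder i (fun l => v l.castSucc) <;>
    simp only [ha, hb, indicator_of_mem, indicator_of_notMem, not_false_eq_true, Pi.one_apply] <;>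
    constructor <;> linarith

variable {P}

theorem memLp_slice {f : ℝ × P.InfWord → ℂ} (hf : MemLp f 2 P.wordProd) :
    ∀ᵐ η ∂arcLength, MemLp (fun ω => f (η, ω)) 2 P.wordMeasure := by
  have h1 : Integrable (fun z => ‖f z‖ ^ 2) P.wordProd := by
    simpa using hf.integrable_norm_pow two_ne_zero
  rw [wordProd] at h1
  have hf1 : AEStronglyMeasurable f (arcLength.prod P.wordMeasure) := hf.1
  filter_upwards [h1.prod_right_ae, hf1.prodMk_left] with η h2 h3
  exact (memLp_two_iff_integrable_sq_norm h3).2 h2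

/-- The squared mean is one of the nonnegative terms in `parseval_word`, applied to `χ f`; the
constant is `2²`. The bound `2` covers both `χ = 1` and every `wordFun`. -/
theorem enorm_letterCoeff_le {χ : P.InfWord → ℝ} (hχ : Measurable χ) (hχ2 : ∀ ω, |χ ω| ≤ 2)
    {f : ℝ × P.InfWord → ℂ} (hf : MemLp f 2 P.wordProd) :
    ∀ᵐ η ∂arcLength, ‖letterCoeff P χ f η‖ₑ ^ 2 ≤ 4 * ∫⁻ ω, ‖f (η, ω)‖ₑ ^ 2 ∂P.wordMeasure := by
  filter_upwards [memLp_slice hf] with η h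
  have h1 : MemLp (fun ω => (χ ω : ℂ) * f (η, ω)) 2 P.wordMeasure := by
    refine MemLp.mul (p := ⊤) (q := 2) h ?_
    refine memLp_top_of_bound ?_ 2 (ae_of_all _ fun ω => ?_)
    · exact (Complex.measurable_ofReal.comp hχ).aestronglyMeasurable
    · simpa using hχ2 ω
  calc ‖letterCoeff P χ f η‖ₑ ^ 2
      ≤ ∫⁻ ω, ‖(χ ω : ℂ) * f (η, ω)‖ₑ ^ 2 ∂P.wordMeasure := by
        rw [← P.parseval_word h1]
        exact le_self_add
    _ ≤ ∫⁻ ω, 4 * ‖f (η, ω)‖ₑ ^ 2 ∂P.wordMeasure := by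
        refine lintegral_mono fun ω => ?_
        rw [enorm_mul, mul_pow]
        refine mul_le_mul_left ?_ _
        rw [enorm_sq_eq_ofReal, show (4 : ENNReal) = ENNReal.ofReal 4 by norm_num]
        refine ENNReal.ofReal_le_ofReal ?_
        have := hχ2 ω
        rw [Complex.norm_real, Real.norm_eq_abs]
        nlinarith [abs_nonneg (χ ω)]
    _ = _ := lintegral_const_mul' _ _ (by norm_num)

theorem lintegral_wordProd_sq {f : ℝ × P.InfWord → ℂ} (hf : MemLp f 2 P.wordProd) :
    ∫⁻ z, ‖f z‖ₑ ^ 2 ∂P.wordProd = ∫⁻ η, ∫⁻ ω, ‖f (η, ω)‖ₑ ^ 2 ∂P.wordMeasure ∂arcLength := by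
  have h := hf.1.enorm
  exact lintegral_prod _ (by unfold wordProd at h; fun_prop)

theorem memLp_letterCoeff {χ : P.InfWord → ℝ} (hχ : Measurable χ) (hχ2 : ∀ ω, |χ ω| ≤ 2)
    {f : ℝ × P.InfWord → ℂ} (hf : MemLp f 2 P.wordProd) :
    MemLp (letterCoeff P χ f) 2 arcLength := by
  have hf1 : AEStronglyMeasurable f (arcLength.prod P.wordMeasure) := hf.1
  have hm : AEStronglyMeasurable (letterCoeff P χ f) arcLength := by
    refine AEStronglyMeasurable.integral_prod_right'
      (f := fun z : ℝ × P.InfWord => (χ z.2 : ℂ) * f z) ?_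
    exact ((Complex.measurable_ofReal.comp hχ).comp measurable_snd).aestronglyMeasurable.mul hf1
  refine ⟨hm, ?_⟩
  have h1 : eLpNorm (letterCoeff P χ f) 2 arcLength ^ 2 < ⊤ := by
    rw [eLpNorm_two_sq]
    refine (lintegral_mono_ae (enorm_letterCoeff_le hχ hχ2 hf)).trans_lt ?_
    rw [lintegral_const_mul' _ _ (by norm_num), ← lintegral_wordProd_sq hf, ← eLpNorm_two_sq]
    exact ENNReal.mul_lt_top (by norm_num) (ENNReal.pow_lt_top hf.2)
  by_contra h
  rw [not_lt, top_le_iff] at h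
  simp [h] at h1

theorem integral_mul_letterCoeff {χ : P.InfWord → ℝ} (hχ : Measurable χ) (hχ2 : ∀ ω, |χ ω| ≤ 2)
    {s : ℝ → ℂ} (hs : Measurable s) (hs1 : ∀ η, ‖s η‖ ≤ 1)
    {f : ℝ × P.InfWord → ℂ} (hf : MemLp f 2 P.wordProd) :
    ∫ z, s z.1 * χ z.2 * f z ∂P.wordProd = ∫ η, s η * letterCoeff P χ f η ∂arcLength := by
  have hi : Integrable f (arcLength.prod P.wordMeasure) := hf.integrable one_le_two
  have h1 : Integrable (fun z => s z.1 * χ z.2 * f z) (arcLength.prod P.wordMeasure) := by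
    refine hi.bdd_mul (c := 2) ?_ (ae_of_all _ fun z => ?_)
    · exact ((hs.comp measurable_fst).mul
        ((Complex.measurable_ofReal.comp hχ).comp measurable_snd)).aestronglyMeasurable
    · rw [norm_mul, Complex.norm_real, Real.norm_eq_abs]
      nlinarith [hs1 z.1, hχ2 z.2, norm_nonneg (s z.1), abs_nonneg (χ z.2)]
  rw [wordProd, integral_prod _ h1]
  refine integral_congr_ae (ae_of_all _ fun η => ?_)
  simp only [letterCoeff, mul_assoc]
  rw [integral_const_mul]

/-- Parseval's identity on the product of the circle with the space of words. -/
theorem parseval_wordProd {f : ℝ × P.InfWord → ℂ} (hf : MemLp f 2 P.wordProd) :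
    ENNReal.ofReal (2 * Real.pi)⁻¹ *
      ∑' m : ℤ, ‖∫ z, fourier m (z.1 : Circ) * f z ∂P.wordProd‖ₑ ^ 2 +
    ∑' i, ∑ α : P.Cell (i + 1), ∑' k : ℕ, ENNReal.ofReal (2 * P.N (i + 1) / P.L (i + 1)) *
      ‖∫ z, (P.arcFun (i + 1) α.1 k z.1 : ℂ) * P.wordFun i α.2 z.2 * f z ∂P.wordProd‖ₑ ^ 2 =
    ∫⁻ z, ‖f z‖ₑ ^ 2 ∂P.wordProd := by
  have h0 : ∀ m : ℤ, ∫ z, fourier m (z.1 : Circ) * f z ∂P.wordProd =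
      ∫ η, fourier m (η : Circ) * letterCoeff P 1 f η ∂arcLength := by
    intro m
    have := integral_mul_letterCoeff (χ := 1) measurable_one (by simp)
      (s := fun η : ℝ => fourier m (η : Circ))
      ((fourier m).continuous.measurable.comp measurable_coe_circ)
      (fun η => by rw [fourier_apply]; exact (Circle.norm_coe _).le) hf
    simpa using this
  have h1 : ∀ i (α : P.Cell (i + 1)) (k : ℕ),
      ∫ z, (P.arcFun (i + 1) α.1 k z.1 : ℂ) * P.wordFun i α.2 z.2 * f z ∂P.wordProd =
      ∫ η, (P.arcFun (i + 1) α.1 k η : ℂ) * letterCoeff P (P.wordFun i α.2) f η ∂arcLength := by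
    intro i α k
    exact integral_mul_letterCoeff (P.measurable_wordFun i α.2) (P.abs_wordFun_le i α.2)
      (s := fun η => (P.arcFun (i + 1) α.1 k η : ℂ))
      (Complex.measurable_ofReal.comp (P.measurable_arcFun _ _ _))
      (fun η => by simpa using P.abs_arcFun_le _ _ _ _) hf
  have hm : ∀ (χ : P.InfWord → ℝ), Measurable χ → (∀ ω, |χ ω| ≤ 2) →
      AEMeasurable (fun η => ‖letterCoeff P χ f η‖ₑ ^ 2) arcLength := by
    intro χ hχ hχ2
    have := (memLp_letterCoeff hχ hχ2 hf).1.enorm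
    fun_prop
  simp only [h0, h1]
  rw [parseval_circle (memLp_letterCoeff measurable_one (by simp) hf), ← mul_assoc,
    ← ENNReal.ofReal_mul (by positivity), inv_mul_cancel₀ (by positivity), ENNReal.ofReal_one,
    one_mul]
  -- For a fixed word, the Dirichlet sines on all arcs of length `L_{i+1}` are together complete on
  -- the circle. Their factor `L_{i+1} / 2` leaves the weight `N_{i+1}` that `parseval_word`
  -- requires.
  have h2 : ∀ i, ∑ α : P.Cell (i + 1), ∑' k : ℕ,
      ENNReal.ofReal (2 * P.N (i + 1) / P.L (i + 1)) *
      ‖∫ η, (P.arcFun (i + 1) α.1 k η : ℂ) * letterCoeff P (P.wordFun i α.2) f η ∂arcLength‖ₑ ^ 2 =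
      ∑ v, (P.N (i + 1) : ENNReal) *
        ∫⁻ η, ‖letterCoeff P (P.wordFun i v) f η‖ₑ ^ 2 ∂arcLength := by
    intro i
    rw [Fintype.sum_prod_type_right]
    refine Finset.sum_congr rfl fun v _ => ?_
    simp only [ENNReal.tsum_mul_left]
    rw [← Finset.mul_sum, P.parseval_arcs (i + 1)
      (memLp_letterCoeff (P.measurable_wordFun i v) (P.abs_wordFun_le i v) hf), ← mul_assoc,
      ← ENNReal.ofReal_mul (by have := P.L_pos (i + 1); positivity), ← ENNReal.ofReal_natCast]
    congr 2
    field_simp [(P.L_pos (i + 1)).ne']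
  simp only [h2]
  have h3 : ∀ i, ∑ v, (P.N (i + 1) : ENNReal) *
      ∫⁻ η, ‖letterCoeff P (P.wordFun i v) f η‖ₑ ^ 2 ∂arcLength =
      ∫⁻ η, ∑ v, (P.N (i + 1) : ENNReal) *
        ‖letterCoeff P (P.wordFun i v) f η‖ₑ ^ 2 ∂arcLength := by
    intro i
    rw [lintegral_finsetSum' _ fun v _ =>
      (hm _ (P.measurable_wordFun i v) (P.abs_wordFun_le i v)).const_mul _]
    refine Finset.sum_congr rfl fun v _ => ?_
    rw [lintegral_const_mul' _ _ (ENNReal.natCast_ne_top _)]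
  have hm2 : ∀ i, AEMeasurable (fun η => ∑ v, (P.N (i + 1) : ENNReal) *
        ‖letterCoeff P (P.wordFun i v) f η‖ₑ ^ 2) arcLength := fun i =>
    Finset.aemeasurable_fun_sum _ fun v _ =>
      (hm _ (P.measurable_wordFun i v) (P.abs_wordFun_le i v)).const_mul _
  simp only [h3]
  rw [← lintegral_tsum hm2, ← lintegral_add_left' (hm 1 measurable_one (by simp)),
    lintegral_wordProd_sq hf]
  -- With the sums over the angular modes carried out, what remains is `parseval_word` on almost
  -- every slice of constant angle.
  refine lintegral_congr_ae ?_
  filter_upwards [memLp_slice hf] with η hη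
  rw [← P.parseval_word hη]
  simp [letterCoeff]

end Parameters
end DiamondFractal
end

/-! ### The frame of eigenfunctions on the fractal -/

noncomputable section

namespace DiamondFractal
namespace Parameters

variable (P : Parameters)

/-- The index set of the frame of eigenfunctions. -/
abbrev Index : Type := ℤ ⊕ (Σ i, P.Cell (i + 1) × ℕ)

/-- The square root of the eigenvalue. -/
def freq : P.Index → ℕ
  | .inl m => m.natAbs
  | .inr ⟨i, _, k⟩ => (k + 1) * P.J (i + 1)

open Classical in
/-- The matrix of the projection onto the functions with mean zero over each bundle. -/
def cellCoeff (i : ℕ) (α β : P.Cell (i + 1)) : ℝ :=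
  (if α = β then 1 else 0) - (P.n (i + 1) : ℝ)⁻¹ * if P.Bundled (i + 1) α β then 1 else 0

/-- The normalization of the eigenfunctions which are new at stage `i`. -/
def amplitude (i : ℕ) : ℝ := √(2 * P.N i / P.L i)

theorem amplitude_sq (i : ℕ) : P.amplitude i ^ 2 = 2 * P.N i / P.L i :=
  Real.sq_sqrt (by have := P.L_pos i; positivity)

theorem amplitude_nonneg (i : ℕ) : 0 ≤ P.amplitude i := Real.sqrt_nonneg _

/-- The union of the cells which are in the same bundle as a given one. -/
def bundle (i : ℕ) (α : P.Cell i) : Set (P.F i) := {y | ∃ β, P.Bundled i α β ∧ y ∈ P.cell i β}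

/-- An eigenfunction which is new at stage `i + 1`. -/
def sineFun (i : ℕ) (α : P.Cell (i + 1)) (k : ℕ) (y : P.F (i + 1)) : ℝ :=
  P.amplitude (i + 1) * (Real.sin ((k + 1) * P.J (i + 1) * P.offset (i + 1) y) *
    ((P.cell (i + 1) α).indicator 1 y - (P.n (i + 1) : ℝ)⁻¹ *
      (P.bundle (i + 1) α).indicator 1 y))

/-- An eigenfunction of the circle. -/
def expFun (m : ℤ) (y : P.F 0) : ℂ := ((√(2 * Real.pi))⁻¹ : ℝ) * fourier m (P.angle 0 y)

/-- The frame of eigenfunctions of the Laplacian of `F_∞`. -/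
def frameFun : P.Index → P.FInf → ℂ
  | .inl m, x => P.expFun m (P.Phi 0 x)
  | .inr ⟨i, α, k⟩, x => P.sineFun i α k (P.Phi (i + 1) x)

variable {P}

theorem sin_J_mul_L (i k : ℕ) : Real.sin ((k + 1) * P.J i * P.L i) = 0 := by
  rw [mul_assoc, P.J_mul_L]
  exact_mod_cast Real.sin_nat_mul_pi (k + 1)

theorem sin_offset_cellMap (i k : ℕ) (α : P.Cell i) {θ : ℝ} (hθ : θ ∈ Icc 0 (P.L i)) :
    Real.sin ((k + 1) * P.J i * P.offset i (P.cellMap i α θ)) =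
      Real.sin ((k + 1) * P.J i * θ) := by
  rcases hθ.2.lt_or_eq with h | h
  · rw [offset_cellMap α ⟨hθ.1, h⟩]
  · rw [h, offset_cellMap_L, sin_J_mul_L]
    simp

/-- The formula extends to the closed cell: at the ends several cells contain the point and the
indicators are ambiguous, but there the sine vanishes. -/
theorem sineFun_cellMap (i : ℕ) (α β : P.Cell (i + 1)) (k : ℕ) {θ : ℝ}
    (hθ : θ ∈ Icc 0 (P.L (i + 1))) :
    P.sineFun i α k (P.cellMap (i + 1) β θ) = P.amplitude (i + 1) *
      (Real.sin ((k + 1) * P.J (i + 1) * θ) * P.cellCoeff i α β) := by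
  unfold sineFun
  rw [sin_offset_cellMap _ _ _ hθ]
  rcases hθ.1.eq_or_lt with h0 | h0
  · simp [← h0]
  rcases hθ.2.eq_or_lt with h1 | h1
  · rw [h1, sin_J_mul_L]
    simp
  have hm : ∀ γ, P.cellMap (i + 1) β θ ∈ P.cell (i + 1) γ ↔ β = γ := fun γ =>
    cellMap_mem_cell ⟨h0, h1⟩
  have h2 : P.cellMap (i + 1) β θ ∈ P.cell (i + 1) α ↔ α = β := (hm α).trans eq_comm
  have h3 : P.cellMap (i + 1) β θ ∈ P.bundle (i + 1) α ↔ P.Bundled (i + 1) α β := by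
    simp only [bundle, mem_ofPred_eq, hm, exists_eq_right']
  classical
  simp only [cellCoeff, indicator_apply, h2, h3, Pi.one_apply]

theorem abs_cellCoeff_le (i : ℕ) (α β : P.Cell (i + 1)) : |P.cellCoeff i α β| ≤ 1 := by
  have h1 : (P.n (i + 1) : ℝ)⁻¹ ≤ 1 :=
    inv_le_one_of_one_le₀ (by exact_mod_cast P.n_pos i)
  have h2 : (0 : ℝ) ≤ (P.n (i + 1) : ℝ)⁻¹ := by positivity
  unfold cellCoeff
  by_cases ha : α = β
  · subst ha
    have : P.Bundled (i + 1) α α := ⟨rfl, fun _ _ => rfl⟩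
    rw [if_pos rfl, if_pos this, abs_le]
    constructor <;> linarith
  · rw [if_neg ha, abs_le]
    split_ifs <;> constructor <;> linarith

theorem measurable_sineFun (i : ℕ) (α : P.Cell (i + 1)) (k : ℕ) :
    Measurable (P.sineFun i α k) := by
  refine measurable_of_cellMap (G := fun β θ => P.amplitude (i + 1) *
      (Real.sin ((k + 1) * P.J (i + 1) * θ) * P.cellCoeff i α β)) (fun β => by fun_prop)
    fun β θ hθ => sineFun_cellMap i α β k ⟨hθ.1.le, hθ.2.le⟩

theorem abs_sineFun_le (i : ℕ) (α : P.Cell (i + 1)) (k : ℕ) (y : P.F (i + 1)) :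
    |P.sineFun i α k y| ≤ P.amplitude (i + 1) := by
  obtain ⟨β, θ, hθ, rfl⟩ := exists_cellMap y
  rw [sineFun_cellMap i α β k ⟨hθ.1, hθ.2.le⟩, abs_mul, abs_mul,
    abs_of_nonneg (P.amplitude_nonneg _)]
  have h1 := Real.abs_sin_le_one ((k + 1) * P.J (i + 1) * θ)
  have h2 := abs_cellCoeff_le i α β
  have h3 := P.amplitude_nonneg (i + 1)
  calc _ ≤ P.amplitude (i + 1) * (1 * 1) := by gcongr
    _ = _ := by ring

theorem measurable_expFun (m : ℤ) : Measurable (P.expFun m) :=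
  ((fourier m).continuous.measurable.comp (measurable_angle 0)).const_mul _

theorem norm_expFun (m : ℤ) (y : P.F 0) : ‖P.expFun m y‖ = (√(2 * Real.pi))⁻¹ := by
  rw [expFun, norm_mul, fourier_apply, Circle.norm_coe, Complex.norm_real, Real.norm_eq_abs,
    abs_of_nonneg (by positivity), mul_one]

theorem measurable_frameFun (n : P.Index) : Measurable (P.frameFun n) := by
  match n with
  | .inl m => exact (measurable_expFun m).comp (P.measurable_Phi 0)
  | .inr ⟨i, α, k⟩ =>
    exact Complex.measurable_ofReal.comp ((measurable_sineFun i α k).comp (P.measurable_Phi _))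

theorem exists_norm_frameFun_le (n : P.Index) : ∃ C, ∀ x, ‖P.frameFun n x‖ ≤ C := by
  match n with
  | .inl m => exact ⟨_, fun x => (norm_expFun m _).le⟩
  | .inr ⟨i, α, k⟩ =>
    refine ⟨P.amplitude (i + 1), fun x => ?_⟩
    rw [frameFun, Complex.norm_real]
    exact abs_sineFun_le i α k _

theorem muInf_eq_map :
    P.muInf = Measure.map (fun a : ℝ × P.InfWord => P.pointInf (a.1 : Circ) a.2) P.wordProd := rfl

instance : IsFiniteMeasure P.muInf := by
  rw [muInf_eq_map]
  exact Measure.isFiniteMeasure_map _ _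

theorem Phi_pointInf (i : ℕ) (η : Circ) (ω : P.InfWord) :
    P.Phi i (P.pointInf η ω) = P.point i η (P.prefixWord i ω) := rfl

/-- The factorization into a function of the angle and a function of the letters is what transports
`parseval_wordProd` to `F_∞`. On the arc of `α`, the matrix entry is the value of `wordFun`; on the
other arcs both sides vanish. -/
theorem sineFun_point (i : ℕ) (α : P.Cell (i + 1)) (k : ℕ) {η : ℝ} (hη : η ∈ Ico 0 (2 * Real.pi))
    (ω : P.InfWord) : P.sineFun i α k (P.point (i + 1) (η : Circ) (P.prefixWord (i + 1) ω)) =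
      P.amplitude (i + 1) * (P.arcFun (i + 1) α.1 k η * P.wordFun i α.2 ω) := by
  obtain ⟨q, θ, hθ, rfl⟩ := P.exists_arc_real (i + 1) hη
  have h := sineFun_cellMap i α (q, P.prefixWord (i + 1) ω) k ⟨hθ.1, hθ.2.le⟩
  rw [cellMap_eq] at h
  rw [h]
  congr 1
  by_cases hq : α.1 = q
  · have h1 : P.arcFun (i + 1) α.1 k (P.L (i + 1) * (q : ℕ) + θ) =
        Real.sin ((k + 1) * P.J (i + 1) * θ) := by
      rw [hq, arcFun]
      rcases hθ.1.eq_or_lt with h0 | h0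
      · simp [← h0]
      · rw [indicator_of_mem (mem_Ioo.2 ⟨by linarith, by linarith [hθ.2]⟩), add_sub_cancel_left]
    rw [h1]
    congr 1
    have h2 : α = (q, P.prefixWord (i + 1) ω) ↔ ω ∈ P.cylinder (i + 1) α.2 := by
      rw [Prod.ext_iff, cylinder, mem_preimage, mem_singleton_iff, eq_comm (b := α.2)]
      exact and_iff_right hq
    have h3 : P.Bundled (i + 1) α (q, P.prefixWord (i + 1) ω) ↔
        ω ∈ P.cylinder i (fun l => α.2 l.castSucc) := by
      rw [bundled_iff, cylinder, mem_preimage, mem_singleton_iff, eq_comm (b := fun l : Fin i => _)]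
      exact and_iff_right hq
    classical
    simp only [cellCoeff, wordFun, h2, h3, indicator_apply, Pi.one_apply]
  · have h1 : P.arcFun (i + 1) α.1 k (P.L (i + 1) * (q : ℕ) + θ) = 0 := by
      rw [arcFun, indicator_of_notMem]
      intro hmem
      refine hq (coe_arc_injective (θ := P.L (i + 1) * (q : ℕ) + θ - P.L (i + 1) * (α.1 : ℕ))
        ⟨by linarith [hmem.1], by linarith [hmem.2]⟩ hθ ?_).1
      simp
    have h2 : P.cellCoeff i α (q, P.prefixWord (i + 1) ω) = 0 := by
      rw [cellCoeff, if_neg fun h => hq (by rw [h]), if_neg fun h => hq h.1]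
      simp
    rw [h1, h2]
    simp

theorem measurePreserving_pointInf :
    MeasurePreserving (fun a : ℝ × P.InfWord => P.pointInf (a.1 : Circ) a.2) P.wordProd P.muInf :=
  ⟨P.measurable_pointInf, rfl⟩

theorem integral_frameFun_mul (n : P.Index) {f : P.FInf → ℂ}
    (hf : AEStronglyMeasurable f P.muInf) :
    ∫ x, P.frameFun n x * f x ∂P.muInf =
      ∫ z, P.frameFun n (P.pointInf (z.1 : Circ) z.2) * f (P.pointInf (z.1 : Circ) z.2)
        ∂P.wordProd := by
  rw [muInf_eq_map, integral_map P.measurable_pointInf.aemeasurable]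
  exact ((measurable_frameFun n).aestronglyMeasurable).mul hf

theorem ae_wordProd : ∀ᵐ z ∂P.wordProd, z.1 ∈ Ico 0 (2 * Real.pi) := by
  have h : ∀ᵐ η ∂arcLength, η ∈ Ico 0 (2 * Real.pi) := ae_restrict_mem measurableSet_Ico
  exact Measure.quasiMeasurePreserving_fst.ae h

/-- Parseval's identity on `F_∞`, as an identity in `[0, ∞]`. -/
theorem tsum_enorm_frame {f : P.FInf → ℂ} (hf : MemLp f 2 P.muInf) :
    ∑' n, ‖∫ x, P.frameFun n x * f x ∂P.muInf‖ₑ ^ 2 = ∫⁻ x, ‖f x‖ₑ ^ 2 ∂P.muInf := by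
  set g : ℝ × P.InfWord → ℂ := fun z => f (P.pointInf (z.1 : Circ) z.2) with hg
  have hgm : MemLp g 2 P.wordProd := hf.comp_measurePreserving measurePreserving_pointInf
  have h0 : ∫⁻ x, ‖f x‖ₑ ^ 2 ∂P.muInf = ∫⁻ z, ‖g z‖ₑ ^ 2 ∂P.wordProd := by
    rw [muInf_eq_map, lintegral_map' (f := fun x => ‖f x‖ₑ ^ 2) ?_
      P.measurable_pointInf.aemeasurable]
    have := hf.1.enorm
    rw [muInf_eq_map] at this
    fun_prop
  have h1 : ∀ m : ℤ, ‖∫ x, P.frameFun (.inl m) x * f x ∂P.muInf‖ₑ ^ 2 =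
      ENNReal.ofReal (2 * Real.pi)⁻¹ *
        ‖∫ z, fourier m (z.1 : Circ) * g z ∂P.wordProd‖ₑ ^ 2 := by
    intro m
    have h2 : ∀ z : ℝ × P.InfWord, P.frameFun (.inl m) (P.pointInf (z.1 : Circ) z.2) *
        f (P.pointInf (z.1 : Circ) z.2) =
        ((√(2 * Real.pi))⁻¹ : ℝ) * (fourier m (z.1 : Circ) * g z) := by
      intro z
      rw [← mul_assoc]
      rfl
    rw [integral_frameFun_mul _ hf.1]
    simp only [h2]
    rw [integral_const_mul, enorm_mul, mul_pow, enorm_sq_eq_ofReal ((_ : ℝ) : ℂ),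
      Complex.norm_real, Real.norm_eq_abs, sq_abs, inv_pow, Real.sq_sqrt (by positivity)]
  have h2 : ∀ i (α : P.Cell (i + 1)) (k : ℕ),
      ‖∫ x, P.frameFun (.inr ⟨i, α, k⟩) x * f x ∂P.muInf‖ₑ ^ 2 =
      ENNReal.ofReal (2 * P.N (i + 1) / P.L (i + 1)) *
      ‖∫ z, (P.arcFun (i + 1) α.1 k z.1 : ℂ) * P.wordFun i α.2 z.2 * g z ∂P.wordProd‖ₑ ^ 2 := by
    intro i α k
    have h3 : ∀ᵐ z ∂P.wordProd, P.frameFun (.inr ⟨i, α, k⟩) (P.pointInf (z.1 : Circ) z.2) *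
        f (P.pointInf (z.1 : Circ) z.2) = (P.amplitude (i + 1) : ℂ) *
        ((P.arcFun (i + 1) α.1 k z.1 : ℂ) * P.wordFun i α.2 z.2 * g z) := by
      filter_upwards [ae_wordProd] with z hz
      rw [frameFun, Phi_pointInf, sineFun_point i α k hz]
      push_cast
      ring
    rw [integral_frameFun_mul _ hf.1, integral_congr_ae h3, integral_const_mul, enorm_mul, mul_pow,
      enorm_sq_eq_ofReal ((_ : ℝ) : ℂ), Complex.norm_real, Real.norm_eq_abs, sq_abs, amplitude_sq]
  rw [h0, ← parseval_wordProd hgm, ENNReal.summable.tsum_sum ENNReal.summable,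
    ENNReal.tsum_sigma']
  simp only [h1, ENNReal.tsum_mul_left]
  congr 1
  refine tsum_congr fun i => ?_
  rw [ENNReal.tsum_prod', tsum_fintype]
  simp only [h2, ENNReal.tsum_mul_left]

end Parameters
end DiamondFractal
end

/-! ### Multipliers with respect to a Parseval frame -/

noncomputable section

namespace DiamondFractal

/-- A Parseval frame of an `L²` space, with respect to the bilinear pairing. -/
structure ParsevalFrame {Ω ι : Type*} [MeasurableSpace Ω] (μ : Measure Ω) (e : ι → Ω → ℂ) :
    Prop where
  memLp : ∀ n, MemLp (e n) 2 μ
  hasSum : ∀ f : Lp ℂ 2 μ, HasSum (fun n => ‖∫ x, e n x * f x ∂μ‖ ^ 2) (‖f‖ ^ 2)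

namespace ParsevalFrame

variable {Ω ι : Type*} [MeasurableSpace Ω] {μ : Measure Ω} {e : ι → Ω → ℂ}

theorem integrable_mul {f g : Ω → ℂ} (hf : MemLp f 2 μ) (hg : MemLp g 2 μ) :
    Integrable (fun x => f x * g x) μ := MemLp.integrable_mul hf hg

variable (h : ParsevalFrame μ e)
include h

theorem memlp_coeff (f : Lp ℂ 2 μ) : Memℓp (fun n => ∫ x, e n x * f x ∂μ) 2 := by
  refine memℓp_gen ?_
  simpa using (h.hasSum f).summable

/-- The analysis operator of a Parseval frame. -/
def analysis : Lp ℂ 2 μ →ₗᵢ[ℂ] lp (fun _ : ι => ℂ) 2 where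
  toFun f := ⟨fun n => ∫ x, e n x * f x ∂μ, h.memlp_coeff f⟩
  map_add' f g := by
    ext n
    simp only [lp.coeFn_add, Pi.add_apply]
    rw [← integral_add (integrable_mul (h.memLp n) (Lp.memLp f))
      (integrable_mul (h.memLp n) (Lp.memLp g))]
    refine integral_congr_ae ?_
    filter_upwards [Lp.coeFn_add f g] with x hx
    rw [hx, Pi.add_apply, mul_add]
  map_smul' c f := by
    ext n
    simp only [lp.coeFn_smul, Pi.smul_apply, RingHom.id_apply, smul_eq_mul]
    rw [← integral_const_mul]
    refine integral_congr_ae ?_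
    filter_upwards [Lp.coeFn_smul c f] with x hx
    rw [hx, Pi.smul_apply, smul_eq_mul]
    ring
  norm_map' f := by
    rw [← sq_eq_sq₀ (norm_nonneg _) (norm_nonneg _)]
    have h1 := lp.norm_rpow_eq_tsum (p := 2) (by norm_num)
      (⟨fun n => ∫ x, e n x * f x ∂μ, h.memlp_coeff f⟩ : lp (fun _ : ι => ℂ) 2)
    simp only [ENNReal.toReal_ofNat, Real.rpow_ofNat] at h1
    rw [← (h.hasSum f).tsum_eq]
    exact h1

theorem analysis_apply (f : Lp ℂ 2 μ) (n : ι) : h.analysis f n = ∫ x, e n x * f x ∂μ := rfl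

/-- The synthesis operator of a Parseval frame. -/
def synthesis : lp (fun _ : ι => ℂ) 2 →L[ℂ] Lp ℂ 2 μ :=
  ContinuousLinearMap.adjoint h.analysis.toContinuousLinearMap

/-- The adjoint of an isometry is a left inverse. A redundant frame admits no right inverse here,
and none is needed. -/
theorem synthesis_analysis (f : Lp ℂ 2 μ) : h.synthesis (h.analysis f) = f := by
  refine ext_inner_left ℂ fun g => ?_
  rw [synthesis, ContinuousLinearMap.adjoint_inner_right]
  exact h.analysis.inner_map_map g f

omit h in
/-- The product of a sequence with a bounded sequence of multipliers. -/
def mulSeq (a : ι → ℂ) (c : lp (fun _ : ι => ℂ) 2) : lp (fun _ : ι => ℂ) 2 :=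
  open Classical in if hc : Memℓp (fun n => a n * c n) 2 then ⟨_, hc⟩ else 0

omit h in
theorem memlp_mulSeq {a : ι → ℂ} {C : ℝ} (ha : ∀ n, ‖a n‖ ≤ C) (c : lp (fun _ : ι => ℂ) 2) :
    Memℓp (fun n => a n * c n) 2 := by
  refine memℓp_gen ?_
  have hc := (memℓp_gen_iff (by norm_num)).1 (lp.memℓp c)
  simp only [ENNReal.toReal_ofNat, Real.rpow_ofNat] at hc ⊢
  refine Summable.of_nonneg_of_le (fun n => by positivity) (fun n => ?_) (hc.mul_left (C ^ 2))
  rw [norm_mul, mul_pow]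
  gcongr
  exact ha n

omit h in
theorem mulSeq_apply {a : ι → ℂ} {C : ℝ} (ha : ∀ n, ‖a n‖ ≤ C) (c : lp (fun _ : ι => ℂ) 2)
    (n : ι) : mulSeq a c n = a n * c n := by
  rw [mulSeq, dif_pos (memlp_mulSeq ha c)]

omit h in
-- Bounded pointwise convergence of multipliers gives strong convergence of the operators, by
-- dominated convergence with the bound `(2C)² ‖c n‖²`.
theorem tendsto_mulSeq {X : Type*} {l : Filter X} [l.IsCountablyGenerated] {a : X → ι → ℂ}
    {b : ι → ℂ} {C : ℝ} (ha : ∀ᶠ s in l, ∀ n, ‖a s n‖ ≤ C) (hb : ∀ n, ‖b n‖ ≤ C)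
    (hab : ∀ n, Tendsto (fun s => a s n) l (𝓝 (b n))) (c : lp (fun _ : ι => ℂ) 2) :
    Tendsto (fun s => mulSeq (a s) c) l (𝓝 (mulSeq b c)) := by
  rw [tendsto_iff_norm_sub_tendsto_zero]
  have hc := (memℓp_gen_iff (by norm_num)).1 (lp.memℓp c)
  simp only [ENNReal.toReal_ofNat, Real.rpow_ofNat] at hc
  have h1 : ∀ᶠ s in l, ‖mulSeq (a s) c - mulSeq b c‖ ^ 2 = ∑' n, ‖(a s n - b n) * c n‖ ^ 2 := by
    filter_upwards [ha] with s hs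
    have h2 := lp.norm_rpow_eq_tsum (p := 2) (by norm_num) (mulSeq (a s) c - mulSeq b c)
    simp only [ENNReal.toReal_ofNat, Real.rpow_ofNat] at h2
    rw [h2]
    refine tsum_congr fun n => ?_
    rw [lp.coeFn_sub, Pi.sub_apply, mulSeq_apply hs, mulSeq_apply hb, sub_mul]
  have h3 : Tendsto (fun s => ∑' n, ‖(a s n - b n) * c n‖ ^ 2) l (𝓝 (∑' _ : ι, (0 : ℝ))) := by
    refine tendsto_tsum_of_dominated_convergence (bound := fun n => (2 * C) ^ 2 * ‖c n‖ ^ 2)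
      (hc.mul_left _) (fun n => ?_) ?_
    · have h4 := ((((hab n).sub_const (b n)).mul_const (c n)).norm).pow 2
      simpa using h4
    · filter_upwards [ha] with s hs n
      rw [Real.norm_eq_abs, abs_of_nonneg (by positivity), norm_mul, mul_pow]
      gcongr
      calc ‖a s n - b n‖ ≤ ‖a s n‖ + ‖b n‖ := norm_sub_le _ _
        _ ≤ 2 * C := by linarith [hs n, hb n]
  rw [tsum_zero] at h3
  have h5 := (h3.congr' (h1.mono fun s hs => hs.symm)).sqrt
  simpa [Real.sqrt_sq (norm_nonneg _)] using h5

/-- The operator which multiplies the coefficients with respect to the frame by given numbers. -/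
def multiplier (a : ι → ℂ) (f : Lp ℂ 2 μ) : Lp ℂ 2 μ := h.synthesis (mulSeq a (h.analysis f))

theorem multiplier_one {a : ι → ℂ} (ha : ∀ n, a n = 1) (f : Lp ℂ 2 μ) : h.multiplier a f = f := by
  have : mulSeq a (h.analysis f) = h.analysis f := by
    ext n
    rw [mulSeq_apply (C := 1) (fun n => by simp [ha]), ha, one_mul]
  rw [multiplier, this, synthesis_analysis]

theorem tendsto_multiplier {X : Type*} {l : Filter X} [l.IsCountablyGenerated] {a : X → ι → ℂ}
    {b : ι → ℂ} {C : ℝ} (ha : ∀ᶠ s in l, ∀ n, ‖a s n‖ ≤ C) (hb : ∀ n, ‖b n‖ ≤ C)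
    (hab : ∀ n, Tendsto (fun s => a s n) l (𝓝 (b n))) (f : Lp ℂ 2 μ) :
    Tendsto (fun s => h.multiplier (a s) f) l (𝓝 (h.multiplier b f)) :=
  (h.synthesis.continuous.tendsto _).comp (tendsto_mulSeq ha hb hab _)

/-- If the coefficients of `v` are multiples of those of `f`, then `v` is given by the
multiplier. -/
theorem eq_multiplier {a : ι → ℂ} {C : ℝ} (ha : ∀ n, ‖a n‖ ≤ C) {f v : Lp ℂ 2 μ}
    (hv : ∀ n, ∫ x, e n x * v x ∂μ = a n * ∫ x, e n x * f x ∂μ) : v = h.multiplier a f := by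
  rw [← h.synthesis_analysis v, multiplier]
  congr 1
  ext n
  rw [mulSeq_apply ha, analysis_apply, analysis_apply, hv]

/-- Synthesis is moved to the other side of the inner product, which leaves an inner product in
`ℓ²`. The pairing with `g` is bilinear, whence the conjugates on the second factor. -/
theorem hasSum_multiplier {a : ι → ℂ} {C : ℝ} (ha : ∀ n, ‖a n‖ ≤ C) (f : Lp ℂ 2 μ) {g : Ω → ℂ}
    (hg : MemLp g 2 μ) :
    HasSum (fun n => a n * (∫ x, e n x * f x ∂μ) * ∫ x, (starRingEnd ℂ) (e n x) * g x ∂μ)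
      (∫ x, h.multiplier a f x * g x ∂μ) := by
  have hg' : MemLp (fun x => (starRingEnd ℂ) (g x)) 2 μ := hg.star
  set G : Lp ℂ 2 μ := hg'.toLp with hG
  have h1 := lp.hasSum_inner (𝕜 := ℂ) (h.analysis G) (mulSeq a (h.analysis f))
  have h2 : inner ℂ (h.analysis G) (mulSeq a (h.analysis f)) =
      ∫ x, h.multiplier a f x * g x ∂μ := by
    have h3 : inner ℂ (h.analysis G) (mulSeq a (h.analysis f)) =
        inner ℂ G (h.multiplier a f) := by
      rw [multiplier, synthesis, ContinuousLinearMap.adjoint_inner_right]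
      rfl
    rw [h3, L2.inner_def]
    refine integral_congr_ae ?_
    filter_upwards [hg'.coeFn_toLp] with x hx
    rw [← hG] at hx
    rw [hx, RCLike.inner_apply, starRingEnd_self_apply]
  rw [h2] at h1
  convert! h1 using 2 with n
  rw [RCLike.inner_apply, mulSeq_apply ha, analysis_apply, analysis_apply, ← integral_conj]
  congr 1
  refine integral_congr_ae ?_
  filter_upwards [hg'.coeFn_toLp] with x hx
  rw [← hG] at hx
  rw [hx, map_mul, starRingEnd_self_apply]

/-- The time integral is computed in `ℓ²`, where evaluation of a coordinate is a continuous linear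
map and commutes with it; synthesis is applied afterwards. -/
theorem integral_smul_multiplier {η : ℝ → ℝ} (hη : Continuous η) (hηc : HasCompactSupport η)
    {a : ℝ → ι → ℂ} {C : ℝ} (ha : ∀ t n, ‖a t n‖ ≤ C) (hac : ∀ n, Continuous fun t => a t n)
    (f : Lp ℂ 2 μ) : ∫ t, η t • h.multiplier (a t) f =
      h.multiplier (fun n => ∫ t, (η t : ℂ) * a t n) f := by
  have hcont : Continuous fun t => η t • mulSeq (a t) (h.analysis f) :=
    hη.smul (continuous_iff_continuousAt.2 fun t => tendsto_mulSeq (C := C)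
      (Eventually.of_forall ha) (ha t) (fun n => (hac n).tendsto t) _)
  have hint : Integrable fun t => η t • mulSeq (a t) (h.analysis f) :=
    hcont.integrable_of_hasCompactSupport (hηc.smul_right)
  have h1 : ∀ t, η t • h.multiplier (a t) f =
      h.synthesis.restrictScalars ℝ (η t • mulSeq (a t) (h.analysis f)) := fun t => by
    rw [map_smul]
    rfl
  simp only [h1]
  rw [ContinuousLinearMap.integral_comp_comm _ hint, multiplier]
  refine congr_arg h.synthesis ?_
  have hb : ∀ n, ‖∫ t, (η t : ℂ) * a t n‖ ≤ C * ∫ t, |η t| := by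
    intro n
    rw [← integral_const_mul]
    refine norm_integral_le_of_norm_le
      ((hη.integrable_of_hasCompactSupport hηc).abs.const_mul C) (ae_of_all _ fun t => ?_)
    rw [norm_mul, Complex.norm_real, Real.norm_eq_abs, mul_comm]
    exact mul_le_mul_of_nonneg_right (ha t n) (abs_nonneg _)
  ext n
  rw [mulSeq_apply hb]
  have h2 := (lp.evalCLM ℝ (fun _ : ι => ℂ) 2 n).integral_comp_comm hint
  refine h2.symm.trans ?_
  rw [← integral_mul_const]
  refine integral_congr_ae (ae_of_all _ fun t => ?_)
  change (η t • mulSeq (a t) (h.analysis f)) n = _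
  rw [lp.coeFn_smul, Pi.smul_apply, mulSeq_apply (ha t), Complex.real_smul, ← mul_assoc]

end ParsevalFrame
end DiamondFractal
end

/-! ### Multipliers as integral operators, and bounds for the kernel -/

noncomputable section

namespace DiamondFractal

theorem integrable_tsum_of_lintegral {Ω ι : Type*} [MeasurableSpace Ω] {μ : Measure Ω} [Countable ι]
    {F : ι → Ω → ℂ} (hF : ∀ n, AEStronglyMeasurable (F n) μ)
    (hF' : ∑' n, ∫⁻ x, ‖F n x‖ₑ ∂μ ≠ ⊤) : Integrable (fun x => ∑' n, F n x) μ := by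
  rw [← lintegral_tsum fun n => (hF n).enorm] at hF'
  have h1 : ∀ᵐ x ∂μ, ∑' n, ‖F n x‖ₑ < ⊤ := ae_lt_top' (AEMeasurable.tsum fun n => (hF n).enorm) hF'
  refine ⟨?_, ?_⟩
  · refine aestronglyMeasurable_of_tendsto_ae (u := (atTop : Filter (Finset ι)))
      (f := fun s x => ∑ n ∈ s, F n x) (fun s => Finset.aestronglyMeasurable_fun_sum s fun n _ => hF n) ?_
    filter_upwards [h1] with x hx
    exact (tsum_enorm_ne_top_iff_summable_norm.1 hx.ne).of_norm.hasSum
  · refine lt_of_le_of_lt (lintegral_mono fun x => ?_) hF'.lt_top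
    exact enorm_tsum_le_tsum_enorm

namespace ParsevalFrame

variable {Ω ι : Type*} [MeasurableSpace Ω] {μ : Measure Ω} {e : ι → Ω → ℂ}
  (h : ParsevalFrame μ e)
include h

/-- A multiplier is an integral operator if the series of the absolute values of the terms of its
kernel is small enough. -/
theorem multiplier_eq_integral [IsFiniteMeasure μ] [Countable ι] {a : ι → ℂ} {C : ℝ}
    (ha : ∀ n, ‖a n‖ ≤ C) {B : ENNReal} (hB : B ≠ ⊤)
    (hbound : ∀ y, ∑' n, ‖a n‖ₑ * (∫⁻ x, ‖e n x‖ₑ ∂μ) * ‖e n y‖ₑ ≤ B) (f : Lp ℂ 2 μ) :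
    ∀ᵐ x ∂μ, Integrable (fun y => (∑' n, a n * (starRingEnd ℂ) (e n x) * e n y) * f y) μ ∧
      h.multiplier a f x = ∫ y, (∑' n, a n * (starRingEnd ℂ) (e n x) * e n y) * f y ∂μ := by
  have hf1 : Integrable f μ := (Lp.memLp f).integrable one_le_two
  have he : ∀ n, AEStronglyMeasurable (e n) μ := fun n => (h.memLp n).1
  have hec : ∀ n, AEStronglyMeasurable (fun x => (starRingEnd ℂ) (e n x)) μ := fun n => (he n).star
  have hfm : AEStronglyMeasurable f μ := hf1.1
  have hef : ∀ n, AEMeasurable (fun y => ‖e n y‖ₑ * ‖f y‖ₑ) μ := fun n =>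
    (he n).enorm.mul hfm.enorm
  -- By Tonelli and the column bound, `∫ S ≤ B ‖f‖₁`, and `f` is integrable on a finite measure
  -- space. So the double series converges absolutely for almost every `x`.
  set S : Ω → ENNReal := fun x => ∑' n, ‖a n‖ₑ * ‖e n x‖ₑ * ∫⁻ y, ‖e n y‖ₑ * ‖f y‖ₑ ∂μ with hS
  have hSm : ∀ n, AEMeasurable (fun x => ‖a n‖ₑ * ‖e n x‖ₑ * ∫⁻ y, ‖e n y‖ₑ * ‖f y‖ₑ ∂μ) μ :=
    fun n => ((he n).enorm.const_mul _).mul_const _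
  have hSint : ∫⁻ x, S x ∂μ ≠ ⊤ := by
    have hfin : B * ∫⁻ y, ‖f y‖ₑ ∂μ < ⊤ := ENNReal.mul_lt_top hB.lt_top hf1.2
    refine ne_of_lt (lt_of_le_of_lt ?_ hfin)
    calc ∫⁻ x, S x ∂μ = ∑' n, ‖a n‖ₑ * (∫⁻ x, ‖e n x‖ₑ ∂μ) * ∫⁻ y, ‖e n y‖ₑ * ‖f y‖ₑ ∂μ := by
          rw [hS, lintegral_tsum hSm]
          refine tsum_congr fun n => ?_
          rw [lintegral_mul_const'' _ ((he n).enorm.const_mul _),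
            lintegral_const_mul'' _ (he n).enorm]
      _ = ∫⁻ y, (∑' n, ‖a n‖ₑ * (∫⁻ x, ‖e n x‖ₑ ∂μ) * ‖e n y‖ₑ) * ‖f y‖ₑ ∂μ := by
          simp only [← ENNReal.tsum_mul_right]
          simp only [mul_assoc]
          rw [lintegral_tsum fun n => ((hef n).const_mul _).const_mul _]
          refine tsum_congr fun n => ?_
          rw [lintegral_const_mul'' _ ((hef n).const_mul _), lintegral_const_mul'' _ (hef n)]
      _ ≤ ∫⁻ y, B * ‖f y‖ₑ ∂μ := lintegral_mono fun y => mul_le_mul_left (hbound y) _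
      _ = _ := lintegral_const_mul'' _ hfm.enorm
  have hSae : ∀ᵐ x ∂μ, S x < ⊤ := ae_lt_top' (AEMeasurable.tsum hSm) hSint
  have hcoef : ∀ n, ‖∫ y, e n y * f y ∂μ‖ₑ ≤ ∫⁻ y, ‖e n y‖ₑ * ‖f y‖ₑ ∂μ := by
    intro n
    refine (enorm_integral_le_lintegral_enorm _).trans_eq ?_
    simp only [enorm_mul]
  have hkm : ∀ n, AEStronglyMeasurable
      (fun x => a n * (starRingEnd ℂ) (e n x) * ∫ y, e n y * f y ∂μ) μ :=
    fun n => ((hec n).const_mul _).mul_const _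
  have hkint : ∑' n, ∫⁻ x, ‖a n * (starRingEnd ℂ) (e n x) * ∫ y, e n y * f y ∂μ‖ₑ ∂μ ≠ ⊤ := by
    refine ne_of_lt (lt_of_le_of_lt ?_ hSint.lt_top)
    rw [hS, lintegral_tsum hSm]
    refine ENNReal.tsum_le_tsum fun n => lintegral_mono fun x => ?_
    rw [enorm_mul, enorm_mul, RCLike.enorm_conj]
    exact mul_le_mul_right (hcoef n) _
  -- Both sides are integrable, so it suffices to integrate over measurable sets; there
  -- `hasSum_multiplier` gives the left side as a series, termwise equal to the right.
  have hT : h.multiplier a f =ᵐ[μ]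
      fun x => ∑' n, a n * (starRingEnd ℂ) (e n x) * ∫ y, e n y * f y ∂μ := by
    refine Integrable.ae_eq_of_forall_setIntegral_eq _ _
      ((Lp.memLp (h.multiplier a f)).integrable one_le_two)
      (integrable_tsum_of_lintegral hkm hkint) fun A hA _ => ?_
    have hg : MemLp (A.indicator fun _ => (1 : ℂ)) 2 μ :=
      memLp_indicator_const 2 hA 1 (Or.inr (measure_ne_top _ _))
    have hind : ∀ φ : Ω → ℂ, ∫ x, φ x * A.indicator (fun _ => (1 : ℂ)) x ∂μ = ∫ x in A, φ x ∂μ := by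
      intro φ
      rw [← integral_indicator hA]
      refine integral_congr_ae (ae_of_all _ fun x => ?_)
      by_cases hx : x ∈ A <;> simp [hx]
    have h1 := h.hasSum_multiplier ha f hg
    simp only [hind] at h1
    rw [← h1.tsum_eq, integral_tsum (fun n => (hkm n).restrict)]
    · refine tsum_congr fun n => ?_
      rw [integral_mul_const, integral_const_mul]
      ring
    · refine ne_of_lt (lt_of_le_of_lt ?_ hkint.lt_top)
      exact ENNReal.tsum_le_tsum fun n => lintegral_mono' Measure.restrict_le_self le_rfl
  filter_upwards [hSae, hT] with x hx hTx
  have hm : ∀ n, AEStronglyMeasurable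
      (fun y => a n * (starRingEnd ℂ) (e n x) * e n y * f y) μ :=
    fun n => ((he n).const_mul _).mul hfm
  have hfin : ∑' n, ∫⁻ y, ‖a n * (starRingEnd ℂ) (e n x) * e n y * f y‖ₑ ∂μ ≠ ⊤ := by
    refine ne_of_lt (lt_of_le_of_lt (le_of_eq ?_) hx)
    refine tsum_congr fun n => ?_
    simp only [enorm_mul, RCLike.enorm_conj, mul_assoc]
    rw [lintegral_const_mul'' _ ((hef n).const_mul _), lintegral_const_mul'' _ (hef n)]
  simp only [← tsum_mul_right]
  refine ⟨integrable_tsum_of_lintegral hm hfin, ?_⟩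
  rw [hTx, integral_tsum hm hfin]
  refine tsum_congr fun n => ?_
  rw [← integral_const_mul]
  refine integral_congr_ae (ae_of_all _ fun y => ?_)
  ring

end ParsevalFrame

namespace Parameters

variable {P : Parameters}

theorem memLp_of_bounded {g : P.FInf → ℂ} (hg : AEStronglyMeasurable g P.muInf) {C : ℝ}
    (hC : ∀ x, ‖g x‖ ≤ C) : MemLp g 2 P.muInf :=
  MemLp.of_bound hg C (ae_of_all _ hC)

variable (P) in
theorem parsevalFrame : ParsevalFrame P.muInf P.frameFun where
  memLp n := by
    obtain ⟨C, hC⟩ := exists_norm_frameFun_le n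
    exact memLp_of_bounded (measurable_frameFun n).aestronglyMeasurable hC
  hasSum f := by
    have h1 := tsum_enorm_frame (Lp.memLp f)
    rw [← eLpNorm_two_sq, ← Lp.enorm_def, enorm_sq_eq_ofReal] at h1
    simp only [enorm_sq_eq_ofReal] at h1
    have h2 : Summable fun n => ‖∫ x, P.frameFun n x * f x ∂P.muInf‖ ^ 2 := by
      by_contra hs
      have h3 := ENNReal.tsum_coe_ne_top_iff_summable_coe
        (f := fun n => (‖∫ x, P.frameFun n x * f x ∂P.muInf‖ ^ 2).toNNReal)
      simp only [Real.coe_toNNReal _ (sq_nonneg _)] at h3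
      refine hs (h3.1 ?_)
      exact h1.trans_ne ENNReal.ofReal_ne_top
    rw [← ENNReal.ofReal_tsum_of_nonneg (fun n => sq_nonneg _) h2,
      ENNReal.ofReal_eq_ofReal_iff (tsum_nonneg fun n => sq_nonneg _) (sq_nonneg _)] at h1
    rw [← h1]
    exact h2.hasSum

open Classical in
-- A bundle has `n_{i+1}` members, parametrized by the last letter.
theorem sum_bundled {M : Type*} [AddCommMonoid M] {i : ℕ} (β : P.Cell (i + 1))
    (X : P.Cell (i + 1) → M) :
    ∑ α, (if P.Bundled (i + 1) α β then X α else 0) =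
      ∑ a, X (β.1, P.wordEquiv i (a, fun l => β.2 l.castSucc)) := by
  have hb : ∀ (q : Fin (2 * P.J (i + 1))) (a : Fin (P.n (i + 1))) (v : P.Word i),
      P.Bundled (i + 1) (q, P.wordEquiv i (a, v)) β ↔
        q = β.1 ∧ v = fun l : Fin i => β.2 l.castSucc := by
    intro q a v
    rw [bundled_iff]
    simp only [wordEquiv_castSucc]
  rw [Fintype.sum_prod_type, Finset.sum_eq_single β.1]
  · rw [← (P.wordEquiv i).sum_comp, Fintype.sum_prod_type_right]
    refine (Finset.sum_eq_single (fun l : Fin i => β.2 l.castSucc) ?_ ?_).trans ?_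
    rotate_left 2
    · refine Finset.sum_congr rfl fun a _ => ?_
      rw [if_pos ((hb _ _ _).2 ⟨rfl, rfl⟩)]
    · intro v _ hv
      refine Finset.sum_eq_zero fun a _ => ?_
      rw [if_neg fun hh => hv ((hb _ _ _).1 hh).2]
    · simp
  · intro q _ hq
    refine Finset.sum_eq_zero fun v _ => ?_
    rw [if_neg fun hh => hq hh.1]
  · simp

theorem Bundled.symm {i : ℕ} {α β : P.Cell i} (h : P.Bundled i α β) : P.Bundled i β α :=
  ⟨h.1.symm, fun l hl => (h.2 l hl).symm⟩

theorem Bundled.trans {i : ℕ} {α β γ : P.Cell i} (h : P.Bundled i α β) (h' : P.Bundled i β γ) :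
    P.Bundled i α γ :=
  ⟨h.1.trans h'.1, fun l hl => (h.2 l hl).trans (h'.2 l hl)⟩

theorem bundled_refl {i : ℕ} (α : P.Cell i) : P.Bundled i α α := ⟨rfl, fun _ _ => rfl⟩

theorem bundled_wordEquiv {i : ℕ} (β : P.Cell (i + 1)) (a : Fin (P.n (i + 1))) :
    P.Bundled (i + 1) (β.1, P.wordEquiv i (a, fun l => β.2 l.castSucc)) β := by
  rw [bundled_iff]
  simp only [wordEquiv_castSucc, and_self]

theorem cellCoeff_comm {i : ℕ} (α β : P.Cell (i + 1)) : P.cellCoeff i α β = P.cellCoeff i β α := by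
  classical
  have : P.Bundled (i + 1) α β ↔ P.Bundled (i + 1) β α := ⟨Bundled.symm, Bundled.symm⟩
  simp only [cellCoeff, eq_comm (a := α), this]

theorem sum_mul_cellCoeff {i : ℕ} (β : P.Cell (i + 1)) (X : P.Cell (i + 1) → ℂ) :
    ∑ α, X α * P.cellCoeff i α β = X β - (P.n (i + 1) : ℂ)⁻¹ *
      ∑ a, X (β.1, P.wordEquiv i (a, fun l => β.2 l.castSucc)) := by
  classical
  rw [← sum_bundled β X]
  simp only [cellCoeff]
  push_cast
  simp only [mul_sub, Finset.sum_sub_distrib, mul_ite, mul_one, mul_zero, Finset.sum_ite_eq',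
    Finset.mem_univ, if_true, mul_comm (P.n (i + 1) : ℂ)⁻¹, apply_ite Complex.ofReal,
    Complex.ofReal_one, Complex.ofReal_zero, ite_mul, one_mul, zero_mul, Finset.sum_mul]

/-- The matrix of the projection has mean zero over each bundle. -/
theorem sum_mul_cellCoeff_eq_zero {i : ℕ} (β : P.Cell (i + 1)) {X : P.Cell (i + 1) → ℂ}
    (hX : ∀ α, P.Bundled (i + 1) α β → X α = X β) : ∑ α, X α * P.cellCoeff i α β = 0 := by
  have hn : (P.n (i + 1) : ℂ) ≠ 0 := by exact_mod_cast (P.n_pos i).ne'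
  rw [sum_mul_cellCoeff, Finset.sum_congr rfl fun a _ => hX _ (bundled_wordEquiv β a)]
  simp [hn]

/-- Idempotence of the projection: the columns already have mean zero over bundles, so projecting
again changes nothing. This collapses the sum over the frame functions of a stage to a single matrix
entry in `levelCoeff_cellMap`. -/
theorem sum_cellCoeff_mul_cellCoeff {i : ℕ} (α β : P.Cell (i + 1)) :
    ∑ γ, (P.cellCoeff i γ α : ℂ) * P.cellCoeff i γ β = P.cellCoeff i α β := by
  have h := sum_mul_cellCoeff α fun γ => (P.cellCoeff i γ β : ℂ)
  have h0 : ∑ a, (P.cellCoeff i (α.1, P.wordEquiv i (a, fun l => α.2 l.castSucc)) β : ℂ) = 0 := by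
    classical
    rw [← sum_bundled α fun γ => (P.cellCoeff i γ β : ℂ)]
    have h1 := sum_mul_cellCoeff_eq_zero β
      (X := fun γ => if P.Bundled (i + 1) γ α then (1 : ℂ) else 0) fun γ hγ => by
        have : P.Bundled (i + 1) γ α ↔ P.Bundled (i + 1) β α :=
          ⟨fun h' => hγ.symm.trans h', fun h' => hγ.trans h'⟩
        simp only [this]
    simpa [ite_mul] using h1
  rw [h0, mul_zero, sub_zero] at h
  rw [← h]
  exact Finset.sum_congr rfl fun γ _ => mul_comm _ _

/-- The identity contributes `1`, and the `n_{i+1}` cells of the bundle contribute `1 / n_{i+1}`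
each. -/
theorem sum_abs_cellCoeff_le {i : ℕ} (β : P.Cell (i + 1)) : ∑ α, |P.cellCoeff i α β| ≤ 2 := by
  classical
  have hn : (P.n (i + 1) : ℝ) ≠ 0 := by exact_mod_cast (P.n_pos i).ne'
  have h1 : ∀ α, |P.cellCoeff i α β| ≤ (if α = β then 1 else 0) +
      (P.n (i + 1) : ℝ)⁻¹ * if P.Bundled (i + 1) α β then 1 else 0 := by
    intro α
    rw [cellCoeff]
    refine (abs_sub _ _).trans_eq ?_
    have h2 : (0 : ℝ) ≤ (P.n (i + 1) : ℝ)⁻¹ := by positivity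
    split_ifs <;> simp
  refine (Finset.sum_le_sum fun α _ => h1 α).trans_eq ?_
  rw [Finset.sum_add_distrib, ← Finset.mul_sum, sum_bundled β fun _ => (1 : ℝ)]
  simp [hn]
  norm_num

/-- Each of the two indicators contributes `1 / N_{i+1}`, as the larger cylinder has mass `1 / N_i`
and weight `1 / n_{i+1}`. -/
theorem lintegral_wordFun_le (i : ℕ) (v : P.Word (i + 1)) :
    ∫⁻ ω, ‖P.wordFun i v ω‖ₑ ∂P.wordMeasure ≤ ENNReal.ofReal (2 / P.N (i + 1)) := by
  have hN : (0 : ℝ) < P.N (i + 1) := by exact_mod_cast P.N_pos (i + 1)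
  have hn : (0 : ℝ) < P.n (i + 1) := by exact_mod_cast P.n_pos i
  have hN0 : (0 : ℝ) < P.N i := by exact_mod_cast P.N_pos i
  have h1 : ∀ ω, ‖P.wordFun i v ω‖ₑ ≤ (P.cylinder (i + 1) v).indicator 1 ω +
      ENNReal.ofReal (P.n (i + 1) : ℝ)⁻¹ *
        (P.cylinder i (fun l => v l.castSucc)).indicator 1 ω := by
    intro ω
    refine enorm_sub_le.trans ?_
    by_cases ha : ω ∈ P.cylinder (i + 1) v <;>
      by_cases hb : ω ∈ P.cylinder i (fun l => v l.castSucc) <;>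
      simp [ha, hb, Real.enorm_eq_ofReal, hn.le]
  refine (lintegral_mono h1).trans_eq ?_
  rw [lintegral_add_left (measurable_one.indicator (P.measurableSet_cylinder _ _)),
    lintegral_const_mul _ (measurable_one.indicator (P.measurableSet_cylinder _ _)),
    lintegral_indicator_one (P.measurableSet_cylinder _ _),
    lintegral_indicator_one (P.measurableSet_cylinder _ _), wordMeasure_cylinder,
    wordMeasure_cylinder]
  rw [← ENNReal.ofReal_natCast, ← ENNReal.ofReal_inv_of_pos hN, ← ENNReal.ofReal_natCast,
    ← ENNReal.ofReal_inv_of_pos hN0, ← ENNReal.ofReal_mul (by positivity),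
    ← ENNReal.ofReal_add (by positivity) (by positivity)]
  congr 1
  rw [N_succ]
  push_cast
  field_simp
  norm_num

theorem lintegral_arcFun_le (i : ℕ) (q : Fin (2 * P.J i)) (k : ℕ) :
    ∫⁻ η, ‖P.arcFun i q k η‖ₑ ∂arcLength ≤ ENNReal.ofReal (P.L i) := by
  have h1 : ∀ η, ‖P.arcFun i q k η‖ₑ ≤
      (Ioo (P.L i * (q : ℕ)) (P.L i * (q : ℕ) + P.L i)).indicator 1 η := by
    intro η
    have h2 := P.abs_arcFun_le i q k η
    by_cases hη : η ∈ Ioo (P.L i * (q : ℕ)) (P.L i * (q : ℕ) + P.L i)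
    · rw [indicator_of_mem hη, Pi.one_apply, ← ofReal_norm, Real.norm_eq_abs]
      simpa using ENNReal.ofReal_le_ofReal h2
    · rw [arcFun, indicator_of_notMem hη]
      simp
  refine (lintegral_mono h1).trans ?_
  rw [lintegral_indicator_one measurableSet_Ioo]
  refine (Measure.restrict_apply_le _ _).trans_eq ?_
  rw [Real.volume_Ioo, add_sub_cancel_left]

theorem lintegral_sineFun_le (i : ℕ) (α : P.Cell (i + 1)) (k : ℕ) :
    ∫⁻ x, ‖P.sineFun i α k (P.Phi (i + 1) x)‖ₑ ∂P.muInf ≤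
      ENNReal.ofReal (P.amplitude (i + 1) * (P.L (i + 1) * (2 / P.N (i + 1)))) := by
  have hm : Measurable fun x => ‖P.sineFun i α k (P.Phi (i + 1) x)‖ₑ :=
    ((measurable_sineFun i α k).comp (P.measurable_Phi _)).enorm
  rw [← measurePreserving_pointInf.lintegral_comp hm]
  have h1 : ∀ᵐ z ∂P.wordProd, ‖P.sineFun i α k (P.Phi (i + 1) (P.pointInf (z.1 : Circ) z.2))‖ₑ =
      ENNReal.ofReal (P.amplitude (i + 1)) *
        (‖P.arcFun (i + 1) α.1 k z.1‖ₑ * ‖P.wordFun i α.2 z.2‖ₑ) := by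
    filter_upwards [ae_wordProd] with z hz
    rw [Phi_pointInf, sineFun_point i α k hz, enorm_mul, enorm_mul,
      Real.enorm_eq_ofReal (P.amplitude_nonneg _)]
  have hL := P.L_pos (i + 1)
  rw [lintegral_congr_ae h1, lintegral_const_mul' _ _ ENNReal.ofReal_ne_top, wordProd,
    lintegral_prod_mul (P.measurable_arcFun _ _ _).enorm.aemeasurable
      (P.measurable_wordFun _ _).enorm.aemeasurable,
    ENNReal.ofReal_mul (P.amplitude_nonneg _), ENNReal.ofReal_mul hL.le]
  gcongr
  · exact lintegral_arcFun_le _ _ _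
  · exact lintegral_wordFun_le _ _

theorem sum_enorm_sineFun_le (i k : ℕ) (y : P.F (i + 1)) :
    ∑ α, ‖P.sineFun i α k y‖ₑ ≤ ENNReal.ofReal (P.amplitude (i + 1) * 2) := by
  obtain ⟨β, θ, hθ, rfl⟩ := exists_cellMap y
  simp only [← ofReal_norm]
  rw [← ENNReal.ofReal_sum_of_nonneg fun α _ => norm_nonneg _]
  refine ENNReal.ofReal_le_ofReal ?_
  calc ∑ α, ‖P.sineFun i α k (P.cellMap (i + 1) β θ)‖
      ≤ ∑ α, P.amplitude (i + 1) * |P.cellCoeff i α β| := by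
        refine Finset.sum_le_sum fun α _ => ?_
        rw [sineFun_cellMap i α β k ⟨hθ.1, hθ.2.le⟩, norm_mul, norm_mul, Real.norm_eq_abs,
          Real.norm_eq_abs, Real.norm_eq_abs, abs_of_nonneg (P.amplitude_nonneg _)]
        refine mul_le_mul_of_nonneg_left ?_ (P.amplitude_nonneg _)
        exact mul_le_of_le_one_left (abs_nonneg _) (Real.abs_sin_le_one _)
    _ ≤ _ := by
        rw [← Finset.mul_sum]
        exact mul_le_mul_of_nonneg_left (sum_abs_cellCoeff_le β) (P.amplitude_nonneg _)

/-- The squared amplitude `2N/L` is cancelled by the `L¹` size `2L/N` of one frame function, and the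
sum over the cells adds a factor `2`. Since the bound is uniform in the stage, `SummableAlong` can
count each pair (stage, `k`) once, without the multiplicity of the cells. -/
theorem sum_lintegral_mul_sineFun_le (i k : ℕ) (y : P.F (i + 1)) :
    ∑ α, (∫⁻ x, ‖P.sineFun i α k (P.Phi (i + 1) x)‖ₑ ∂P.muInf) * ‖P.sineFun i α k y‖ₑ ≤ 8 := by
  have hN : (0 : ℝ) < P.N (i + 1) := by exact_mod_cast P.N_pos (i + 1)
  have hL := P.L_pos (i + 1)
  refine (Finset.sum_le_sum fun α _ =>
    mul_le_mul_left (lintegral_sineFun_le i α k) _).trans ?_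
  rw [← Finset.mul_sum]
  refine (mul_le_mul_right (sum_enorm_sineFun_le i k y) _).trans_eq ?_
  rw [← ENNReal.ofReal_mul (by have := P.amplitude_nonneg (i + 1); positivity)]
  have : P.amplitude (i + 1) * (P.L (i + 1) * (2 / P.N (i + 1))) * (P.amplitude (i + 1) * 2) =
      P.amplitude (i + 1) ^ 2 * P.L (i + 1) * 4 / P.N (i + 1) := by ring
  rw [this, amplitude_sq]
  have h8 : 2 * (P.N (i + 1) : ℝ) / P.L (i + 1) * P.L (i + 1) * 4 / P.N (i + 1) = 8 := by
    field_simp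
    norm_num
  rw [h8]
  norm_num

/-- The multipliers which are functions of the eigenvalue and for which the terms of the kernel are
summable. -/
def SummableAlong (P : Parameters) (b : ℕ → ℂ) : Prop :=
  Summable (fun k => ‖b k‖) ∧ Summable fun p : ℕ × ℕ => ‖b ((p.2 + 1) * P.J (p.1 + 1))‖

theorem exists_bound_kernel {b : ℕ → ℂ} (hb : P.SummableAlong b) :
    ∃ B : ENNReal, B ≠ ⊤ ∧ ∀ y, ∑' n, ‖b (P.freq n)‖ₑ * (∫⁻ x, ‖P.frameFun n x‖ₑ ∂P.muInf) *
      ‖P.frameFun n y‖ₑ ≤ B := by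
  set D : ENNReal := ENNReal.ofReal (√(2 * Real.pi))⁻¹ * P.muInf univ *
    ENNReal.ofReal (√(2 * Real.pi))⁻¹ with hD
  have hD' : D ≠ ⊤ := ENNReal.mul_ne_top
    (ENNReal.mul_ne_top ENNReal.ofReal_ne_top (measure_ne_top _ _)) ENNReal.ofReal_ne_top
  refine ⟨(∑' m : ℤ, ‖b m.natAbs‖ₑ) * D +
    (∑' p : ℕ × ℕ, ‖b ((p.2 + 1) * P.J (p.1 + 1))‖ₑ) * 8, ?_, fun y => ?_⟩
  · refine ENNReal.add_ne_top.2 ⟨ENNReal.mul_ne_top ?_ hD', ENNReal.mul_ne_top ?_ (by norm_num)⟩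
    · rw [tsum_int_of_even fun m => by rw [Int.natAbs_neg]]
      refine ENNReal.add_ne_top.2 ⟨enorm_ne_top, ENNReal.mul_ne_top (by norm_num) ?_⟩
      refine tsum_enorm_ne_top_iff_summable_norm.2 ?_
      exact (summable_nat_add_iff 1).2 hb.1
    · exact tsum_enorm_ne_top_iff_summable_norm.2 hb.2
  · rw [ENNReal.summable.tsum_sum ENNReal.summable, ENNReal.tsum_sigma']
    refine add_le_add ?_ ?_
    · rw [← ENNReal.tsum_mul_right]
      refine ENNReal.tsum_le_tsum fun m => ?_
      have h1 : ∀ x, ‖P.frameFun (.inl m) x‖ₑ = ENNReal.ofReal (√(2 * Real.pi))⁻¹ := by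
        intro x
        rw [frameFun, ← ofReal_norm, norm_expFun]
      simp only [h1, lintegral_const, freq, mul_assoc, hD]
      exact le_rfl
    · rw [ENNReal.tsum_prod', ← ENNReal.tsum_mul_right]
      refine ENNReal.tsum_le_tsum fun i => ?_
      rw [ENNReal.tsum_prod', tsum_fintype, ← Summable.tsum_finsetSum fun _ _ => ENNReal.summable,
        ← ENNReal.tsum_mul_right]
      refine ENNReal.tsum_le_tsum fun k => ?_
      simp only [freq, mul_assoc]
      rw [← Finset.mul_sum]
      refine mul_le_mul_right ?_ _
      have h1 : ∀ (α : P.Cell (i + 1)) x, ‖P.frameFun (.inr ⟨i, α, k⟩) x‖ₑ =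
          ‖P.sineFun i α k (P.Phi (i + 1) x)‖ₑ := by
        intro α x
        rw [frameFun, ← ofReal_norm, ← ofReal_norm, Complex.norm_real]
      simp only [h1]
      exact sum_lintegral_mul_sineFun_le i k _

end Parameters
end DiamondFractal
end

/-! ### Refinement of the graphs, Green's identity and the eigenvalue equations -/

noncomputable section

namespace DiamondFractal

/-- The Kirchhoff condition in dual form: a balance at every vertex is a balance against every
function on the vertices. Sums over cells are then enough, and the vertices need not be enumerated.
-/
theorem forall_finsum_fiber_eq_iff {A V : Type*} [Fintype A] (s e : A → V) (X Y : A → ℂ) :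
    (∀ v, (∑ᶠ α ∈ {α | s α = v}, X α) = ∑ᶠ α ∈ {α | e α = v}, Y α) ↔
      ∀ φ : V → ℂ, ∑ α, φ (s α) * X α = ∑ α, φ (e α) * Y α := by
  classical
  have h1 : ∀ (s : A → V) (X : A → ℂ) (v : V), (∑ᶠ α ∈ {α | s α = v}, X α) =
      ∑ α, (if s α = v then X α else 0) := by
    intro s X v
    rw [finsum_mem_def, finsum_eq_sum_of_fintype]
    refine Finset.sum_congr rfl fun α _ => ?_
    simp [indicator_apply]
  simp only [h1]
  constructor
  · intro h φ
    set T : Finset V := Finset.univ.image s ∪ Finset.univ.image e with hT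
    have h2 : ∀ (s : A → V) (X : A → ℂ), (∀ α, s α ∈ T) →
        ∑ α, φ (s α) * X α = ∑ v ∈ T, φ v * ∑ α, if s α = v then X α else 0 := by
      intro s X hs
      simp only [Finset.mul_sum]
      rw [Finset.sum_comm]
      refine Finset.sum_congr rfl fun α _ => ?_
      simp [hs]
    rw [h2 s X fun α => by simp [hT], h2 e Y fun α => by simp [hT]]
    exact Finset.sum_congr rfl fun v _ => by rw [h v]
  · intro h v
    simpa using h fun v' => if v' = v then 1 else 0

namespace Parameters

variable {P : Parameters}

/-- The data which witness that `h` is the Laplacian of `g`, with the Kirchhoff condition in weak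
form. -/
structure LaplacianData (i : ℕ) (g h : P.F i → ℂ) (G : P.Cell i → ℝ → ℂ) : Prop where
  contDiff : ∀ α, ContDiff ℝ 2 (G α)
  apply_eq : ∀ α, ∀ θ ∈ Icc 0 (P.L i), g (P.cellMap i α θ) = G α θ
  laplacian_eq : ∀ α, ∀ θ ∈ Ioo 0 (P.L i), h (P.cellMap i α θ) = -deriv (deriv (G α)) θ
  kirchhoff : ∀ φ : P.F i → ℂ, ∑ α, φ (P.cellMap i α 0) * deriv (G α) 0 =
    ∑ α, φ (P.cellMap i α (P.L i)) * deriv (G α) (P.L i)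

theorem isLaplacian_iff {i : ℕ} {g h : P.F i → ℂ} :
    P.IsLaplacian i g h ↔ ∃ G, LaplacianData i g h G := by
  refine exists_congr fun G => ?_
  rw [forall_finsum_fiber_eq_iff (fun α => P.cellMap i α 0) (fun α => P.cellMap i α (P.L i))
    (fun α => deriv (G α) 0) fun α => deriv (G α) (P.L i)]
  exact ⟨fun ⟨h1, h2, h3, h4⟩ => ⟨h1, h2, h3, h4⟩, fun ⟨h1, h2, h3, h4⟩ => ⟨h1, h2, h3, h4⟩⟩

/-- An arc of length `L_i` consists of `j_{i+1}` arcs of length `L_{i+1}`. -/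
def arcEquiv (P : Parameters) (i : ℕ) :
    Fin (2 * P.J i) × Fin (P.j (i + 1)) ≃ Fin (2 * P.J (i + 1)) :=
  finProdFinEquiv.trans (finCongr (by rw [J_succ, mul_assoc]))

theorem arcEquiv_apply (i : ℕ) (q : Fin (2 * P.J i)) (r : Fin (P.j (i + 1))) :
    (P.arcEquiv i (q, r) : ℕ) = r + P.j (i + 1) * q := by
  simp [arcEquiv]

theorem L_mul_arcEquiv (i : ℕ) (q : Fin (2 * P.J i)) (r : Fin (P.j (i + 1))) :
    P.L (i + 1) * ((P.arcEquiv i (q, r) : ℕ) : ℝ) =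
      P.L i * (q : ℕ) + P.L (i + 1) * (r : ℕ) := by
  rw [arcEquiv_apply, P.L_succ i]
  push_cast
  ring

theorem sum_cell_succ {i : ℕ} (X : P.Cell (i + 1) → ℂ) :
    ∑ α, X α = ∑ β : P.Cell i, ∑ a, ∑ r : Fin (P.j (i + 1)),
      X (P.arcEquiv i (β.1, r), P.wordEquiv i (a, β.2)) := by
  rw [Fintype.sum_prod_type_right, ← (P.wordEquiv i).sum_comp, Fintype.sum_prod_type_right,
    Fintype.sum_prod_type_right]
  refine Finset.sum_congr rfl fun v _ => ?_
  refine Eq.trans ?_ Finset.sum_comm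
  refine Finset.sum_congr rfl fun a _ => ?_
  rw [← (P.arcEquiv i).sum_comp, Fintype.sum_prod_type]

theorem sum_fin_succ_eq {m : ℕ} {f : ℕ → ℂ} :
    ∑ r : Fin m, f r + f m = ∑ r : Fin m, f (r + 1) + f 0 := by
  rw [Fin.sum_univ_eq_sum_range, Fin.sum_univ_eq_sum_range fun r => f (r + 1),
    ← Finset.sum_range_succ, Finset.sum_range_succ']

theorem proj_cellMap (i : ℕ) (q : Fin (2 * P.J i)) (r : Fin (P.j (i + 1))) (a : Fin (P.n (i + 1)))
    (v : P.Word i) (θ : ℝ) :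
    P.proj i (P.cellMap (i + 1) (P.arcEquiv i (q, r), P.wordEquiv i (a, v)) θ) =
      P.cellMap i (q, v) (P.L (i + 1) * (r : ℕ) + θ) := by
  rw [cellMap_eq, cellMap_eq, proj_point, L_mul_arcEquiv, add_assoc]
  simp only [wordEquiv_castSucc]

theorem glue_cellMap (i : ℕ) (q : Fin (2 * P.J i)) (r : Fin (P.j (i + 1))) (a : Fin (P.n (i + 1)))
    (v : P.Word i) (θ : ℝ) :
    P.cellMap (i + 1) (P.arcEquiv i (q, r), P.wordEquiv i (a, v)) θ =
      P.glue i (P.cellMap i (q, v) (P.L (i + 1) * (r : ℕ) + θ), a) := by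
  rw [cellMap_eq, cellMap_eq, point, L_mul_arcEquiv, add_assoc]
  simp only [wordEquiv_castSucc, wordEquiv_last]

theorem deriv_const_add_comp (f : ℝ → ℂ) (c : ℝ) :
    deriv (fun θ => f (c + θ)) = fun θ => deriv f (c + θ) :=
  funext fun θ => by rw [deriv_comp_const_add]

theorem LaplacianData.pullback {i : ℕ} {g h : P.F i → ℂ} {G : P.Cell i → ℝ → ℂ}
    (H : LaplacianData i g h G) :
    P.IsLaplacian (i + 1) (fun y => g (P.proj i y)) (fun y => h (P.proj i y)) := by
  set K : P.Cell (i + 1) → ℝ → ℂ := fun α θ =>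
    G (((P.arcEquiv i).symm α.1).1, ((P.wordEquiv i).symm α.2).2)
      (P.L (i + 1) * (((P.arcEquiv i).symm α.1).2 : ℕ) + θ) with hK
  have hK1 : ∀ q r a v, K (P.arcEquiv i (q, r), P.wordEquiv i (a, v)) =
      fun θ => G (q, v) (P.L (i + 1) * (r : ℕ) + θ) := by
    intro q r a v
    simp [hK]
  have hL := P.L_pos (i + 1)
  have hle : ∀ r : Fin (P.j (i + 1)), P.L (i + 1) * (r : ℕ) + P.L (i + 1) ≤ P.L i := by
    intro r
    have : ((r : ℕ) : ℝ) + 1 ≤ P.j (i + 1) := by exact_mod_cast r.2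
    rw [P.L_succ i]
    nlinarith
  have h0 : ∀ r : Fin (P.j (i + 1)), 0 ≤ P.L (i + 1) * ((r : ℕ) : ℝ) := fun r => by positivity
  have hcell : ∀ α : P.Cell (i + 1), ∃ q r a v,
      α = (P.arcEquiv i (q, r), P.wordEquiv i (a, v)) := fun α =>
    ⟨((P.arcEquiv i).symm α.1).1, ((P.arcEquiv i).symm α.1).2, ((P.wordEquiv i).symm α.2).1,
      ((P.wordEquiv i).symm α.2).2, by simp⟩
  refine isLaplacian_iff.2 ⟨K, fun α => ?_, fun α θ hθ => ?_, fun α θ hθ => ?_, fun φ => ?_⟩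
  · exact (H.contDiff _).comp (contDiff_const.add contDiff_id)
  · obtain ⟨q, r, a, v, rfl⟩ := hcell α
    rw [proj_cellMap, hK1, H.apply_eq]
    exact ⟨add_nonneg (h0 r) hθ.1, by linarith [hle r, hθ.2]⟩
  · obtain ⟨q, r, a, v, rfl⟩ := hcell α
    rw [proj_cellMap, hK1, H.laplacian_eq, deriv_const_add_comp, deriv_const_add_comp]
    exact ⟨add_pos_of_nonneg_of_pos (h0 r) hθ.1, by linarith [hle r, hθ.2]⟩
  · rw [sum_cell_succ, sum_cell_succ]
    simp only [hK1, deriv_const_add_comp, glue_cellMap, add_zero]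
    -- The fluxes of a pullback agree on the `n_{i+1}` copies, so `φ` acts through its sum over the
    -- copies.
    have h1 := H.kirchhoff fun y => ∑ a, φ (P.glue i (y, a))
    simp only [Finset.sum_mul] at h1
    -- Adding the flux at the end of every old cell, and rewriting it on one side as the flux at the
    -- start, reduces the claim to a telescoping sum on each old cell: the fluxes at the new
    -- interior vertices cancel.
    rw [← add_left_inj (∑ β : P.Cell i, ∑ a, φ (P.glue i (P.cellMap i β (P.L i), a)) *
      deriv (G β) (P.L i))]
    conv_rhs => rw [← h1]
    simp only [← Finset.sum_add_distrib]
    refine Finset.sum_congr rfl fun β _ => Finset.sum_congr rfl fun a _ => ?_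
    have h2 := sum_fin_succ_eq (m := P.j (i + 1))
      (f := fun r => φ (P.glue i (P.cellMap i β (P.L (i + 1) * (r : ℕ)), a)) *
        deriv (G β) (P.L (i + 1) * (r : ℕ)))
    simpa only [← P.L_succ i, Nat.cast_add, Nat.cast_one, mul_add, mul_one, Nat.cast_zero,
      mul_zero] using h2

theorem IsLaplacian.exists_pullback {i : ℕ} {g h : P.F i → ℂ} (H : P.IsLaplacian i g h) {m : ℕ}
    (him : i ≤ m) : ∃ g' h' : P.F m → ℂ, P.IsLaplacian m g' h' ∧
      (∀ x, g' (P.Phi m x) = g (P.Phi i x)) ∧ ∀ x, h' (P.Phi m x) = h (P.Phi i x) := by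
  induction m, him using Nat.le_induction with
  | base => exact ⟨g, h, H, fun _ => rfl, fun _ => rfl⟩
  | succ m _ ih =>
    obtain ⟨g', h', H', hg, hh⟩ := ih
    obtain ⟨G, HG⟩ := isLaplacian_iff.1 H'
    refine ⟨_, _, HG.pullback, fun x => ?_, fun x => ?_⟩
    · rw [← hg]
      exact congr_arg g' (x.2 m)
    · rw [← hh]
      exact congr_arg h' (x.2 m)

namespace LaplacianData

variable {i : ℕ} {g h : P.F i → ℂ} {G : P.Cell i → ℝ → ℂ} (H : LaplacianData i g h G)
include H

theorem contDiff_deriv (α : P.Cell i) : ContDiff ℝ 1 (deriv (G α)) :=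
  ((contDiff_succ_iff_deriv (n := 1)).1 (H.contDiff α)).2.2

theorem continuous_deriv_deriv (α : P.Cell i) : Continuous (deriv (deriv (G α))) :=
  (H.contDiff_deriv α).continuous_deriv le_rfl

theorem measurable : Measurable g :=
  measurable_of_cellMap (fun α => (H.contDiff α).continuous.measurable)
    fun α θ hθ => H.apply_eq α θ ⟨hθ.1.le, hθ.2.le⟩

theorem measurable_laplacian : Measurable h :=
  measurable_of_cellMap (fun α => (H.continuous_deriv_deriv α).neg.measurable) H.laplacian_eq

end LaplacianData

theorem exists_bound_cells {i : ℕ} {G : P.Cell i → ℝ → ℂ} (hG : ∀ α, Continuous (G α)) :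
    ∃ C, ∀ α, ∀ θ ∈ Icc 0 (P.L i), ‖G α θ‖ ≤ C := by
  choose C hC using fun α => isCompact_Icc.exists_bound_of_continuousOn (s := Icc 0 (P.L i))
    (hG α).continuousOn
  refine ⟨∑ α, |C α|, fun α θ hθ => ((hC α θ hθ).trans (le_abs_self _)).trans ?_⟩
  exact Finset.single_le_sum (f := fun α => |C α|) (fun β _ => abs_nonneg _) (Finset.mem_univ α)

namespace LaplacianData

variable {i : ℕ} {g h : P.F i → ℂ} {G : P.Cell i → ℝ → ℂ} (H : LaplacianData i g h G)
include H

theorem exists_bound : ∃ C, ∀ y, ‖g y‖ ≤ C := by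
  obtain ⟨C, hC⟩ := exists_bound_cells fun α => (H.contDiff α).continuous
  refine ⟨C, fun y => ?_⟩
  obtain ⟨α, θ, hθ, rfl⟩ := exists_cellMap y
  have hθ' : θ ∈ Icc 0 (P.L i) := ⟨hθ.1, hθ.2.le⟩
  rw [H.apply_eq α θ hθ']
  exact hC α θ hθ'

/-- At the vertices the values of `h` are arbitrary, but there are only finitely many of them; their
norms are added to the bound. -/
theorem exists_bound_laplacian : ∃ C, ∀ y, ‖h y‖ ≤ C := by
  obtain ⟨C, hC⟩ := exists_bound_cells H.continuous_deriv_deriv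
  refine ⟨|C| + ∑ α, ‖h (P.cellMap i α 0)‖, fun y => ?_⟩
  have h0 : 0 ≤ ∑ α, ‖h (P.cellMap i α 0)‖ := Finset.sum_nonneg fun _ _ => norm_nonneg _
  obtain ⟨α, θ, hθ, rfl⟩ := exists_cellMap y
  rcases hθ.1.eq_or_lt with h1 | h1
  · rw [← h1]
    have := Finset.single_le_sum (f := fun α => ‖h (P.cellMap i α 0)‖)
      (fun β _ => norm_nonneg _) (Finset.mem_univ α)
    linarith [abs_nonneg C]
  · rw [H.laplacian_eq α θ ⟨h1, hθ.2⟩, norm_neg]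
    linarith [hC α θ ⟨hθ.1, hθ.2.le⟩, le_abs_self C]

end LaplacianData

theorem IsLaplacian.memLp {i : ℕ} {g h : P.F i → ℂ} (H : P.IsLaplacian i g h) :
    MemLp (fun x => g (P.Phi i x)) 2 P.muInf ∧ MemLp (fun x => h (P.Phi i x)) 2 P.muInf := by
  obtain ⟨G, HG⟩ := isLaplacian_iff.1 H
  obtain ⟨C, hC⟩ := HG.exists_bound
  obtain ⟨C', hC'⟩ := HG.exists_bound_laplacian
  exact ⟨memLp_of_bounded (HG.measurable.comp (P.measurable_Phi i)).aestronglyMeasurable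
      fun x => hC _,
    memLp_of_bounded (HG.measurable_laplacian.comp (P.measurable_Phi i)).aestronglyMeasurable
      fun x => hC' _⟩

theorem integral_mul_deriv_deriv {u v : ℝ → ℂ} (hu : ContDiff ℝ 2 u) (hv : ContDiff ℝ 2 v)
    (a b : ℝ) : ∫ θ in a..b, u θ * deriv (deriv v) θ =
      (u b * deriv v b - u a * deriv v a) - ∫ θ in a..b, deriv u θ * deriv v θ := by
  have hu1 := (contDiff_succ_iff_deriv (n := 1)).1 hu
  have hv1 := (contDiff_succ_iff_deriv (n := 1)).1 hv
  refine intervalIntegral.integral_mul_deriv_eq_deriv_mul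
    (fun x _ => (hu1.1 x).hasDerivAt)
    (fun x _ => ((hv1.2.2.differentiable one_ne_zero) x).hasDerivAt)
    (hu1.2.2.continuous.intervalIntegrable _ _)
    ((hv1.2.2.continuous_deriv le_rfl).intervalIntegrable _ _)

/-- Green's identity on `F_i`. -/
theorem green_mu {i : ℕ} {g₁ h₁ g₂ h₂ : P.F i → ℂ} (H₁ : P.IsLaplacian i g₁ h₁)
    (H₂ : P.IsLaplacian i g₂ h₂) :
    ∫ y, g₁ y * h₂ y ∂P.mu i = ∫ y, h₁ y * g₂ y ∂P.mu i := by
  obtain ⟨G₁, H₁⟩ := isLaplacian_iff.1 H₁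
  obtain ⟨G₂, H₂⟩ := isLaplacian_iff.1 H₂
  -- Integration by parts on each cell. The boundary terms cancel by the Kirchhoff condition of `g₂`
  -- tested against `g₁`, and the Dirichlet form that remains is symmetric.
  have key : ∀ {g₁ h₁ g₂ h₂ : P.F i → ℂ} {G₁ G₂}, LaplacianData i g₁ h₁ G₁ →
      LaplacianData i g₂ h₂ G₂ → ∫ y, g₁ y * h₂ y ∂P.mu i = (P.N i : ℂ)⁻¹ *
        ∑ α : P.Cell i, ∫ θ in 0..P.L i, deriv (G₁ α) θ * deriv (G₂ α) θ := by
    intro g₁ h₁ g₂ h₂ G₁ G₂ H₁ H₂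
    obtain ⟨C, hC⟩ := H₁.exists_bound
    obtain ⟨C', hC'⟩ := H₂.exists_bound_laplacian
    rw [integral_mu (f := fun y => g₁ y * h₂ y) (H₁.measurable.mul H₂.measurable_laplacian)
      (C := |C| * |C'|) fun α θ _ => by
      rw [norm_mul]
      exact mul_le_mul ((hC _).trans (le_abs_self _)) ((hC' _).trans (le_abs_self _))
        (norm_nonneg _) (abs_nonneg _)]
    congr 1
    have h1 : ∀ α : P.Cell i, ∫ θ in 0..P.L i, g₁ (P.cellMap i α θ) * h₂ (P.cellMap i α θ) =
        (g₁ (P.cellMap i α 0) * deriv (G₂ α) 0 -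
          g₁ (P.cellMap i α (P.L i)) * deriv (G₂ α) (P.L i)) +
          ∫ θ in 0..P.L i, deriv (G₁ α) θ * deriv (G₂ α) θ := by
      intro α
      have h2 : ∫ θ in 0..P.L i, g₁ (P.cellMap i α θ) * h₂ (P.cellMap i α θ) =
          ∫ θ in 0..P.L i, -(G₁ α θ * deriv (deriv (G₂ α)) θ) := by
        rw [intervalIntegral.integral_of_le (P.L_pos i).le,
          intervalIntegral.integral_of_le (P.L_pos i).le, integral_Ioc_eq_integral_Ioo,
          integral_Ioc_eq_integral_Ioo]
        refine setIntegral_congr_fun measurableSet_Ioo fun θ hθ => ?_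
        rw [H₁.apply_eq α θ ⟨hθ.1.le, hθ.2.le⟩, H₂.laplacian_eq α θ hθ, mul_neg]
      rw [h2, intervalIntegral.integral_neg,
        integral_mul_deriv_deriv (H₁.contDiff α) (H₂.contDiff α),
        H₁.apply_eq α 0 ⟨le_rfl, (P.L_pos i).le⟩, H₁.apply_eq α _ ⟨(P.L_pos i).le, le_rfl⟩]
      ring
    rw [Finset.sum_congr rfl fun α _ => h1 α, Finset.sum_add_distrib, Finset.sum_sub_distrib,
      H₂.kirchhoff g₁, sub_self, zero_add]
  rw [key H₁ H₂, integral_congr_ae (ae_of_all _ fun y => mul_comm (h₁ y) (g₂ y)), key H₂ H₁]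
  simp only [mul_comm]

theorem integral_Phi {i : ℕ} {f : P.F i → ℂ} (hf : Measurable f) :
    ∫ x, f (P.Phi i x) ∂P.muInf = ∫ y, f y ∂P.mu i := by
  rw [← P.map_Phi_muInf i, integral_map (P.measurable_Phi i).aemeasurable hf.aestronglyMeasurable]

/-- Green's identity on `F_∞`. -/
theorem green_muInf {i k : ℕ} {g₁ h₁ : P.F i → ℂ} {g₂ h₂ : P.F k → ℂ}
    (H₁ : P.IsLaplacian i g₁ h₁) (H₂ : P.IsLaplacian k g₂ h₂) :
    ∫ x, g₁ (P.Phi i x) * h₂ (P.Phi k x) ∂P.muInf =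
      ∫ x, h₁ (P.Phi i x) * g₂ (P.Phi k x) ∂P.muInf := by
  obtain ⟨g₁', h₁', H₁', e1, e2⟩ := H₁.exists_pullback (le_max_left i k)
  obtain ⟨g₂', h₂', H₂', e3, e4⟩ := H₂.exists_pullback (le_max_right i k)
  simp only [← e1, ← e2, ← e3, ← e4]
  obtain ⟨G₁, HG₁⟩ := isLaplacian_iff.1 H₁'
  obtain ⟨G₂, HG₂⟩ := isLaplacian_iff.1 H₂'
  rw [integral_Phi (f := fun y => g₁' y * h₂' y) (HG₁.measurable.mul HG₂.measurable_laplacian),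
    integral_Phi (f := fun y => h₁' y * g₂' y) (HG₁.measurable_laplacian.mul HG₂.measurable)]
  exact green_mu H₁' H₂'

/-! ### The eigenfunctions -/

/-- Even `F_0` is a graph with vertices, the ends of its two half circles. The Kirchhoff sums differ
by a telescoping sum around the circle, which vanishes by periodicity. -/
theorem isLaplacian_expFun (m : ℤ) :
    P.IsLaplacian 0 (P.expFun m) (fun y => (m.natAbs : ℂ) ^ 2 * P.expFun m y) := by
  set c : ℂ := (((√(2 * Real.pi))⁻¹ : ℝ) : ℂ) with hc
  have hE : ∀ η : ℝ, fourier m (η : Circ) = Complex.exp (Complex.I * m * η) := by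
    intro η
    rw [fourier_coe_apply]
    congr 1
    have : (Real.pi : ℂ) ≠ 0 := by exact_mod_cast Real.pi_ne_zero
    push_cast
    field_simp
  have hexp : ∀ α θ, P.expFun m (P.cellMap 0 α θ) =
      c * Complex.exp (Complex.I * m * ((P.L 0 * (α.1 : ℕ) + θ : ℝ) : ℂ)) := by
    intro α θ
    rw [expFun, cellMap_eq, angle_point, hE]
  have hd : ∀ (d : ℂ) (a : ℝ), deriv (fun θ : ℝ =>
      d * Complex.exp (Complex.I * m * ((a + θ : ℝ) : ℂ))) =
      fun θ : ℝ => (d * (Complex.I * m)) * Complex.exp (Complex.I * m * ((a + θ : ℝ) : ℂ)) := by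
    intro d a
    funext θ
    have h1 : HasDerivAt (fun θ : ℝ => ((a + θ : ℝ) : ℂ)) 1 θ := by
      simpa using ((hasDerivAt_id θ).const_add a).ofReal_comp
    have h2 := ((h1.const_mul (Complex.I * m)).cexp.const_mul d).deriv
    rw [h2]
    ring
  have hm : (m : ℂ) ^ 2 = (m.natAbs : ℂ) ^ 2 := by
    rw [← Int.cast_natCast m.natAbs, ← Int.cast_pow, ← Int.cast_pow, Int.natAbs_sq]
  refine isLaplacian_iff.2 ⟨fun α θ => P.expFun m (P.cellMap 0 α θ), fun α => ?_, fun α θ _ => rfl,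
    fun α θ _ => ?_, fun φ => ?_⟩
  · simp only [hexp]
    have h1 : ContDiff ℝ 2 fun θ : ℝ => ((P.L 0 * (α.1 : ℕ) + θ : ℝ) : ℂ) :=
      Complex.ofRealCLM.contDiff.comp (contDiff_const.add contDiff_id)
    exact contDiff_const.mul (contDiff_const.mul h1).cexp
  · simp only [hexp, hd]
    linear_combination (c * Complex.exp (Complex.I * m * ((P.L 0 * (α.1 : ℕ) + θ : ℝ) : ℂ)) *
      (m : ℂ) ^ 2) * Complex.I_sq - (c * Complex.exp (Complex.I * m *
        ((P.L 0 * (α.1 : ℕ) + θ : ℝ) : ℂ))) * hm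
  · simp only [hexp, hd]
    set f : ℝ → ℂ := fun η => φ (η : Circ) * (c * (Complex.I * m) * fourier m (η : Circ)) with hf
    have h1 : ∀ (α : P.Cell 0) θ, φ (P.cellMap 0 α θ) * (c * (Complex.I * m) *
        Complex.exp (Complex.I * m * ((P.L 0 * (α.1 : ℕ) + θ : ℝ) : ℂ))) =
        f (P.L 0 * (α.1 : ℕ) + θ) := by
      intro α θ
      rw [hf]
      simp only
      rw [hE]
      rfl
    simp only [h1]
    rw [Fintype.sum_prod_type_right, Fintype.sum_prod_type_right]
    refine Finset.sum_congr rfl fun w _ => ?_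
    have h2 := sum_fin_succ_eq (m := 2 * P.J 0) (f := fun r => f (P.L 0 * (r : ℕ)))
    have h3 : f (P.L 0 * (2 * P.J 0 : ℕ)) = f (P.L 0 * (0 : ℕ)) := by
      rw [(P.L_mul 0).2, Nat.cast_zero, mul_zero, hf]
      simp only [AddCircle.coe_period]
      rfl
    rw [h3] at h2
    have h4 := add_right_cancel h2
    simpa only [Nat.cast_add, Nat.cast_one, mul_add, mul_one, add_zero] using h4

/-- The cells of a bundle share both end points, and the derivatives there are proportional to a row
of the projection matrix, which sums to zero over the bundle. So both sides of the Kirchhoff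
condition vanish. -/
theorem isLaplacian_sineFun (i : ℕ) (α : P.Cell (i + 1)) (k : ℕ) :
    P.IsLaplacian (i + 1) (fun y => (P.sineFun i α k y : ℂ))
      (fun y => (((k + 1) * P.J (i + 1) : ℕ) : ℂ) ^ 2 * (P.sineFun i α k y : ℂ)) := by
  set ω : ℝ := (k + 1) * P.J (i + 1) with hω
  have hd1 : ∀ d : ℂ, deriv (fun θ : ℝ => d * (Real.sin (ω * θ) : ℂ)) =
      fun θ : ℝ => (d * ω) * (Real.cos (ω * θ) : ℂ) := by
    intro d
    funext θ
    have h1 : HasDerivAt (fun θ : ℝ => ω * θ) ω θ := by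
      simpa using (hasDerivAt_id θ).const_mul ω
    rw [(h1.sin.ofReal_comp.const_mul d).deriv]
    push_cast
    ring
  have hd2 : ∀ d : ℂ, deriv (fun θ : ℝ => d * (Real.cos (ω * θ) : ℂ)) =
      fun θ : ℝ => -(d * ω) * (Real.sin (ω * θ) : ℂ) := by
    intro d
    funext θ
    have h1 : HasDerivAt (fun θ : ℝ => ω * θ) ω θ := by
      simpa using (hasDerivAt_id θ).const_mul ω
    rw [(h1.cos.ofReal_comp.const_mul d).deriv]
    push_cast
    ring
  have hs : ∀ β, ∀ θ ∈ Icc 0 (P.L (i + 1)), (P.sineFun i α k (P.cellMap (i + 1) β θ) : ℂ) =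
      (P.amplitude (i + 1) * P.cellCoeff i α β : ℂ) * (Real.sin (ω * θ) : ℂ) := by
    intro β θ hθ
    rw [sineFun_cellMap i α β k hθ, ← hω, Complex.ofReal_mul, Complex.ofReal_mul]
    ring
  have hE : (((k + 1) * P.J (i + 1) : ℕ) : ℂ) = ω := by
    rw [hω]
    push_cast
    rfl
  refine isLaplacian_iff.2 ⟨fun β θ => (P.amplitude (i + 1) * P.cellCoeff i α β : ℂ) *
    (Real.sin (ω * θ) : ℂ), fun β => ?_, hs, fun β θ hθ => ?_, fun φ => ?_⟩
  · exact contDiff_const.mul (Complex.ofRealCLM.contDiff.comp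
      (Real.contDiff_sin.comp (contDiff_const.mul contDiff_id)))
  · simp only [hd1, hd2, hs β θ ⟨hθ.1.le, hθ.2.le⟩, hE]
    ring
  · simp only [hd1]
    have h1 : ∀ (d : ℂ) (x : P.Cell (i + 1) → P.F (i + 1)),
        (∀ β, P.Bundled (i + 1) β α → x β = x α) →
        ∑ β, φ (x β) * ((P.amplitude (i + 1) * P.cellCoeff i α β : ℂ) * ω * d) = 0 := by
      intro d x hx
      have h2 := sum_mul_cellCoeff_eq_zero α (X := fun β => φ (x β)) fun β hβ => by rw [hx β hβ]
      rw [← mul_zero (P.amplitude (i + 1) * ω * d), ← h2, Finset.mul_sum]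
      refine Finset.sum_congr rfl fun β _ => ?_
      rw [cellCoeff_comm]
      ring
    rw [h1 _ (fun β => P.cellMap (i + 1) β 0) fun β hβ => hβ.cellMap_zero,
      h1 _ (fun β => P.cellMap (i + 1) β (P.L (i + 1))) fun β hβ => hβ.cellMap_L]

theorem integral_frameFun_laplacian (n : P.Index) {i : ℕ} {g h : P.F i → ℂ}
    (H : P.IsLaplacian i g h) :
    ∫ x, P.frameFun n x * h (P.Phi i x) ∂P.muInf =
      (P.freq n : ℂ) ^ 2 * ∫ x, P.frameFun n x * g (P.Phi i x) ∂P.muInf := by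
  match n with
  | .inl m =>
    refine (green_muInf (isLaplacian_expFun m) H).trans ?_
    rw [← integral_const_mul]
    exact integral_congr_ae (ae_of_all _ fun x => mul_assoc _ _ _)
  | .inr ⟨l, α, k⟩ =>
    refine (green_muInf (isLaplacian_sineFun l α k) H).trans ?_
    rw [← integral_const_mul]
    exact integral_congr_ae (ae_of_all _ fun x => mul_assoc _ _ _)

/-- The frame is stable under conjugation with the same frequencies, so the conjugates in
`hasSum_multiplier` obey the same eigenvalue relation. -/
theorem exists_conj_frameFun (n : P.Index) :
    ∃ n', P.freq n' = P.freq n ∧ ∀ x, (starRingEnd ℂ) (P.frameFun n x) = P.frameFun n' x := by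
  match n with
  | .inl m =>
    refine ⟨.inl (-m), by simp [freq], fun x => ?_⟩
    simp only [frameFun, expFun, map_mul, Complex.conj_ofReal, fourier_neg]
  | .inr ⟨l, α, k⟩ => exact ⟨.inr ⟨l, α, k⟩, rfl, fun x => Complex.conj_ofReal _⟩

theorem integral_conj_frameFun_laplacian (n : P.Index) {i : ℕ} {g h : P.F i → ℂ}
    (H : P.IsLaplacian i g h) :
    ∫ x, (starRingEnd ℂ) (P.frameFun n x) * h (P.Phi i x) ∂P.muInf =
      (P.freq n : ℂ) ^ 2 *
        ∫ x, (starRingEnd ℂ) (P.frameFun n x) * g (P.Phi i x) ∂P.muInf := by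
  obtain ⟨n', h1, h2⟩ := exists_conj_frameFun n
  simp only [h2]
  rw [integral_frameFun_laplacian n' H, h1]

theorem exists_laplacian_frameFun (n : P.Index) : ∃ (i : ℕ) (g : P.F i → ℂ),
    P.IsLaplacian i g (fun y => (P.freq n : ℂ) ^ 2 * g y) ∧ ∀ x, g (P.Phi i x) = P.frameFun n x := by
  match n with
  | .inl m => exact ⟨0, _, isLaplacian_expFun m, fun _ => rfl⟩
  | .inr ⟨l, α, k⟩ => exact ⟨l + 1, _, isLaplacian_sineFun l α k, fun _ => rfl⟩

end Parameters
end DiamondFractal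
end

/-! ### Existence and uniqueness for the evolution equations -/

noncomputable section

namespace DiamondFractal

theorem continuous_integral_mul {Ω : Type*} [MeasurableSpace Ω] {μ : Measure Ω} {g : Ω → ℂ}
    (hg : MemLp g 2 μ) : Continuous fun f : Lp ℂ 2 μ => ∫ x, f x * g x ∂μ := by
  have hg' : MemLp (fun x => (starRingEnd ℂ) (g x)) 2 μ := hg.star
  have h : ∀ f : Lp ℂ 2 μ, ∫ x, f x * g x ∂μ = inner ℂ hg'.toLp f := by
    intro f
    rw [L2.inner_def]
    refine integral_congr_ae ?_
    filter_upwards [hg'.coeFn_toLp] with x hx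
    rw [hx, RCLike.inner_apply, starRingEnd_self_apply]
  simp only [h]
  exact continuous_const.inner continuous_id

/-- The product `exp (a s) y s` has zero derivative on the open half line; continuity at `0`, where
no derivative is assumed, identifies the constant. -/
theorem eq_exp_of_hasDerivAt {y : ℝ → ℂ} {a : ℂ} (hc : ContinuousOn y (Ici 0))
    (hd : ∀ t, 0 < t → HasDerivAt y (-a * y t) t) {t : ℝ} (ht : 0 ≤ t) :
    y t = Complex.exp (-a * t) * y 0 := by
  set w : ℝ → ℂ := fun s => Complex.exp (a * s) * y s with hw
  have hexp : ∀ s : ℝ, HasDerivAt (fun s : ℝ => Complex.exp (a * s)) (Complex.exp (a * s) * a) s := by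
    intro s
    have h1 : HasDerivAt (fun s : ℝ => a * (s : ℂ)) a s := by
      simpa using (hasDerivAt_id s).ofReal_comp.const_mul a
    exact h1.cexp
  have hwd : ∀ s, 0 < s → HasDerivAt w 0 s := by
    intro s hs
    convert! (hexp s).mul (hd s hs) using 1
    ring
  have hconst : ∀ s, 0 < s → ∀ s', 0 < s' → w s = w s' := fun s hs s' hs' =>
    isOpen_Ioi.is_const_of_deriv_eq_zero isPreconnected_Ioi
      (fun x hx => (hwd x hx).differentiableAt.differentiableWithinAt)
      (fun x hx => (hwd x hx).deriv) (mem_Ioi.2 hs) (mem_Ioi.2 hs')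
  have hw0 : ∀ s, 0 < s → w s = y 0 := by
    intro s hs
    have h1 : Tendsto w (𝓝[>] 0) (𝓝 (w 0)) := by
      have h2 : ContinuousWithinAt w (Ici 0) 0 :=
        (hexp 0).continuousAt.continuousWithinAt.mul (hc 0 (mem_Ici.2 le_rfl))
      exact h2.mono_left (nhdsWithin_mono _ Ioi_subset_Ici_self)
    have h3 : Tendsto w (𝓝[>] 0) (𝓝 (w s)) :=
      tendsto_const_nhds.congr' (eventually_nhdsWithin_of_forall fun s' hs' =>
        hconst s hs s' hs')
    rw [tendsto_nhds_unique h3 h1, hw]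
    simp
  rcases ht.eq_or_lt with h | h
  · simp [← h]
  · rw [← hw0 t h, hw, ← mul_assoc, ← Complex.exp_add]
    simp

namespace Parameters

variable {P : Parameters}

/-- The multiplier of the solution operator of `∂u/∂t = -c Δ u`. -/
def evolution (P : Parameters) (c : ℂ) (s : ℝ) (n : P.Index) : ℂ :=
  Complex.exp (-(c * (P.freq n : ℂ) ^ 2) * (max s 0 : ℝ))

theorem norm_exp_neg_mul_le {c : ℂ} (hc : 0 ≤ c.re) (k : ℕ) {s : ℝ} (hs : 0 ≤ s) :
    ‖Complex.exp (-(c * (k : ℂ) ^ 2) * s)‖ ≤ 1 := by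
  rw [Complex.norm_exp, Real.exp_le_one_iff]
  have h1 : (-(c * (k : ℂ) ^ 2) * s).re = -(c.re * k ^ 2 * s) := by
    have h2 : -(c * (k : ℂ) ^ 2) * s = c * ((-(k ^ 2 * s) : ℝ) : ℂ) := by push_cast; ring
    rw [h2, Complex.re_mul_ofReal]
    ring
  rw [h1]
  have : 0 ≤ c.re * k ^ 2 * s := by positivity
  linarith

/-- The clamp `max s 0` in `evolution` makes this bound, and hence the continuity of `solution`,
hold on the whole real line. -/
theorem norm_evolution_le {c : ℂ} (hc : 0 ≤ c.re) (s : ℝ) (n : P.Index) :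
    ‖P.evolution c s n‖ ≤ 1 := norm_exp_neg_mul_le hc _ (le_max_right _ _)

theorem continuous_evolution (c : ℂ) (n : P.Index) : Continuous fun s => P.evolution c s n := by
  unfold evolution
  fun_prop

theorem evolution_of_nonneg (c : ℂ) {s : ℝ} (hs : 0 ≤ s) (n : P.Index) :
    P.evolution c s n = Complex.exp (-(c * (P.freq n : ℂ) ^ 2) * s) := by
  rw [evolution, max_eq_left hs]

/-- The solution operator of `∂u/∂t = -c Δ u`. -/
def solution (P : Parameters) (c : ℂ) (f : P.L2) (s : ℝ) : P.L2 :=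
  P.parsevalFrame.multiplier (P.evolution c s) f

theorem continuous_solution {c : ℂ} (hc : 0 ≤ c.re) (f : P.L2) : Continuous (P.solution c f) :=
  continuous_iff_continuousAt.2 fun s => P.parsevalFrame.tendsto_multiplier
    (Eventually.of_forall fun s => norm_evolution_le hc s) (norm_evolution_le hc s)
    (fun n => (continuous_evolution c n).tendsto s) f

theorem isSolution_solution {c : ℂ} (hc : 0 ≤ c.re) (f : P.L2) :
    P.IsSolution c f (P.solution c f) := by
  refine ⟨(continuous_solution hc f).continuousOn,
    P.parsevalFrame.multiplier_one (fun n => by simp [evolution]) f, fun i g h H t ht => ?_⟩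
  obtain ⟨hg, hh⟩ := H.memLp
  set fc : P.Index → ℂ := fun n => ∫ x, P.frameFun n x * f x ∂P.muInf with hfc
  set gc : P.Index → ℂ := fun n => ∫ x, (starRingEnd ℂ) (P.frameFun n x) * g (P.Phi i x) ∂P.muInf
    with hgc
  set hhc : P.Index → ℂ := fun n =>
    ∫ x, (starRingEnd ℂ) (P.frameFun n x) * h (P.Phi i x) ∂P.muInf with hhhc
  have hhg : ∀ n, hhc n = (P.freq n : ℂ) ^ 2 * gc n := fun n =>
    integral_conj_frameFun_laplacian n H
  have hsum1 := fun s => P.parsevalFrame.hasSum_multiplier (norm_evolution_le hc s) f hg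
  have hsum2 := fun s => P.parsevalFrame.hasSum_multiplier (norm_evolution_le hc s) f hh
  -- The eigenvalue is absorbed into the test function, by `hhg`. The differentiated series is thus
  -- dominated uniformly in time by the products of two square summable sequences, even when `c = i`
  -- and there is no decay.
  have hsummable : Summable fun n => ‖c‖ * ‖fc n * hhc n‖ := by
    have h1 := (P.parsevalFrame.hasSum_multiplier (a := fun _ => 1) (C := 1)
      (fun _ => by simp) f hh).summable
    simp only [one_mul] at h1
    exact h1.norm.mul_left _
  have key := hasDerivAt_tsum_of_isPreconnected (𝕜 := ℝ) (t := Ioi (0 : ℝ)) (y₀ := t) (y := t)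
    (g := fun n (s : ℝ) => Complex.exp (-(c * (P.freq n : ℂ) ^ 2) * s) * fc n * gc n)
    (g' := fun n (s : ℝ) => -c * (Complex.exp (-(c * (P.freq n : ℂ) ^ 2) * s) * fc n * hhc n))
    hsummable isOpen_Ioi isPreconnected_Ioi (fun n s _ => ?_) (fun n s hs => ?_) (mem_Ioi.2 ht)
    ?_ (mem_Ioi.2 ht)
  · have h2 : ∑' n, -c * (Complex.exp (-(c * (P.freq n : ℂ) ^ 2) * t) * fc n * hhc n) =
        -c * ∫ x, P.solution c f t x * h (P.Phi i x) ∂P.muInf := by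
      have h3 := (hsum2 t).tsum_eq
      simp only [evolution_of_nonneg c ht.le] at h3
      rw [tsum_mul_left, h3]
      rfl
    rw [h2] at key
    refine key.congr_of_eventuallyEq ?_
    filter_upwards [Ioi_mem_nhds ht] with s hs
    have h3 := (hsum1 s).tsum_eq
    simp only [evolution_of_nonneg c (le_of_lt hs)] at h3
    exact h3.symm
  · have h1 : HasDerivAt (fun s : ℝ => -(c * (P.freq n : ℂ) ^ 2) * (s : ℂ))
        (-(c * (P.freq n : ℂ) ^ 2)) s := by
      simpa using (hasDerivAt_id s).ofReal_comp.const_mul (-(c * (P.freq n : ℂ) ^ 2))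
    convert! (h1.cexp.mul_const (fc n)).mul_const (gc n) using 1
    rw [hhg]
    ring
  · have h1 := norm_exp_neg_mul_le hc (P.freq n) (le_of_lt hs)
    rw [norm_mul, norm_neg, mul_assoc, norm_mul]
    exact mul_le_mul_of_nonneg_left (mul_le_of_le_one_left (norm_nonneg _) h1) (norm_nonneg _)
  · have h3 := (hsum1 t).summable
    simpa only [evolution_of_nonneg c ht.le] using h3

/-- Testing with a frame function gives a scalar linear equation for each coefficient, and the
coefficients determine an element of `L²`. -/
theorem IsSolution.eq_solution {c : ℂ} (hc : 0 ≤ c.re) {f : P.L2} {v : ℝ → P.L2}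
    (hv : P.IsSolution c f v) {t : ℝ} (ht : 0 ≤ t) : v t = P.solution c f t := by
  obtain ⟨h1, h2, h3⟩ := hv
  refine P.parsevalFrame.eq_multiplier (norm_evolution_le hc t) fun n => ?_
  obtain ⟨i, g, hg, hgn⟩ := exists_laplacian_frameFun n
  have h4 := h3 i g _ hg
  simp only [hgn] at h4
  have h5 := eq_exp_of_hasDerivAt (y := fun s => ∫ x, v s x * P.frameFun n x ∂P.muInf)
    (a := c * (P.freq n : ℂ) ^ 2)
    ((continuous_integral_mul (P.parsevalFrame.memLp n)).comp_continuousOn h1) (fun s hs => ?_) ht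
  · rw [evolution_of_nonneg c ht]
    simp only [mul_comm (P.frameFun n _)]
    rw [← h2]
    exact h5
  · convert! h4 s hs using 1
    simp only [mul_left_comm _ ((P.freq n : ℂ) ^ 2)]
    rw [integral_const_mul]
    ring

theorem isUniqueSolution_solution {c : ℂ} (hc : 0 ≤ c.re) (f : P.L2) :
    P.IsUniqueSolution c f (P.solution c f) :=
  ⟨isSolution_solution hc f, fun _ hv _ ht => hv.eq_solution hc ht⟩

end Parameters
end DiamondFractal
end

/-! ### The heat kernel as a sum over the stages -/

noncomputable section

namespace DiamondFractal

theorem fourier_add_fourier_neg (k : ℕ) (x : Circ) :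
    (fourier (k + 1) x : ℂ) + fourier (-(k + 1)) x =
      2 * (Real.Angle.cos ((k + 1) • (show Real.Angle from x)) : ℝ) := by
  induction x using QuotientAddGroup.induction_on with
  | H t =>
    have h1 : (k + 1) • (show Real.Angle from ((t : ℝ) : Circ)) =
        (((k + 1 : ℕ) * t : ℝ) : Real.Angle) := by
      rw [Real.Angle.natCast_mul_eq_nsmul]
      rfl
    rw [h1, Real.Angle.cos_coe, fourier_neg, Complex.add_conj]
    have h2 : (fourier (k + 1) ((t : ℝ) : Circ) : ℂ) =
        Complex.exp (((k + 1 : ℕ) * t : ℝ) * Complex.I) := by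
      rw [fourier_coe_apply]
      congr 1
      have : (Real.pi : ℂ) ≠ 0 := by exact_mod_cast Real.pi_ne_zero
      push_cast
      field_simp
    change ((2 * (fourier (k + 1) ((t : ℝ) : Circ) : ℂ).re : ℝ) : ℂ) = _
    rw [h2, Complex.exp_ofReal_mul_I_re]
    push_cast
    rfl

/-- A sequence which decays quadratically. -/
def QuadDecay (c : ℕ → ℂ) : Prop := ∃ C, ∀ k, ‖c k‖ ≤ C / (1 + (k : ℝ) ^ 2)

theorem QuadDecay.exists_pos {c : ℕ → ℂ} (h : QuadDecay c) :
    ∃ C, 0 ≤ C ∧ ∀ k, ‖c k‖ ≤ C / (1 + (k : ℝ) ^ 2) := by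
  obtain ⟨C, hC⟩ := h
  refine ⟨C, ?_, hC⟩
  have := (norm_nonneg _).trans (hC 0)
  simpa using this

theorem summable_inv_sq_mul {J : ℕ} (hJ : 0 < J) :
    Summable fun k : ℕ => 1 / (1 + ((k * J : ℕ) : ℝ) ^ 2) := by
  refine (summable_nat_add_iff 1).1 ?_
  have h1 : Summable fun k : ℕ => 1 / (((k + 1 : ℕ) : ℝ)) ^ 2 :=
    (summable_nat_add_iff (f := fun k : ℕ => 1 / (k : ℝ) ^ 2) 1).2 (Real.summable_one_div_nat_pow.2 one_lt_two)
  refine Summable.of_nonneg_of_le (fun k => by positivity) (fun k => ?_) h1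
  have h2 : (1 : ℝ) ≤ J := by exact_mod_cast hJ
  refine one_div_le_one_div_of_le (by positivity) ?_
  push_cast
  nlinarith [mul_le_mul_of_nonneg_left h2 (show (0 : ℝ) ≤ k + 1 by positivity),
    sq_nonneg (((k : ℝ) + 1) * J - (k + 1))]

theorem QuadDecay.summable_mul {c : ℕ → ℂ} (h : QuadDecay c) {J : ℕ} (hJ : 0 < J) :
    Summable fun k : ℕ => ‖c (k * J)‖ := by
  obtain ⟨C, -, hC⟩ := h.exists_pos
  refine Summable.of_nonneg_of_le (fun k => norm_nonneg _) (fun k => hC _) ?_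
  simpa only [div_eq_mul_one_div C] using (summable_inv_sq_mul hJ).mul_left C

/-- The sequence `exp (-k² z)`. -/
def heatSeq (z : ℂ) (k : ℕ) : ℂ := Complex.exp (-(k : ℂ) ^ 2 * z)

theorem norm_heatSeq (z : ℂ) (k : ℕ) : ‖heatSeq z k‖ = Real.exp (-((k : ℝ) ^ 2 * z.re)) := by
  rw [heatSeq, Complex.norm_exp]
  congr 1
  have h2 : -(k : ℂ) ^ 2 * z = z * ((-(k ^ 2) : ℝ) : ℂ) := by push_cast; ring
  rw [h2, Complex.re_mul_ofReal]
  ring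

/-- With `r = Re z`, the constant comes from `1 + k² ≤ (1 + k² r)(1 + 1/r)` and `1 + s ≤ exp s`. -/
theorem quadDecay_heatSeq {z : ℂ} (hz : 0 < z.re) : QuadDecay (heatSeq z) := by
  refine ⟨1 + 1 / z.re, fun k => ?_⟩
  rw [norm_heatSeq, le_div_iff₀ (by positivity), Real.exp_neg, inv_mul_le_iff₀ (Real.exp_pos _)]
  have h1 := Real.add_one_le_exp ((k : ℝ) ^ 2 * z.re)
  have h2 : 1 + (k : ℝ) ^ 2 ≤ ((k : ℝ) ^ 2 * z.re + 1) * (1 + 1 / z.re) := by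
    have : ((k : ℝ) ^ 2 * z.re + 1) * (1 + 1 / z.re) =
        1 + (k : ℝ) ^ 2 + ((k : ℝ) ^ 2 * z.re + 1 / z.re) := by field_simp; ring
    rw [this]
    have : 0 ≤ (k : ℝ) ^ 2 * z.re + 1 / z.re := by positivity
    linarith
  exact h2.trans (mul_le_mul_of_nonneg_right h1 (by positivity))

namespace Parameters

variable {P : Parameters}

/-- Since `J_i ≥ 2^i`, the double sequence is dominated by a product of `2^{-i}` and `(k + 1)^{-2}`.
-/
theorem summableAlong_of_quadDecay {c : ℕ → ℂ} (h : QuadDecay c) : P.SummableAlong c := by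
  refine ⟨by simpa using h.summable_mul (J := 1) one_pos, ?_⟩
  obtain ⟨C, hC0, hC⟩ := h.exists_pos
  have h1 : Summable fun k : ℕ => 1 / (((k + 1 : ℕ) : ℝ)) ^ 2 :=
    (summable_nat_add_iff (f := fun k : ℕ => 1 / (k : ℝ) ^ 2) 1).2 (Real.summable_one_div_nat_pow.2 one_lt_two)
  have h2 : Summable fun p : ℕ × ℕ => (1 / 2 : ℝ) ^ p.1 * (1 / (((p.2 + 1 : ℕ) : ℝ)) ^ 2) :=
    summable_mul_of_summable_norm (f := fun i : ℕ => (1 / 2 : ℝ) ^ i)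
      (g := fun k : ℕ => 1 / (((k + 1 : ℕ) : ℝ)) ^ 2) summable_geometric_two.norm h1.norm
  have h8 : ∀ p : ℕ × ℕ, ‖c ((p.2 + 1) * P.J (p.1 + 1))‖ ≤
      C * ((1 / 2 : ℝ) ^ p.1 * (1 / (((p.2 + 1 : ℕ) : ℝ)) ^ 2)) := by
    intro p
    have h3 : (2 : ℝ) ^ p.1 ≤ P.J (p.1 + 1) := by
      have h5 : 2 ^ p.1 ≤ P.J (p.1 + 1) :=
        le_trans (Nat.pow_le_pow_right two_pos (Nat.le_succ p.1)) (P.two_pow_le_J (p.1 + 1))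
      exact_mod_cast h5
    have h4 : (1 : ℝ) ≤ P.J (p.1 + 1) := by exact_mod_cast P.J_pos (p.1 + 1)
    have h6 : (2 : ℝ) ^ p.1 ≤ (P.J (p.1 + 1) : ℝ) ^ 2 := h3.trans (le_self_pow₀ h4 two_ne_zero)
    have h7 : (2 : ℝ) ^ p.1 * ((p.2 + 1 : ℕ) : ℝ) ^ 2 ≤
        1 + (((p.2 + 1) * P.J (p.1 + 1) : ℕ) : ℝ) ^ 2 := by
      have := mul_le_mul_of_nonneg_right h6 (sq_nonneg ((p.2 + 1 : ℕ) : ℝ))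
      rw [Nat.cast_mul, mul_pow, mul_comm (((p.2 + 1 : ℕ) : ℝ) ^ 2)]
      linarith
    have h9 : (0 : ℝ) < (2 : ℝ) ^ p.1 * ((p.2 + 1 : ℕ) : ℝ) ^ 2 := by positivity
    calc _ ≤ C / (1 + (((p.2 + 1) * P.J (p.1 + 1) : ℕ) : ℝ) ^ 2) := hC _
      _ ≤ C / ((2 : ℝ) ^ p.1 * ((p.2 + 1 : ℕ) : ℝ) ^ 2) := div_le_div_of_nonneg_left hC0 h9 h7
      _ = _ := by rw [div_eq_mul_one_div, one_div_pow, one_div_mul_one_div]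
  exact Summable.of_nonneg_of_le (fun _ => norm_nonneg _) h8 (h2.mul_left C)

/-- The coefficients of the cosine or sine series which is added to the kernel at stage `l`. -/
def levelCoeff (P : Parameters) : (l k : ℕ) → P.F l → P.F l → ℝ
  | 0, 0, _, _ => 1 / (2 * Real.pi)
  | 0, k + 1, x, y =>
    1 / Real.pi * Real.Angle.cos ((k + 1) • (show Real.Angle from P.angle 0 y - P.angle 0 x))
  | _ + 1, 0, _, _ => 0
  | i + 1, k + 1, x, y => ∑ α, P.sineFun i α k x * P.sineFun i α k y

/-- The term of stage `l` of the kernel of a function of the Laplacian. -/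
def levelKernel (P : Parameters) (c : ℕ → ℂ) (l : ℕ) (x y : P.F l) : ℂ :=
  ∑' k : ℕ, c (k * P.J l) * P.levelCoeff l k x y

theorem levelCoeff_cellMap (i k : ℕ) (α β : P.Cell (i + 1)) {θ θ' : ℝ}
    (hθ : θ ∈ Icc 0 (P.L (i + 1))) (hθ' : θ' ∈ Icc 0 (P.L (i + 1))) :
    P.levelCoeff (i + 1) k (P.cellMap (i + 1) α θ) (P.cellMap (i + 1) β θ') =
      P.amplitude (i + 1) ^ 2 * P.cellCoeff i α β *
        (Real.sin (k * P.J (i + 1) * θ) * Real.sin (k * P.J (i + 1) * θ')) := by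
  cases k with
  | zero => simp [levelCoeff]
  | succ k =>
    have h := sum_cellCoeff_mul_cellCoeff α β
    rw [levelCoeff]
    simp only [sineFun_cellMap i _ _ k hθ, sineFun_cellMap i _ _ k hθ']
    have h' : ∑ γ, P.cellCoeff i γ α * P.cellCoeff i γ β = P.cellCoeff i α β := by
      exact_mod_cast h
    rw [← h', Finset.mul_sum, Finset.sum_mul]
    refine Finset.sum_congr rfl fun γ _ => ?_
    push_cast
    ring

theorem amplitude_sq_eq (i : ℕ) : P.amplitude i ^ 2 = 2 * P.N i * P.J i / Real.pi := by
  rw [amplitude_sq, L, div_div_eq_mul_div]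

theorem abs_levelCoeff_le (l k : ℕ) (x y : P.F l) :
    |P.levelCoeff l k x y| ≤ P.amplitude l ^ 2 := by
  match l, k with
  | 0, 0 =>
    rw [amplitude_sq_eq, N_zero, J_zero, levelCoeff, abs_of_nonneg (by positivity), Nat.cast_one]
    rw [div_le_div_iff₀ (by positivity) (by positivity)]
    nlinarith [Real.pi_pos]
  | 0, k + 1 =>
    rw [amplitude_sq_eq, N_zero, J_zero, levelCoeff, abs_mul, abs_of_nonneg (by positivity),
      Nat.cast_one]
    have h1 : |Real.Angle.cos ((k + 1) • (show Real.Angle from P.angle 0 y - P.angle 0 x))| ≤ 1 := by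
      generalize ((k + 1) • (show Real.Angle from P.angle 0 y - P.angle 0 x)) = a
      induction a using Real.Angle.induction_on
      exact Real.abs_cos_le_one _
    have h2 : 0 < 1 / Real.pi := by positivity
    calc _ ≤ 1 / Real.pi * 1 := by gcongr
      _ ≤ 1 / Real.pi * 2 := by gcongr; norm_num
      _ = _ := by ring
  | i + 1, k =>
    obtain ⟨α, θ, hθ, rfl⟩ := exists_cellMap x
    obtain ⟨β, θ', hθ', rfl⟩ := exists_cellMap y
    rw [levelCoeff_cellMap i k α β ⟨hθ.1, hθ.2.le⟩ ⟨hθ'.1, hθ'.2.le⟩, abs_mul, abs_mul, abs_mul,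
      abs_of_nonneg (sq_nonneg _)]
    have h1 := abs_cellCoeff_le i α β
    have h2 := Real.abs_sin_le_one (k * P.J (i + 1) * θ)
    have h3 := Real.abs_sin_le_one (k * P.J (i + 1) * θ')
    calc _ ≤ P.amplitude (i + 1) ^ 2 * 1 * (1 * 1) := by gcongr
      _ = _ := by ring

theorem measurable_levelCoeff (l k : ℕ) (x : P.F l) : Measurable fun y => P.levelCoeff l k x y := by
  match l, k with
  | 0, 0 => exact measurable_const
  | 0, k + 1 =>
    refine measurable_const.mul ?_
    have h1 : Measurable fun y : P.F 0 => (fourier (k + 1) (P.angle 0 y - P.angle 0 x) : ℂ) :=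
      (fourier (k + 1)).continuous.measurable.comp ((measurable_angle 0).sub_const _)
    have h2 : Measurable fun y : P.F 0 => (fourier (-(k + 1)) (P.angle 0 y - P.angle 0 x) : ℂ) :=
      (fourier (-(k + 1))).continuous.measurable.comp ((measurable_angle 0).sub_const _)
    have h3 := Complex.measurable_re.comp ((h1.add h2).const_mul (1 / 2 : ℂ))
    convert! h3 using 2 with y
    simp only [Function.comp, Pi.add_apply]
    rw [fourier_add_fourier_neg, ← mul_assoc, one_div, inv_mul_cancel₀ two_ne_zero, one_mul,
      Complex.ofReal_re]
  | i + 1, 0 => exact measurable_const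
  | i + 1, k + 1 =>
    exact Finset.measurable_sum _ fun α _ => (measurable_sineFun i α k).const_mul _

theorem measurable_levelKernel (c : ℕ → ℂ) (l : ℕ) (x : P.F l) :
    Measurable fun y => P.levelKernel c l x y :=
  Measurable.tsum fun k => (Complex.measurable_ofReal.comp (measurable_levelCoeff l k x)).const_mul _

theorem norm_levelTerm_le (c : ℕ → ℂ) (l k : ℕ) (x y : P.F l) :
    ‖c (k * P.J l) * P.levelCoeff l k x y‖ ≤ P.amplitude l ^ 2 * ‖c (k * P.J l)‖ := by
  rw [norm_mul, Complex.norm_real, Real.norm_eq_abs, mul_comm]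
  exact mul_le_mul_of_nonneg_right (abs_levelCoeff_le l k x y) (norm_nonneg _)

theorem summable_levelTerm {c : ℕ → ℂ} (hc : QuadDecay c) (l : ℕ) (x y : P.F l) :
    Summable fun k => c (k * P.J l) * P.levelCoeff l k x y :=
  Summable.of_norm_bounded ((hc.summable_mul (P.J_pos l)).mul_left _)
    fun k => norm_levelTerm_le c l k x y

theorem levelKernel_zero_heatSeq {z : ℂ} (hz : 0 < z.re) (x y : P.F 0) :
    P.levelKernel (heatSeq z) 0 x y = circleKernel z x y := by
  rw [levelKernel, (summable_levelTerm (quadDecay_heatSeq hz) 0 x y).tsum_eq_zero_add]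
  unfold circleKernel
  rw [← tsum_mul_left]
  congr 1
  · simp [levelCoeff, heatSeq]
  · refine tsum_congr fun k => ?_
    simp only [levelCoeff, heatSeq, J_zero, mul_one]
    push_cast
    rw [← mul_assoc, mul_comm _ (1 / (Real.pi : ℂ)), mul_assoc]
    rfl

theorem circleKernel_coe (z : ℂ) (a b : ℝ) : circleKernel z (a : Circ) (b : Circ) =
    1 / (2 * Real.pi) + 1 / Real.pi * ∑' k : ℕ, heatSeq z (k + 1) *
      (Real.cos ((k + 1) * (b - a)) : ℝ) := by
  rw [circleKernel]
  congr 2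
  refine tsum_congr fun k => ?_
  have h1 : (k + 1) • (show Real.Angle from ((b : ℝ) : Circ) - ((a : ℝ) : Circ)) =
      (((k + 1 : ℕ) * (b - a) : ℝ) : Real.Angle) := by
    rw [Real.Angle.natCast_mul_eq_nsmul]
    rfl
  rw [h1, Real.Angle.cos_coe, heatSeq]
  push_cast
  rfl

/-- The method of images: subtracting the reflected circle kernel is `cos (a - b) - cos (a + b) = 2
sin a sin b` term by term, which leaves the Dirichlet series of an arc of length `L_i`. -/
theorem cellKernel_eq {z : ℂ} (hz : 0 < z.re) (i : ℕ) (θ θ' : ℝ) :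
    P.cellKernel i z θ θ' = 2 * P.J i / Real.pi * ∑' k : ℕ, heatSeq z (k * P.J i) *
      (Real.sin (k * P.J i * θ) * Real.sin (k * P.J i * θ') : ℝ) := by
  have hq := quadDecay_heatSeq hz
  have hJ := P.J_pos i
  have hsum : ∀ s : ℕ → ℝ, (∀ k, |s k| ≤ 1) →
      Summable fun k : ℕ => heatSeq z (k * P.J i) * (s k : ℂ) := fun s hs =>
    Summable.of_norm_bounded (hq.summable_mul hJ) fun k => by
      rw [norm_mul, Complex.norm_real]
      exact mul_le_of_le_one_right (norm_nonneg _) (hs k)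
  have hb : ∀ k : ℕ, heatSeq ((P.J i : ℂ) ^ 2 * z) k = heatSeq z (k * P.J i) := by
    intro k
    rw [heatSeq, heatSeq]
    push_cast
    ring_nf
  have h1 := (summable_nat_add_iff 1).2 (hsum (fun k => Real.cos (k * (P.J i * θ' - P.J i * θ)))
    fun k => Real.abs_cos_le_one _)
  have h2 := (summable_nat_add_iff 1).2 (hsum (fun k => Real.cos (k * (-(P.J i * θ') - P.J i * θ)))
    fun k => Real.abs_cos_le_one _)
  have h3 := hsum (fun k => Real.sin (k * P.J i * θ) * Real.sin (k * P.J i * θ')) fun k => by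
    rw [abs_mul]
    exact mul_le_one₀ (Real.abs_sin_le_one _) (abs_nonneg _) (Real.abs_sin_le_one _)
  rw [cellKernel, circleKernel_coe, circleKernel_coe, h3.tsum_eq_zero_add]
  simp only [hb]
  push_cast at h1 h2 ⊢
  rw [add_sub_add_left_eq_sub, ← mul_sub, ← h1.tsum_sub h2]
  simp only [zero_mul, Complex.sin_zero, mul_zero, zero_add]
  rw [mul_div_assoc, mul_comm (2 : ℂ), mul_assoc, ← tsum_mul_left, ← tsum_mul_left,
    ← tsum_mul_left, ← tsum_mul_left]
  refine tsum_congr fun k => ?_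
  have h4 : Complex.cos (((k : ℂ) + 1) * (P.J i * θ' - P.J i * θ)) -
      Complex.cos (((k : ℂ) + 1) * (-(P.J i * θ') - P.J i * θ)) =
      2 * (Complex.sin (((k : ℂ) + 1) * P.J i * θ) * Complex.sin (((k : ℂ) + 1) * P.J i * θ')) := by
    rw [← Complex.cos_neg (((k : ℂ) + 1) * (-(P.J i * θ') - P.J i * θ))]
    have e1 : ((k : ℂ) + 1) * (P.J i * θ' - P.J i * θ) =
      ((k : ℂ) + 1) * P.J i * θ' - ((k : ℂ) + 1) * P.J i * θ := by ring
    have e2 : -(((k : ℂ) + 1) * (-(P.J i * θ') - P.J i * θ)) =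
      ((k : ℂ) + 1) * P.J i * θ' + ((k : ℂ) + 1) * P.J i * θ := by ring
    rw [e1, e2, Complex.cos_sub, Complex.cos_add]
    ring
  rw [← mul_sub, h4]
  ring

theorem levelKernel_succ_heatSeq {z : ℂ} (hz : 0 < z.re) (i : ℕ) (α β : P.Cell (i + 1)) {θ θ' : ℝ}
    (hθ : θ ∈ Icc 0 (P.L (i + 1))) (hθ' : θ' ∈ Icc 0 (P.L (i + 1))) :
    P.levelKernel (heatSeq z) (i + 1) (P.cellMap (i + 1) α θ) (P.cellMap (i + 1) β θ') =
      P.N (i + 1) * P.cellCoeff i α β * P.cellKernel (i + 1) z θ θ' := by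
  rw [cellKernel_eq hz, levelKernel, ← tsum_mul_left, ← tsum_mul_left]
  refine tsum_congr fun k => ?_
  rw [levelCoeff_cellMap i k α β hθ hθ', amplitude_sq_eq]
  push_cast
  ring

/-- The coefficients of the recursion are `N_{i+1}` times the entries of the projection matrix: `N_i
(n - 1) = N_{i+1} (1 - 1/n)` in the same cell, and `-N_i = -N_{i+1} / n` in the same bundle. -/
theorem p_succ {z : ℂ} (hz : 0 < z.re) (i : ℕ) (x y : P.F (i + 1)) :
    P.p (i + 1) z x y = P.p i z (P.proj i x) (P.proj i y) +
      P.levelKernel (heatSeq z) (i + 1) x y := by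
  obtain ⟨α, θ, hθ, rfl⟩ := exists_cellMap x
  obtain ⟨β, θ', hθ', rfl⟩ := exists_cellMap y
  rw [levelKernel_succ_heatSeq hz i α β ⟨hθ.1, hθ.2.le⟩ ⟨hθ'.1, hθ'.2.le⟩, p,
    offset_cellMap α hθ, offset_cellMap β hθ']
  congr 1
  -- At a vertex the chosen cell does not decide which branch of the recursion applies, but there
  -- the Dirichlet kernel is zero.
  rcases hθ.1.eq_or_lt with h | h
  · have : P.cellKernel (i + 1) z θ θ' = 0 := by
      rw [cellKernel_eq hz]
      simp [← h]
    simp [this]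
  rcases hθ'.1.eq_or_lt with h' | h'
  · have : P.cellKernel (i + 1) z θ θ' = 0 := by
      rw [cellKernel_eq hz]
      simp [← h']
    simp [this]
  have hn : (P.n (i + 1) : ℂ) ≠ 0 := by exact_mod_cast (P.n_pos i).ne'
  rw [sameCell_cellMap ⟨h, hθ.2⟩ ⟨h', hθ'.2⟩, sameBundle_cellMap ⟨h, hθ.2⟩ ⟨h', hθ'.2⟩, cellCoeff,
    N_succ]
  by_cases h1 : α = β
  · rw [if_pos h1, if_pos h1, if_pos (h1 ▸ bundled_refl α)]
    push_cast
    field_simp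
  · rw [if_neg h1, if_neg h1]
    by_cases h2 : P.Bundled (i + 1) α β
    · rw [if_pos h2, if_pos h2]
      push_cast
      field_simp
      ring
    · rw [if_neg h2, if_neg h2]
      simp

theorem p_Phi {z : ℂ} (hz : 0 < z.re) (i : ℕ) (x y : P.FInf) :
    P.p i z (P.Phi i x) (P.Phi i y) =
      ∑ l ∈ Finset.range (i + 1), P.levelKernel (heatSeq z) l (P.Phi l x) (P.Phi l y) := by
  induction i with
  | zero =>
    rw [zero_add, Finset.sum_range_one]
    exact (levelKernel_zero_heatSeq hz _ _).symm
  | succ i ih =>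
    rw [Finset.sum_range_succ, ← ih, p_succ hz]
    congr 2
    · exact x.2 i
    · exact y.2 i

end Parameters
end DiamondFractal
end

/-! ### Localization of the kernels off the diagonal -/

noncomputable section

namespace DiamondFractal
namespace Parameters

variable {P : Parameters}

/-! ### The number `i_*` -/

theorem Phi_eq_point {m i : ℕ} (hmi : m ≤ i) {x : P.FInf} {η : Circ} {w : P.Word i}
    (h : P.Phi i x = P.point i η w) :
    P.Phi m x = P.point m η fun l => w ⟨l, l.2.trans_le hmi⟩ := by
  induction i, hmi using Nat.le_induction with
  | base => exact h
  | succ i hmi ih =>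
    have h1 : P.Phi i x = P.point i η fun l => w l.castSucc := by
      rw [← proj_point, ← h]
      exact (x.2 i).symm
    exact ih h1

theorem angle_Phi (i : ℕ) (x : P.FInf) : P.angle i (P.Phi i x) = P.angle 0 (P.Phi 0 x) := by
  induction i with
  | zero => rfl
  | succ i ih =>
    rw [← ih, ← angle_proj]
    exact congr_arg _ (x.2 i)

theorem norm_angle_sub_le {x y : P.FInf} {i : ℕ} (h : P.SameBundle i (P.Phi i x) (P.Phi i y)) :
    ‖P.angle 0 (P.Phi 0 x) - P.angle 0 (P.Phi 0 y)‖ ≤ P.L i := by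
  obtain ⟨α, β, hαβ, ⟨θ, hθ, hx⟩, ⟨θ', hθ', hy⟩⟩ := h
  rw [← angle_Phi i x, ← angle_Phi i y, ← hx, ← hy, cellMap_eq, cellMap_eq, angle_point,
    angle_point, hαβ.1]
  have h1 : ((P.L i * (β.1 : ℕ) + θ : ℝ) : Circ) - ((P.L i * (β.1 : ℕ) + θ' : ℝ) : Circ) =
      ((θ - θ' : ℝ) : Circ) := by
    rw [← AddCircle.coe_sub]
    congr 1
    ring
  rw [h1]
  refine (QuotientAddGroup.norm_mk_le_norm).trans ?_
  rw [Real.norm_eq_abs, abs_le]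
  constructor <;> linarith [hθ.1, hθ.2, hθ'.1, hθ'.2]

theorem tendsto_L : Tendsto P.L atTop (𝓝 0) := by
  have h1 : Tendsto (fun i : ℕ => Real.pi * (1 / 2 : ℝ) ^ i) atTop (𝓝 (Real.pi * 0)) :=
    (tendsto_pow_atTop_nhds_zero_of_lt_one (by norm_num) (by norm_num)).const_mul _
  rw [mul_zero] at h1
  refine squeeze_zero (fun i => (P.L_pos i).le) (fun i => ?_) h1
  rw [L, div_eq_mul_one_div, one_div_pow]
  refine mul_le_mul_of_nonneg_left (one_div_le_one_div_of_le (by positivity) ?_) Real.pi_pos.le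
  exact_mod_cast P.two_pow_le_J i

theorem bddAbove_bundleLevels {x y : P.FInf} (hxy : x ≠ y) : BddAbove (P.bundleLevels x y) := by
  by_contra hb
  rw [not_bddAbove_iff] at hb
  refine hxy (Subtype.ext (funext fun m => ?_))
  have hangle : P.angle 0 (P.Phi 0 x) = P.angle 0 (P.Phi 0 y) := by
    rw [← sub_eq_zero, ← norm_le_zero_iff]
    refine ge_of_tendsto_of_frequently (f := P.L) tendsto_L ?_
    refine frequently_atTop.2 fun i => ?_
    obtain ⟨k, hk, hik⟩ := hb i
    exact ⟨k, hik.le, norm_angle_sub_le hk.2⟩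
  -- The inequality `m < i` has to be strict, because a bundle leaves its last letter free.
  obtain ⟨i, hi, hmi⟩ := hb m
  obtain ⟨α, β, hαβ, ⟨θ, hθ, hx⟩, ⟨θ', hθ', hy⟩⟩ := hi.2
  have h1 := Phi_eq_point hmi.le hx.symm
  have h2 := Phi_eq_point hmi.le hy.symm
  have h3 := angle_Phi m x
  have h4 := angle_Phi m y
  rw [h1, angle_point] at h3
  rw [h2, angle_point] at h4
  change P.Phi m x = P.Phi m y
  rw [h1, h2, h3, h4, hangle]
  congr 1
  funext l
  exact hαβ.2 _ (lt_of_le_of_lt (Nat.succ_le_of_lt l.2) hmi)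

theorem not_sameBundle {x y : P.FInf} (hxy : x ≠ y) {i : ℕ} (hi : P.iStar x y ≤ i) :
    ¬ P.SameBundle (i + 1) (P.Phi (i + 1) x) (P.Phi (i + 1) y) := by
  intro h
  have := le_csSup (bddAbove_bundleLevels hxy) (show i + 1 ∈ P.bundleLevels x y from
    ⟨Nat.le_add_left 1 i, h⟩)
  exact absurd (this.trans hi) (by omega)

/-- A frame function of this stage vanishes outside one bundle. This is the reason why the kernels
stop at `i_*`. -/
theorem sineFun_mul_eq_zero {i : ℕ} {x y : P.F (i + 1)} (h : ¬ P.SameBundle (i + 1) x y)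
    (α : P.Cell (i + 1)) (k : ℕ) : P.sineFun i α k x * P.sineFun i α k y = 0 := by
  obtain ⟨β, θ, hθ, rfl⟩ := exists_cellMap x
  obtain ⟨γ, θ', hθ', rfl⟩ := exists_cellMap y
  have hc : ∀ δ, ¬ P.Bundled (i + 1) α δ → P.cellCoeff i α δ = 0 := by
    intro δ hδ
    have : α ≠ δ := fun h => hδ (h ▸ bundled_refl α)
    simp [cellCoeff, this, hδ]
  rw [sineFun_cellMap i α β k ⟨hθ.1, hθ.2.le⟩, sineFun_cellMap i α γ k ⟨hθ'.1, hθ'.2.le⟩]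
  by_cases h1 : P.Bundled (i + 1) α β
  · by_cases h2 : P.Bundled (i + 1) α γ
    · exact absurd ⟨β, γ, h1.symm.trans h2, ⟨θ, ⟨hθ.1, hθ.2.le⟩, rfl⟩, ⟨θ', ⟨hθ'.1, hθ'.2.le⟩, rfl⟩⟩ h
    · simp [hc γ h2]
  · simp [hc β h1]

theorem levelCoeff_eq_zero {i : ℕ} {x y : P.F (i + 1)} (h : ¬ P.SameBundle (i + 1) x y) (k : ℕ) :
    P.levelCoeff (i + 1) k x y = 0 := by
  cases k with
  | zero => rfl
  | succ k => exact Finset.sum_eq_zero fun α _ => sineFun_mul_eq_zero h α k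

theorem levelKernel_eq_zero (c : ℕ → ℂ) {i : ℕ} {x y : P.F (i + 1)}
    (h : ¬ P.SameBundle (i + 1) x y) : P.levelKernel c (i + 1) x y = 0 := by
  simp [levelKernel, levelCoeff_eq_zero h]

theorem levelKernel_Phi_eq_zero (c : ℕ → ℂ) {x y : P.FInf} (hxy : x ≠ y) {l : ℕ}
    (hl : l ∉ Finset.range (P.iStar x y + 1)) : P.levelKernel c l (P.Phi l x) (P.Phi l y) = 0 := by
  obtain ⟨i, rfl⟩ : ∃ i, l = i + 1 :=
    ⟨l - 1, by have := Finset.mem_range.not.1 hl; omega⟩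
  refine levelKernel_eq_zero c (not_sameBundle hxy ?_)
  have := Finset.mem_range.not.1 hl
  omega

/-- The kernel of a function of the Laplacian, off the diagonal. -/
def starKernel (P : Parameters) (c : ℕ → ℂ) (x y : P.FInf) : ℂ :=
  ∑ l ∈ Finset.range (P.iStar x y + 1), P.levelKernel c l (P.Phi l x) (P.Phi l y)

theorem pStar_eq_starKernel {z : ℂ} (hz : 0 < z.re) (x y : P.FInf) :
    P.pStar z x y = P.starKernel (heatSeq z) x y := p_Phi hz _ x y

/-! ### The series of the kernel -/

theorem conj_expFun_mul_expFun (m : ℤ) (x y : P.F 0) :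
    (starRingEnd ℂ) (P.expFun m x) * P.expFun m y =
      1 / (2 * Real.pi) * fourier m (P.angle 0 y - P.angle 0 x) := by
  have h1 : (fourier m (P.angle 0 y - P.angle 0 x) : ℂ) =
      fourier m (P.angle 0 y) * (starRingEnd ℂ) (fourier m (P.angle 0 x)) := by
    rw [← fourier_neg' (n := m) (x := P.angle 0 x), fourier_apply, smul_sub, sub_eq_add_neg,
      AddCircle.toCircle_add, Circle.coe_mul, fourier_apply]
  have h2 : (((√(2 * Real.pi))⁻¹ : ℝ) : ℂ) * (((√(2 * Real.pi))⁻¹ : ℝ) : ℂ) =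
      1 / (2 * Real.pi) := by
    rw [← Complex.ofReal_mul, ← mul_inv, Real.mul_self_sqrt (by positivity)]
    push_cast
    ring
  rw [expFun, expFun, map_mul, Complex.conj_ofReal, h1, ← h2]
  ring

/-- The modes `m` and `-m` have the same frequency, and together they give the cosine terms of the
circle kernel. -/
theorem hasSum_expFun {c : ℕ → ℂ} (hc : QuadDecay c) (x y : P.F 0) :
    HasSum (fun m : ℤ => c m.natAbs * (starRingEnd ℂ) (P.expFun m x) * P.expFun m y)
      (P.levelKernel c 0 x y) := by
  have hf : ∀ m : ℤ, c m.natAbs * (starRingEnd ℂ) (P.expFun m x) * P.expFun m y =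
      c m.natAbs * (1 / (2 * Real.pi) * fourier m (P.angle 0 y - P.angle 0 x)) := fun m => by
    rw [mul_assoc, conj_expFun_mul_expFun]
  simp only [hf]
  have hsum : Summable fun k : ℕ => ‖c (k + 1)‖ :=
    (summable_nat_add_iff (f := fun k => ‖c k‖) 1).2 (by simpa using hc.summable_mul (J := 1) one_pos)
  have hs : ∀ e : ℕ → ℤ, Summable fun k : ℕ =>
      c (k + 1) * (1 / (2 * Real.pi) * fourier (e k) (P.angle 0 y - P.angle 0 x)) := by
    intro e
    refine Summable.of_norm_bounded (hsum.mul_right ‖(1 / (2 * Real.pi) : ℂ)‖) fun k => ?_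
    rw [norm_mul, norm_mul, fourier_apply, Circle.norm_coe, mul_one]
  have hn : ∀ k : ℕ, ((k : ℤ) + 1).natAbs = k + 1 := fun k => by omega
  have h1 := HasSum.of_add_one_of_neg_add_one
    (f := fun m : ℤ => c m.natAbs * (1 / (2 * Real.pi) * fourier m (P.angle 0 y - P.angle 0 x)))
    (by simpa only [hn] using (hs fun k => k + 1).hasSum)
    (by simpa only [Int.natAbs_neg, hn] using (hs fun k => -(k + 1)).hasSum)
  convert! h1 using 1
  rw [levelKernel, (summable_levelTerm hc 0 x y).tsum_eq_zero_add, add_right_comm,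
    ← (hs _).tsum_add (hs _), add_comm]
  congr 1
  · refine tsum_congr fun k => ?_
    rw [← mul_add, ← mul_add, fourier_add_fourier_neg]
    simp only [J_zero, mul_one, levelCoeff]
    push_cast
    field_simp
  · simp [levelCoeff]

end Parameters
end DiamondFractal
end

/-! ### Integral kernels of functions of the Laplacian, and the growth condition -/

noncomputable section

namespace DiamondFractal
namespace Parameters

variable {P : Parameters}

theorem summable_sineFun {c : ℕ → ℂ} (hc : QuadDecay c) (i : ℕ) (x y : P.F (i + 1)) :
    Summable fun q : P.Cell (i + 1) × ℕ => ‖c ((q.2 + 1) * P.J (i + 1)) *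
      (P.sineFun i q.1 q.2 x : ℂ) * (P.sineFun i q.1 q.2 y : ℂ)‖ := by
  have h1 : Summable fun k : ℕ => ‖c ((k + 1) * P.J (i + 1))‖ :=
    (summable_nat_add_iff (f := fun k => ‖c (k * P.J (i + 1))‖) 1).2 (hc.summable_mul (P.J_pos _))
  have h2 : ∀ q : P.Cell (i + 1) × ℕ, ‖c ((q.2 + 1) * P.J (i + 1)) *
      (P.sineFun i q.1 q.2 x : ℂ) * (P.sineFun i q.1 q.2 y : ℂ)‖ ≤
      ‖c ((q.2 + 1) * P.J (i + 1))‖ * P.amplitude (i + 1) ^ 2 := by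
    intro q
    rw [norm_mul, norm_mul, Complex.norm_real, Complex.norm_real, mul_assoc, sq]
    exact mul_le_mul_of_nonneg_left (mul_le_mul (abs_sineFun_le i _ _ _) (abs_sineFun_le i _ _ _)
      (norm_nonneg _) (P.amplitude_nonneg _)) (norm_nonneg _)
  refine (summable_prod_of_nonneg fun q => norm_nonneg _).2 ⟨fun α => ?_, Summable.of_finite⟩
  exact Summable.of_nonneg_of_le (fun k => norm_nonneg _) (fun k => h2 (α, k))
    (h1.mul_right (P.amplitude (i + 1) ^ 2))

theorem tsum_sineFun {c : ℕ → ℂ} (hc : QuadDecay c) (i : ℕ) (x y : P.F (i + 1)) :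
    ∑' q : P.Cell (i + 1) × ℕ, c ((q.2 + 1) * P.J (i + 1)) *
      (P.sineFun i q.1 q.2 x : ℂ) * (P.sineFun i q.1 q.2 y : ℂ) = P.levelKernel c (i + 1) x y := by
  have hs := (summable_sineFun hc i x y).of_norm
  rw [hs.tsum_prod, tsum_fintype, ← Summable.tsum_finsetSum fun α _ => hs.prod_factor α,
    levelKernel, (summable_levelTerm hc (i + 1) x y).tsum_eq_zero_add]
  simp only [levelCoeff, Complex.ofReal_zero, mul_zero, zero_add]
  refine tsum_congr fun k => ?_
  push_cast
  rw [Finset.mul_sum]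
  exact Finset.sum_congr rfl fun α _ => mul_assoc _ _ _

/-- Off the diagonal, the series of the kernel is a finite sum over the stages. -/
theorem tsum_frameFun {c : ℕ → ℂ} (hc : QuadDecay c) {x y : P.FInf} (hxy : x ≠ y) :
    ∑' n, c (P.freq n) * (starRingEnd ℂ) (P.frameFun n x) * P.frameFun n y =
      P.starKernel c x y := by
  obtain ⟨f, hf⟩ : ∃ f : (Σ i, P.Cell (i + 1) × ℕ) → ℂ, ∀ i q, f ⟨i, q⟩ =
      c ((q.2 + 1) * P.J (i + 1)) * (P.sineFun i q.1 q.2 (P.Phi (i + 1) x) : ℂ) *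
        (P.sineFun i q.1 q.2 (P.Phi (i + 1) y) : ℂ) :=
    ⟨fun n => c ((n.2.2 + 1) * P.J (n.1 + 1)) *
      (P.sineFun n.1 n.2.1 n.2.2 (P.Phi (n.1 + 1) x) : ℂ) *
        (P.sineFun n.1 n.2.1 n.2.2 (P.Phi (n.1 + 1) y) : ℂ), fun _ _ => rfl⟩
  have h0 : HasSum (fun m : ℤ => c (P.freq (.inl m)) *
      (starRingEnd ℂ) (P.frameFun (.inl m) x) * P.frameFun (.inl m) y) _ :=
    hasSum_expFun hc (P.Phi 0 x) (P.Phi 0 y)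
  have h1 : ∀ n : (Σ i, P.Cell (i + 1) × ℕ), c (P.freq (.inr n)) *
      (starRingEnd ℂ) (P.frameFun (.inr n) x) * P.frameFun (.inr n) y = f n := by
    rintro ⟨i, α, k⟩
    rw [hf, frameFun, frameFun, Complex.conj_ofReal, freq]
  have hz : ∀ i, P.iStar x y ≤ i → ∀ q, f ⟨i, q⟩ = 0 := by
    intro i hi q
    rw [hf, mul_assoc, ← Complex.ofReal_mul, sineFun_mul_eq_zero (not_sameBundle hxy hi),
      Complex.ofReal_zero, mul_zero]
  -- Each stage is absolutely summable by the decay of `c`, and only finitely many stages are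
  -- nonzero at the pair `(x, y)`.
  have hs : Summable f := by
    refine Summable.of_norm ((summable_sigma_of_nonneg fun n => norm_nonneg _).2
      ⟨fun i => ?_, ?_⟩)
    · simp only [hf]
      exact summable_sineFun hc i _ _
    refine summable_of_ne_finset_zero (s := Finset.range (P.iStar x y)) fun i hi => ?_
    have hi' : P.iStar x y ≤ i := by simpa using hi
    simp [hz i hi']
  have h2 := Summable.tsum_sum (f := fun n => c (P.freq n) *
    (starRingEnd ℂ) (P.frameFun n x) * P.frameFun n y) h0.summable
    (by simpa only [Function.comp_def, h1] using hs)
  rw [h2, h0.tsum_eq]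
  simp only [h1]
  rw [hs.tsum_sigma, tsum_eq_sum (s := Finset.range (P.iStar x y)) fun i hi => by
    have hi' : P.iStar x y ≤ i := by simpa using hi
    simp [hz i hi'], starKernel, Finset.sum_range_succ', add_comm]
  congr 1
  refine Finset.sum_congr rfl fun i _ => ?_
  simp only [hf]
  exact tsum_sineFun hc i _ _

/-- Already the set of points with the same angle as `x` is null. Hence the values of a kernel on
the diagonal do not affect the operator. -/
theorem ae_ne (x : P.FInf) : ∀ᵐ y ∂P.muInf, x ≠ y := by
  have h0 : ∀ᵐ η ∂arcLength, P.Phi 0 x ≠ ((η : ℝ) : Circ) := by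
    rw [arcLength, ae_restrict_iff' measurableSet_Ico]
    have hsub : {η : ℝ | ¬ (η ∈ Ico 0 (2 * Real.pi) → P.Phi 0 x ≠ ((η : ℝ) : Circ))}.Subsingleton := by
      intro a ha b hb
      simp only [mem_ofPred_eq, Classical.not_imp, not_not] at ha hb
      have : Fact (0 < 2 * Real.pi) := ⟨Real.two_pi_pos⟩
      exact (AddCircle.coe_eq_coe_iff_of_mem_Ico (a := 0) (by simpa using ha.1)
        (by simpa using hb.1)).1 (ha.2.symm.trans hb.2)
    exact hsub.measure_zero _
  have h1 : ∀ᵐ z ∂P.wordProd, P.Phi 0 x ≠ ((z.1 : ℝ) : Circ) :=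
    Measure.quasiMeasurePreserving_fst.ae h0
  have hms : MeasurableSet {y : P.FInf | P.Phi 0 x ≠ P.Phi 0 y} :=
    ((P.measurable_Phi 0) (measurableSet_singleton (α := Circ) (P.Phi 0 x))).compl.congr
      (Set.ext fun y => not_congr eq_comm)
  have h2 : ∀ᵐ y ∂P.muInf, P.Phi 0 x ≠ P.Phi 0 y := by
    rw [muInf_eq_map]
    exact (ae_map_iff P.measurable_pointInf.aemeasurable hms).2 h1
  filter_upwards [h2] with y hy hxy
  exact hy (by rw [hxy])

theorem QuadDecay.exists_norm_le {c : ℕ → ℂ} (hc : QuadDecay c) : ∃ C, ∀ k, ‖c k‖ ≤ C := by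
  obtain ⟨C, hC0, hC⟩ := hc.exists_pos
  refine ⟨C, fun k => (hC k).trans (div_le_self hC0 ?_)⟩
  have := sq_nonneg (k : ℝ)
  linarith

/-- A function of the Laplacian is the integral operator with the kernel `starKernel`. -/
theorem multiplier_eq_integral_starKernel {c : ℕ → ℂ} (hc : QuadDecay c) (f : P.L2) :
    ∀ᵐ x ∂P.muInf, Integrable (fun y => P.starKernel c x y * f y) P.muInf ∧
      P.parsevalFrame.multiplier (fun n => c (P.freq n)) f x =
        ∫ y, P.starKernel c x y * f y ∂P.muInf := by
  obtain ⟨C, hC⟩ := QuadDecay.exists_norm_le hc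
  obtain ⟨B, hB, hbound⟩ := exists_bound_kernel (summableAlong_of_quadDecay (P := P) hc)
  filter_upwards [P.parsevalFrame.multiplier_eq_integral (a := fun n => c (P.freq n))
    (fun n => hC _) hB hbound f] with x hx
  have h1 : (fun y => (∑' n, c (P.freq n) * (starRingEnd ℂ) (P.frameFun n x) * P.frameFun n y) *
      f y) =ᵐ[P.muInf] fun y => P.starKernel c x y * f y := by
    filter_upwards [ae_ne x] with y hy
    rw [tsum_frameFun hc hy]
  exact ⟨hx.1.congr h1, hx.2.trans (integral_congr_ae h1)⟩

/-! ### The heat kernel -/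

theorem exists_bound_levelTerm (hP : P.Growth) {δ : ℝ} (hδ : 0 < δ) :
    ∃ C ρ : ℝ, 0 ≤ C ∧ 0 ≤ ρ ∧ ρ < 1 ∧ ∀ (l k : ℕ) (z : ℂ), δ ≤ z.re → ∀ x y : P.F l,
      ‖heatSeq z (k * P.J l) * P.levelCoeff l k x y‖ ≤ C * (1 / 2) ^ l * ρ ^ k := by
  obtain ⟨ε, hε, hlim⟩ := hP
  -- The factor `3` allows the exponent to be spent three times: on `N_l`, on the remaining factor
  -- `J_l` of the squared amplitude, and on the geometric decay in `k`.
  set t : ℝ := min (δ / 3) (ε / 2) with ht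
  have ht0 : 0 < t := lt_min (by positivity) (by positivity)
  have htδ : 3 * t ≤ δ := by linarith [min_le_left (δ / 3) (ε / 2)]
  have htε : t < ε := by linarith [min_le_right (δ / 3) (ε / 2)]
  obtain ⟨a, ha⟩ := hlim t ⟨ht0, htε⟩
  obtain ⟨B, hB⟩ := ha.bddAbove_range
  have hB' : ∀ l, (P.N l : ℝ) * Real.exp (-(P.J l : ℝ) ^ 2 * t) ≤ B := fun l => hB ⟨l, rfl⟩
  have hB0 : 0 ≤ B := le_trans (by positivity) (hB' 0)
  refine ⟨P.amplitude 0 ^ 2 + 2 / Real.pi * (B / t), Real.exp (-t), by positivity, by positivity,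
    by simpa using ht0, fun l k z hz x y => ?_⟩
  have hD : 0 ≤ 2 / Real.pi * (B / t) := by positivity
  rcases Nat.eq_zero_or_pos k with rfl | hk
  · rcases l with _ | i
    · refine (norm_levelTerm_le _ _ _ _ _).trans ?_
      rw [norm_heatSeq]
      simpa using hD
    · simp only [levelCoeff, Complex.ofReal_zero, mul_zero, norm_zero]
      positivity
  · refine (norm_levelTerm_le _ _ _ _ _).trans ?_
    rw [norm_heatSeq, amplitude_sq_eq]
    have hk1 : (1 : ℝ) ≤ k := by exact_mod_cast hk
    have hJ1 : (1 : ℝ) ≤ P.J l := by exact_mod_cast P.J_pos l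
    have hJ2 : (2 : ℝ) ^ l ≤ P.J l := by exact_mod_cast P.two_pow_le_J l
    set J : ℝ := ((P.J l : ℕ) : ℝ) with hJ
    -- One `J² t` pairs with `N_l` through the growth assumption; the second gives `J exp (-J² t) ≤
    -- 1 / (J t) ≤ 2^{-l} / t`; the summand `k t` gives `ρ^k` with `ρ = exp (-t)`.
    have h1 : 2 * (J ^ 2 * t) + k * t ≤ ((k * P.J l : ℕ) : ℝ) ^ 2 * z.re := by
      have e1 : 2 * J ^ 2 + k ≤ 3 * (k * J) ^ 2 := by
        have : (1 : ℝ) ≤ (k : ℝ) ^ 2 := one_le_pow₀ hk1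
        have h2 : (1 : ℝ) ≤ J ^ 2 := one_le_pow₀ hJ1
        have h3 : (k : ℝ) ≤ (k : ℝ) ^ 2 := by nlinarith
        have h4 : J ^ 2 ≤ (k : ℝ) ^ 2 * J ^ 2 := le_mul_of_one_le_left (by positivity) this
        have h5 : (k : ℝ) ^ 2 ≤ (k : ℝ) ^ 2 * J ^ 2 := le_mul_of_one_le_right (by positivity) h2
        rw [mul_pow]
        linarith
      push_cast
      calc 2 * (J ^ 2 * t) + k * t = (2 * J ^ 2 + k) * t := by ring
        _ ≤ (3 * (k * J) ^ 2) * t := by gcongr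
        _ = (k * J) ^ 2 * (3 * t) := by ring
        _ ≤ (k * J) ^ 2 * z.re := by
          gcongr
          exact htδ.trans hz
    have h2 : Real.exp (-(((k * P.J l : ℕ) : ℝ) ^ 2 * z.re)) ≤
        Real.exp (-J ^ 2 * t) * Real.exp (-(J ^ 2 * t)) * Real.exp (-t) ^ k := by
      rw [← Real.exp_nat_mul, ← Real.exp_add, ← Real.exp_add]
      refine Real.exp_le_exp.2 ?_
      linarith
    have h3 : J * Real.exp (-(J ^ 2 * t)) ≤ (1 / 2) ^ l / t := by
      have e1 : 0 < J ^ 2 * t := by positivity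
      have e2 : Real.exp (-(J ^ 2 * t)) ≤ 1 / (J ^ 2 * t) := by
        rw [Real.exp_neg, inv_eq_one_div]
        exact one_div_le_one_div_of_le e1 (by linarith [Real.add_one_le_exp (J ^ 2 * t)])
      calc J * Real.exp (-(J ^ 2 * t)) ≤ J * (1 / (J ^ 2 * t)) := by gcongr
        _ = 1 / J / t := by field_simp
        _ ≤ (1 / 2) ^ l / t := by
          rw [one_div_pow]
          gcongr
    calc 2 * (P.N l : ℝ) * J / Real.pi * Real.exp (-(((k * P.J l : ℕ) : ℝ) ^ 2 * z.re))
        ≤ 2 * (P.N l : ℝ) * J / Real.pi *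
          (Real.exp (-J ^ 2 * t) * Real.exp (-(J ^ 2 * t)) * Real.exp (-t) ^ k) := by gcongr
      _ = 2 / Real.pi * (((P.N l : ℝ) * Real.exp (-J ^ 2 * t)) *
          (J * Real.exp (-(J ^ 2 * t)))) * Real.exp (-t) ^ k := by ring
      _ ≤ 2 / Real.pi * (B * ((1 / 2) ^ l / t)) * Real.exp (-t) ^ k := by
          gcongr
          exact hB' l
      _ = 2 / Real.pi * (B / t) * (1 / 2) ^ l * Real.exp (-t) ^ k := by ring
      _ ≤ _ := by
          gcongr
          exact le_add_of_nonneg_left (sq_nonneg _)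

theorem exists_bound_levelKernel (hP : P.Growth) {δ : ℝ} (hδ : 0 < δ) :
    ∃ C : ℝ, ∀ (l : ℕ) (z : ℂ), δ ≤ z.re → ∀ x y : P.F l,
      ‖P.levelKernel (heatSeq z) l x y‖ ≤ C * (1 / 2) ^ l := by
  obtain ⟨C, ρ, hC, hρ0, hρ1, h⟩ := exists_bound_levelTerm hP hδ
  refine ⟨C * (1 - ρ)⁻¹, fun l z hz x y => ?_⟩
  have h1 := tsum_of_norm_bounded ((hasSum_geometric_of_lt_one hρ0 hρ1).mul_left
    (C * (1 / 2) ^ l)) fun k => h l k z hz x y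
  refine h1.trans_eq ?_
  ring

theorem summable_half (C : ℝ) : Summable fun l : ℕ => C * (1 / 2 : ℝ) ^ l :=
  summable_geometric_two.mul_left C

theorem summable_levelKernel (hP : P.Growth) {z : ℂ} (hz : 0 < z.re) (x y : P.FInf) :
    Summable fun l => P.levelKernel (heatSeq z) l (P.Phi l x) (P.Phi l y) := by
  obtain ⟨C, hC⟩ := exists_bound_levelKernel hP hz
  exact Summable.of_norm_bounded (summable_half C) fun l => hC l z le_rfl _ _

theorem tendsto_p (hP : P.Growth) {z : ℂ} (hz : 0 < z.re) (x y : P.FInf) :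
    Tendsto (fun i => P.p i z (P.Phi i x) (P.Phi i y)) atTop
      (𝓝 (∑' l, P.levelKernel (heatSeq z) l (P.Phi l x) (P.Phi l y))) := by
  simp only [p_Phi hz]
  exact (tendsto_add_atTop_iff_nat 1).2 (summable_levelKernel hP hz x y).hasSum.tendsto_sum_nat

theorem pInf_eq_tsum (hP : P.Growth) {z : ℂ} (hz : 0 < z.re) (x y : P.FInf) :
    P.pInf z x y = ∑' l, P.levelKernel (heatSeq z) l (P.Phi l x) (P.Phi l y) :=
  (tendsto_p hP hz x y).limUnder_eq

theorem pInf_eq_starKernel (hP : P.Growth) {z : ℂ} (hz : 0 < z.re) {x y : P.FInf} (hxy : x ≠ y) :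
    P.pInf z x y = P.starKernel (heatSeq z) x y := by
  rw [pInf_eq_tsum hP hz, starKernel]
  exact tsum_eq_sum fun l hl => levelKernel_Phi_eq_zero _ hxy hl

theorem exists_bound_pInf (hP : P.Growth) {z : ℂ} (hz : 0 < z.re) :
    ∃ C, ∀ x y : P.FInf, ‖P.pInf z x y‖ ≤ C := by
  obtain ⟨C, hC⟩ := exists_bound_levelKernel hP hz
  refine ⟨∑' l : ℕ, C * (1 / 2 : ℝ) ^ l, fun x y => ?_⟩
  rw [pInf_eq_tsum hP hz]
  exact tsum_of_norm_bounded (summable_half C).hasSum fun l => hC l z le_rfl _ _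

theorem measurable_pInf (hP : P.Growth) {z : ℂ} (hz : 0 < z.re) (x : P.FInf) :
    Measurable fun y => P.pInf z x y := by
  simp only [pInf_eq_tsum hP hz]
  exact Measurable.tsum fun l => (measurable_levelKernel _ l _).comp (P.measurable_Phi l)

/-- Since `i_*` varies with `y`, measurability and boundedness are read off from the series `pInf`,
which differs from `pStar` at most at `y = x`. -/
theorem integrable_pStar_mul (hP : P.Growth) {z : ℂ} (hz : 0 < z.re) (x : P.FInf) (f : P.L2) :
    Integrable (fun y => P.pStar z x y * f y) P.muInf := by
  obtain ⟨C, hC⟩ := exists_bound_pInf hP hz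
  have h1 : Integrable (fun y => P.pInf z x y * f y) P.muInf :=
    ((Lp.memLp f).integrable one_le_two).bdd_mul
      (measurable_pInf hP hz x).aestronglyMeasurable (ae_of_all _ (hC x))
  refine h1.congr ?_
  filter_upwards [ae_ne x] with y hy
  rw [pStar_eq_starKernel hz, pInf_eq_starKernel hP hz hy]

theorem differentiable_heatSeq (k : ℕ) : Differentiable ℂ fun z => heatSeq z k := by
  unfold heatSeq
  fun_prop

/-- Weierstrass' theorem twice, in `k` and then in the stage, on each half plane `Re z > δ`, where
the bounds are uniform. -/
theorem differentiableOn_pInf (hP : P.Growth) (x y : P.FInf) :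
    DifferentiableOn ℂ (fun z => P.pInf z x y) {z | 0 < z.re} := by
  have key : ∀ δ : ℝ, 0 < δ → DifferentiableOn ℂ (fun z => P.pInf z x y) {z | δ < z.re} := by
    intro δ hδ
    have hopen : IsOpen {z : ℂ | δ < z.re} := isOpen_lt continuous_const Complex.continuous_re
    obtain ⟨C, ρ, hC, hρ0, hρ1, h⟩ := exists_bound_levelTerm hP hδ
    obtain ⟨C', hC'⟩ := exists_bound_levelKernel hP hδ
    have h1 : ∀ l, DifferentiableOn ℂ
        (fun z => P.levelKernel (heatSeq z) l (P.Phi l x) (P.Phi l y)) {z | δ < z.re} := by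
      intro l
      refine Complex.differentiableOn_tsum_of_summable_norm
        ((summable_geometric_of_lt_one hρ0 hρ1).mul_left (C * (1 / 2) ^ l))
        (fun k => ((differentiable_heatSeq _).mul_const _).differentiableOn) hopen
        fun k z hz => h l k z (le_of_lt hz) _ _
    refine (Complex.differentiableOn_tsum_of_summable_norm (summable_half C') h1 hopen
      fun l z hz => hC' l z (le_of_lt hz) _ _).congr fun z hz => ?_
    exact pInf_eq_tsum hP (hδ.trans hz) x y
  intro z hz
  have hz' : (0 : ℝ) < z.re := hz
  have h2 : z.re / 2 < z.re := half_lt_self hz'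
  have h3 := (key (z.re / 2) (half_pos hz')) z h2
  exact (h3.differentiableAt ((isOpen_lt continuous_const Complex.continuous_re).mem_nhds
    h2)).differentiableWithinAt

theorem isHeatKernel_pInf (hP : P.Growth) : P.IsHeatKernel fun t => P.pInf t := by
  intro f
  refine ⟨P.solution 1 f, isUniqueSolution_solution (by simp) f, fun t ht => ?_⟩
  have ht' : 0 < (t : ℂ).re := by simpa using ht
  have h1 : P.evolution 1 t = fun n => heatSeq t (P.freq n) := by
    funext n
    rw [evolution_of_nonneg 1 ht.le, heatSeq, one_mul]
  filter_upwards [multiplier_eq_integral_starKernel (quadDecay_heatSeq ht') f] with x hx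
  have h2 : (fun y => P.starKernel (heatSeq t) x y * f y) =ᵐ[P.muInf]
      fun y => P.pInf t x y * f y := by
    filter_upwards [ae_ne x] with y hy
    rw [pInf_eq_starKernel hP ht' hy]
  refine ⟨hx.1.congr h2, ?_⟩
  rw [solution, h1, hx.2]
  exact integral_congr_ae h2

end Parameters
end DiamondFractal
end

/-! ### Distributions in time and Wick rotation -/

noncomputable section

namespace DiamondFractal

/-- The Fourier coefficient `∫ η(t) exp (-i k² t) dt` of a test function. -/
def timeCoeff (η : 𝓓(posTimes, ℝ)) (k : ℕ) : ℂ :=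
  ∫ t : ℝ, (η t : ℂ) * heatSeq (Complex.I * t) k

theorem norm_heatSeq_I_mul (t : ℝ) (k : ℕ) : ‖heatSeq (Complex.I * t) k‖ = 1 := by
  rw [norm_heatSeq]
  simp

theorem continuous_heatSeq_comp {g : ℝ → ℂ} (hg : Continuous g) (k : ℕ) :
    Continuous fun t => heatSeq (g t) k := by
  unfold heatSeq
  fun_prop

theorem heatSeq_add (z w : ℂ) (k : ℕ) : heatSeq (z + w) k = heatSeq z k * heatSeq w k := by
  rw [heatSeq, heatSeq, heatSeq, ← Complex.exp_add]
  ring_nf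

theorem norm_heatSeq_ofReal_le {ε : ℝ} (hε : 0 ≤ ε) (k : ℕ) : ‖heatSeq ε k‖ ≤ 1 := by
  rw [norm_heatSeq, Real.exp_le_one_iff, Complex.ofReal_re]
  have : 0 ≤ (k : ℝ) ^ 2 * ε := by positivity
  linarith

theorem tsum_mul_integral {w : ℝ → ℂ} (hw : Continuous w) (hwc : HasCompactSupport w)
    {a : ℕ → ℂ} (ha : Summable fun k => ‖a k‖) {h : ℕ → ℝ → ℂ} (hh : ∀ k, Continuous (h k))
    (hb : ∀ k t, ‖h k t‖ ≤ 1) :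
    (Continuous fun t => ∑' k, a k * h k t) ∧
      ∑' k, a k * ∫ t, w t * h k t = ∫ t, w t * ∑' k, a k * h k t := by
  constructor
  · refine continuous_tsum (fun k => (hh k).const_mul (a k)) ha fun k t => ?_
    rw [norm_mul]
    exact mul_le_of_le_one_right (norm_nonneg _) (hb k t)
  · have hi : ∀ k, Integrable (fun t => a k * (w t * h k t)) := fun k =>
      ((hw.mul (hh k)).integrable_of_hasCompactSupport hwc.mul_right).const_mul _
    have hs : Summable fun k => ∫ t, ‖a k * (w t * h k t)‖ := by
      refine Summable.of_nonneg_of_le (fun k => integral_nonneg fun t => norm_nonneg _)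
        (fun k => ?_) (ha.mul_right (∫ t, ‖w t‖))
      rw [← integral_const_mul]
      refine integral_mono (hi k).norm
        ((hw.integrable_of_hasCompactSupport hwc).norm.const_mul _) fun t => ?_
      simp only
      rw [norm_mul, norm_mul]
      exact mul_le_mul_of_nonneg_left (mul_le_of_le_one_right (norm_nonneg _) (hb k t))
        (norm_nonneg _)
    simp only [← integral_const_mul]
    rw [integral_tsum_of_summable_integral_norm hi hs]
    refine integral_congr_ae (ae_of_all _ fun t => ?_)
    simp only
    rw [← tsum_mul_left]
    exact tsum_congr fun k => by ring

section TestFunction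

variable (η : 𝓓(posTimes, ℝ))

theorem continuous_ofReal_testFunction : Continuous fun t => (η t : ℂ) :=
  Complex.continuous_ofReal.comp η.continuous

theorem hasCompactSupport_ofReal_testFunction : HasCompactSupport fun t => (η t : ℂ) :=
  η.hasCompactSupport.comp_left Complex.ofReal_zero

theorem contDiff_one_testFunction : ContDiff ℝ 1 η := η.contDiff.of_le (by simp)

theorem continuous_deriv_testFunction : Continuous fun t => ((deriv η t : ℝ) : ℂ) :=
  Complex.continuous_ofReal.comp ((contDiff_one_testFunction η).continuous_deriv le_rfl)

theorem hasCompactSupport_deriv_testFunction : HasCompactSupport fun t => ((deriv η t : ℝ) : ℂ) :=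
  η.hasCompactSupport.deriv.comp_left Complex.ofReal_zero

/-- One integration by parts gives `i k²`; adding `i ∫ η exp (-i k² t) dt` gives a factor that is
nonzero at `k = 0` as well. The right side is bounded in `k`, whence the quadratic decay. -/
theorem mul_timeCoeff (k : ℕ) : Complex.I * (1 + (k : ℂ) ^ 2) * timeCoeff η k =
    ∫ t : ℝ, (((deriv η t : ℝ) : ℂ) + Complex.I * η t) * heatSeq (Complex.I * t) k := by
  have hcv : Continuous fun t : ℝ => heatSeq (Complex.I * t) k :=
    continuous_heatSeq_comp (by fun_prop) k
  have h1 : ∀ t : ℝ, HasDerivAt (fun t : ℝ => (η t : ℂ)) ((deriv η t : ℝ) : ℂ) t := fun t =>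
    (((contDiff_one_testFunction η).differentiable one_ne_zero) t).hasDerivAt.ofReal_comp
  have h2 : ∀ t : ℝ, HasDerivAt (fun t : ℝ => heatSeq (Complex.I * t) k)
      (heatSeq (Complex.I * t) k * (-(k : ℂ) ^ 2 * Complex.I)) t := by
    intro t
    have h3 : HasDerivAt (fun t : ℝ => -(k : ℂ) ^ 2 * (Complex.I * t))
        (-(k : ℂ) ^ 2 * Complex.I) t := by
      simpa using ((hasDerivAt_id t).ofReal_comp.const_mul Complex.I).const_mul (-(k : ℂ) ^ 2)
    exact h3.cexp
  have i1 : Integrable (fun t : ℝ => (η t : ℂ) * heatSeq (Complex.I * t) k) :=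
    ((continuous_ofReal_testFunction η).mul hcv).integrable_of_hasCompactSupport
    (hasCompactSupport_ofReal_testFunction η).mul_right
  have i2 : Integrable (fun t : ℝ => ((deriv η t : ℝ) : ℂ) * heatSeq (Complex.I * t) k) :=
    ((continuous_deriv_testFunction η).mul hcv).integrable_of_hasCompactSupport
    (hasCompactSupport_deriv_testFunction η).mul_right
  have h3 := integral_mul_deriv_eq_deriv_mul_of_integrable (fun t _ => h1 t) (fun t _ => h2 t)
    (by
      have := i1.mul_const (-(k : ℂ) ^ 2 * Complex.I)
      refine this.congr (ae_of_all _ fun t => ?_)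
      simp only [Pi.mul_apply, mul_assoc]) i2 i1
  simp only [← mul_assoc] at h3
  simp only [add_mul, mul_assoc Complex.I]
  rw [integral_add i2 (i1.const_mul _), integral_const_mul, ← neg_neg (∫ t, _ * _), ← h3,
    timeCoeff]
  simp only [mul_assoc _ (-(k : ℂ) ^ 2) Complex.I]
  rw [integral_mul_const]
  ring

theorem quadDecay_timeCoeff : QuadDecay (timeCoeff η) := by
  refine ⟨∫ t : ℝ, ‖((deriv η t : ℝ) : ℂ) + Complex.I * η t‖, fun k => ?_⟩
  rw [le_div_iff₀ (by positivity)]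
  have h1 : ‖Complex.I * (1 + (k : ℂ) ^ 2)‖ = 1 + (k : ℝ) ^ 2 := by
    rw [norm_mul, Complex.norm_I, one_mul]
    have : (1 + (k : ℂ) ^ 2) = ((1 + (k : ℝ) ^ 2 : ℝ) : ℂ) := by push_cast; rfl
    rw [this, Complex.norm_real, Real.norm_eq_abs, abs_of_nonneg (by positivity)]
  rw [mul_comm, ← h1, ← norm_mul, mul_timeCoeff]
  refine (norm_integral_le_integral_norm _).trans_eq ?_
  simp only [norm_mul, norm_heatSeq_I_mul, mul_one]

end TestFunction

theorem lineDeriv_one_eq_deriv (η : 𝓓(posTimes, ℝ)) (t : ℝ) :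
    (TestFunction.lineDerivCLM ℝ (1 : ℝ) η : 𝓓(posTimes, ℝ)) t = deriv η t := by
  rw [TestFunction.lineDerivCLM_apply_of_le (by simp)]
  have h1 : DifferentiableAt ℝ η t :=
    ((contDiff_one_testFunction η).differentiable one_ne_zero) t
  rw [h1.lineDeriv_eq_fderiv, fderiv_apply_one_eq_deriv]

/-- The distribution `t ↦ ∑ d_k exp (-i (k J)² t)`. -/
theorem exists_distribution {d : ℕ → ℝ} {D : ℝ} (hd : ∀ k, |d k| ≤ D) {J : ℕ} (hJ : 0 < J) :
    ∃ T : 𝓓'(posTimes, ℂ), ∀ η, T η = ∑' k, timeCoeff η (k * J) * d k := by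
  have hD : 0 ≤ D := (abs_nonneg _).trans (hd 0)
  -- Dividing by the factor of `mul_timeCoeff` makes the series `G` absolutely convergent, hence a
  -- continuous function.
  set a : ℕ → ℂ := fun k => d k / (Complex.I * (1 + ((k * J : ℕ) : ℂ) ^ 2)) with ha
  have hne : ∀ k : ℕ, Complex.I * (1 + (k : ℂ) ^ 2) ≠ 0 := by
    intro k
    refine mul_ne_zero Complex.I_ne_zero ?_
    have : (1 + (k : ℂ) ^ 2) = ((1 + (k : ℝ) ^ 2 : ℝ) : ℂ) := by push_cast; rfl
    rw [this]
    exact_mod_cast (by positivity : (0 : ℝ) < 1 + (k : ℝ) ^ 2).ne'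
  have hsum : Summable fun k => ‖a k‖ := by
    refine Summable.of_nonneg_of_le (fun k => norm_nonneg _) (fun k => ?_)
      ((summable_inv_sq_mul hJ).mul_left D)
    have h1 : ‖Complex.I * (1 + ((k * J : ℕ) : ℂ) ^ 2)‖ = 1 + ((k * J : ℕ) : ℝ) ^ 2 := by
      rw [norm_mul, Complex.norm_I, one_mul]
      have : (1 + ((k * J : ℕ) : ℂ) ^ 2) = ((1 + ((k * J : ℕ) : ℝ) ^ 2 : ℝ) : ℂ) := by
        push_cast
        rfl
      rw [this, Complex.norm_real, Real.norm_eq_abs, abs_of_nonneg (by positivity)]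
    rw [ha, norm_div, h1, Complex.norm_real, Real.norm_eq_abs, div_eq_mul_one_div]
    exact mul_le_mul_of_nonneg_right (hd k) (by positivity)
  have hc : ∀ k : ℕ, Continuous fun t : ℝ => heatSeq (Complex.I * t) (k * J) := fun k =>
    continuous_heatSeq_comp (by fun_prop) _
  have hb : ∀ (k : ℕ) (t : ℝ), ‖heatSeq (Complex.I * t) (k * J)‖ ≤ 1 := fun k t =>
    (norm_heatSeq_I_mul t _).le
  set G : ℝ → ℂ := fun t => ∑' k, a k * heatSeq (Complex.I * t) (k * J) with hG
  have hGc : Continuous G := (tsum_mul_integral (continuous_const (y := (0 : ℂ)))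
    HasCompactSupport.zero hsum hc hb).1
  set B : ℝ →L[ℝ] ℂ →L[ℝ] ℂ := ContinuousLinearMap.lsmul ℝ ℝ with hB
  have hloc : ∀ φ : ℝ → ℂ, Continuous φ → LocallyIntegrableOn φ posTimes volume := fun φ hφ =>
    hφ.locallyIntegrable.locallyIntegrableOn _
  -- The distribution is `-G' + i G`: applied to `η` it is `∫ (η' + i η) G`, so continuity in `η` is
  -- inherited from differentiation and from integration against a continuous function.
  set T : 𝓓(posTimes, ℝ) →L[ℝ] ℂ :=
    (TestFunction.integralAgainstBilinCLM (n := ⊤) (Ω := posTimes) B volume G).comp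
        (TestFunction.lineDerivCLM ℝ (1 : ℝ) : 𝓓(posTimes, ℝ) →L[ℝ] 𝓓(posTimes, ℝ)) +
      TestFunction.integralAgainstBilinCLM B volume (fun t => Complex.I * G t) with hT
  refine ⟨{ T with }, fun η => ?_⟩
  change T η = _
  rw [hT, add_apply, ContinuousLinearMap.comp_apply,
    TestFunction.integralAgainstBilinCLM_eq_integral (hloc _ hGc),
    TestFunction.integralAgainstBilinCLM_eq_integral (hloc _ (hGc.const_mul _))]
  have hw1 := continuous_deriv_testFunction η
  have hw2 := (continuous_ofReal_testFunction η).const_mul Complex.I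
  have hs1 := hasCompactSupport_deriv_testFunction η
  have hs2 : HasCompactSupport fun t => Complex.I * (η t : ℂ) :=
    (hasCompactSupport_ofReal_testFunction η).mul_left
  have key := (tsum_mul_integral (hw1.add hw2) (hs1.add hs2) hsum hc hb).2
  simp only [Pi.add_apply, ← mul_timeCoeff] at key
  have h1 : ∀ k, a k * (Complex.I * (1 + ((k * J : ℕ) : ℂ) ^ 2) * timeCoeff η (k * J)) =
      timeCoeff η (k * J) * d k := by
    intro k
    simp only [ha]
    rw [← mul_assoc, div_mul_cancel₀ _ (hne (k * J)), mul_comm]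
  simp only [h1] at key
  rw [key, ← integral_add]
  · refine integral_congr_ae (ae_of_all _ fun t => ?_)
    simp only [hB, ContinuousLinearMap.lsmul_apply, Complex.real_smul, lineDeriv_one_eq_deriv, hG]
    ring
  · simp only [hB, ContinuousLinearMap.lsmul_apply, Complex.real_smul, lineDeriv_one_eq_deriv]
    exact (hw1.mul hGc).integrable_of_hasCompactSupport hs1.mul_right
  · simp only [hB, ContinuousLinearMap.lsmul_apply, Complex.real_smul]
    exact ((continuous_ofReal_testFunction η).mul (hGc.const_mul
      Complex.I)).integrable_of_hasCompactSupport
        (hasCompactSupport_ofReal_testFunction η).mul_right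

namespace Parameters

variable {P : Parameters}

theorem exists_schrodingerDistribution (x y : P.FInf) :
    ∃ T : 𝓓'(posTimes, ℂ), ∀ η, T η = P.starKernel (timeCoeff η) x y := by
  choose T hT using fun l => exists_distribution
    (fun k => abs_levelCoeff_le l k (P.Phi l x) (P.Phi l y)) (P.J_pos l)
  refine ⟨∑ l ∈ Finset.range (P.iStar x y + 1), T l, fun η => ?_⟩
  have h1 : (∑ l ∈ Finset.range (P.iStar x y + 1), T l) η =
      ∑ l ∈ Finset.range (P.iStar x y + 1), T l η := by
    induction Finset.range (P.iStar x y + 1) using Finset.induction_on with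
    | empty => rfl
    | insert l s hl ih =>
      rw [Finset.sum_insert hl, Finset.sum_insert hl, ← ih]
      rfl
  rw [h1]
  exact Finset.sum_congr rfl fun l _ => hT l η

/-- The free Schrödinger kernel of `F_∞`. -/
def schrodingerKernel (P : Parameters) (x y : P.FInf) : 𝓓'(posTimes, ℂ) :=
  (exists_schrodingerDistribution x y).choose

theorem schrodingerKernel_apply (x y : P.FInf) (η : 𝓓(posTimes, ℝ)) :
    P.schrodingerKernel x y η = P.starKernel (timeCoeff η) x y :=
  (exists_schrodingerDistribution x y).choose_spec η

/-- The factor `exp (-ε k²)` makes the series absolutely convergent uniformly in time, so the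
integral acts on each coefficient and yields `timeCoeff`. -/
theorem integral_levelKernel {ε : ℝ} (hε : 0 < ε) (η : 𝓓(posTimes, ℝ)) (l : ℕ) (x y : P.F l) :
    (Integrable fun t : ℝ => (η t : ℂ) * P.levelKernel (heatSeq (ε + Complex.I * t)) l x y) ∧
      ∫ t : ℝ, (η t : ℂ) * P.levelKernel (heatSeq (ε + Complex.I * t)) l x y =
        P.levelKernel (fun k => heatSeq ε k * timeCoeff η k) l x y := by
  have hε' : 0 < (ε : ℂ).re := by simpa using hε
  have h1 := tsum_mul_integral (continuous_ofReal_testFunction η)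
    (hasCompactSupport_ofReal_testFunction η)
    (a := fun k => heatSeq ε (k * P.J l) * P.levelCoeff l k x y)
    (h := fun k t => heatSeq (Complex.I * t) (k * P.J l))
    (summable_levelTerm (quadDecay_heatSeq hε') l x y).norm
    (fun k => continuous_heatSeq_comp (by fun_prop) _) fun k t => (norm_heatSeq_I_mul t _).le
  have h2 : ∀ t : ℝ, P.levelKernel (heatSeq (ε + Complex.I * t)) l x y =
      ∑' k, heatSeq ε (k * P.J l) * P.levelCoeff l k x y * heatSeq (Complex.I * t) (k * P.J l) := by
    intro t
    refine tsum_congr fun k => ?_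
    rw [heatSeq_add]
    ring
  simp only [h2]
  refine ⟨((continuous_ofReal_testFunction η).mul h1.1).integrable_of_hasCompactSupport
    (hasCompactSupport_ofReal_testFunction η).mul_right, ?_⟩
  rw [← h1.2, levelKernel]
  refine tsum_congr fun k => ?_
  rw [timeCoeff]
  ring

/-- The roles are exchanged in the limit: now the decay of `c` dominates, and the heat factor is
only bounded by `1`. -/
theorem tendsto_levelKernel {c : ℕ → ℂ} (hc : QuadDecay c) (l : ℕ) (x y : P.F l) :
    Tendsto (fun ε : ℝ => P.levelKernel (fun k => heatSeq ε k * c k) l x y) (𝓝[>] 0)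
      (𝓝 (P.levelKernel c l x y)) := by
  refine tendsto_tsum_of_dominated_convergence (summable_levelTerm hc l x y).norm (fun k => ?_) ?_
  · have h1 : Continuous fun ε : ℝ => heatSeq ε (k * P.J l) :=
      continuous_heatSeq_comp Complex.continuous_ofReal _
    have h2 : Tendsto (fun ε : ℝ => heatSeq ε (k * P.J l)) (𝓝[>] 0) (𝓝 1) := by
      have := (h1.tendsto 0).mono_left (nhdsWithin_le_nhds (s := Ioi 0))
      simpa [heatSeq] using this
    simpa using (h2.mul_const (c (k * P.J l))).mul_const (P.levelCoeff l k x y : ℂ)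
  · filter_upwards [self_mem_nhdsWithin] with ε hε k
    rw [mul_assoc, norm_mul]
    exact mul_le_of_le_one_left (norm_nonneg _) (norm_heatSeq_ofReal_le (le_of_lt hε) _)

theorem isWickRotation_schrodingerKernel (x y : P.FInf) :
    IsWickRotation (fun z => P.pStar z x y) (P.schrodingerKernel x y) := by
  intro η
  rw [schrodingerKernel_apply, starKernel]
  have h1 := tendsto_finsetSum (Finset.range (P.iStar x y + 1)) fun l _ =>
    tendsto_levelKernel (quadDecay_timeCoeff η) l (P.Phi l x) (P.Phi l y)
  refine h1.congr' ?_
  filter_upwards [self_mem_nhdsWithin] with ε hε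
  have hε' : (0 : ℝ) < ε := hε
  have h2 : ∀ t : ℝ, (η t : ℂ) * P.pStar (ε + Complex.I * t) x y =
      ∑ l ∈ Finset.range (P.iStar x y + 1),
        (η t : ℂ) * P.levelKernel (heatSeq (ε + Complex.I * t)) l (P.Phi l x) (P.Phi l y) := by
    intro t
    rw [pStar_eq_starKernel (by simpa using hε'), starKernel, Finset.mul_sum]
  simp only [h2]
  rw [integral_finsetSum _ fun l _ => (integral_levelKernel hε' η l _ _).1]
  exact Finset.sum_congr rfl fun l _ => (integral_levelKernel hε' η l _ _).2.symm

end Parameters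
end DiamondFractal
end

/-! ### Uniqueness of the kernel, and the limit at fixed times -/

noncomputable section

namespace DiamondFractal

/-- By Parseval, nothing but zero is orthogonal to all conjugated frame functions, so their span is
dense; the frame is countable. -/
theorem ParsevalFrame.secondCountableTopology {Ω ι : Type*} [MeasurableSpace Ω] {μ : Measure Ω}
    {e : ι → Ω → ℂ} [Countable ι] (h : ParsevalFrame μ e) :
    SecondCountableTopology (Lp ℂ 2 μ) := by
  have hm : ∀ n, MemLp (fun x => (starRingEnd ℂ) (e n x)) 2 μ := fun n => (h.memLp n).star
  set K : Submodule ℂ (Lp ℂ 2 μ) := Submodule.span ℂ (range fun n => (hm n).toLp) with hK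
  have hsep : TopologicalSpace.IsSeparable (K : Set (Lp ℂ 2 μ)) :=
    (countable_range _).isSeparable.span
  have htop : K.topologicalClosure = ⊤ := by
    rw [Submodule.topologicalClosure_eq_top_iff, Submodule.eq_bot_iff]
    intro f hf
    have h0 : ∀ n, ∫ x, e n x * f x ∂μ = 0 := by
      intro n
      have h1 := (Submodule.mem_orthogonal K f).1 hf _ (Submodule.subset_span ⟨n, rfl⟩)
      rw [L2.inner_def] at h1
      rw [← h1]
      refine integral_congr_ae ?_
      filter_upwards [(hm n).coeFn_toLp] with x hx
      rw [hx, RCLike.inner_apply, starRingEnd_self_apply, mul_comm]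
    have h2 := h.hasSum f
    simp only [h0, norm_zero, ne_eq, OfNat.ofNat_ne_zero, not_false_eq_true, zero_pow] at h2
    simpa using h2.unique hasSum_zero
  have huniv : TopologicalSpace.IsSeparable (univ : Set (Lp ℂ 2 μ)) := by
    have h1 := hsep.closure
    rw [← Submodule.topologicalClosure_coe, htop] at h1
    exact h1
  have : TopologicalSpace.SeparableSpace (Lp ℂ 2 μ) :=
    TopologicalSpace.isSeparable_univ_iff.1 huniv
  exact UniformSpace.secondCountable_of_separable _

/-- A kernel which defines the zero operator on `L²` vanishes almost everywhere. -/
theorem ae_ae_eq_zero {Ω : Type*} [MeasurableSpace Ω] {μ : Measure Ω} [IsFiniteMeasure μ]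
    [SecondCountableTopology (Lp ℂ 2 μ)] {D : Ω → Ω → ℂ}
    (hD : ∀ f : Lp ℂ 2 μ, ∀ᵐ x ∂μ, Integrable (fun y => D x y * f y) μ ∧
      ∫ y, D x y * f y ∂μ = 0) : ∀ᵐ x ∂μ, ∀ᵐ y ∂μ, D x y = 0 := by
  set S : Set (Lp ℂ 2 μ) := {f | ∃ A, ∃ hA : MeasurableSet A,
    f = indicatorConstLp 2 hA (measure_ne_top μ A) (1 : ℂ)} with hS
  -- The null set in the hypothesis depends on `f`, so only countably many `f` can be used at once.
  -- They are chosen among indicators, so that the approximants stay bounded by `1` and `|D x y|`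
  -- serves as a dominating function.
  obtain ⟨t, htS, htc, hdense⟩ :=
    (TopologicalSpace.IsSeparable.of_separableSpace S).exists_countable_dense_subset
  have h1 : ∀ᵐ x ∂μ, ∀ f ∈ t, ∫ y, D x y * f y ∂μ = 0 :=
    (ae_ball_iff htc).2 fun f _ => (hD f).mono fun x hx => hx.2
  filter_upwards [h1, hD (indicatorConstLp 2 MeasurableSet.univ (measure_ne_top μ _) (1 : ℂ))]
    with x hx hx1
  have hint : Integrable (D x) μ := by
    refine hx1.1.congr ?_
    filter_upwards [indicatorConstLp_coeFn (p := 2) (hs := MeasurableSet.univ)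
      (hμs := measure_ne_top μ univ) (c := (1 : ℂ))] with y hy
    rw [hy]
    simp
  refine hint.ae_eq_zero_of_forall_setIntegral_eq_zero fun A hA _ => ?_
  set g : Lp ℂ 2 μ := indicatorConstLp 2 hA (measure_ne_top μ A) (1 : ℂ) with hg
  obtain ⟨u, hut, hu⟩ := mem_closure_iff_seq_limit.1 (hdense (show g ∈ S from ⟨A, hA, hg⟩))
  obtain ⟨ns, -, hns⟩ := (tendstoInMeasure_of_tendsto_Lp hu).exists_seq_tendsto_ae
  have hbound : ∀ k, ∀ᵐ y ∂μ, ‖u k y‖ ≤ 1 := by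
    intro k
    obtain ⟨B, hB, hBu⟩ := htS (hut k)
    rw [hBu]
    filter_upwards [indicatorConstLp_coeFn (p := 2) (hs := hB) (hμs := measure_ne_top μ B)
      (c := (1 : ℂ))] with y hy
    rw [hy]
    by_cases hyB : y ∈ B <;> simp [hyB]
  have hlim : Tendsto (fun k => ∫ y, D x y * u (ns k) y ∂μ) atTop
      (𝓝 (∫ y, D x y * g y ∂μ)) := by
    refine tendsto_integral_of_dominated_convergence (fun y => ‖D x y‖)
      (fun k => hint.1.mul (Lp.aestronglyMeasurable _)) hint.norm (fun k => ?_) ?_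
    · filter_upwards [hbound (ns k)] with y hy
      rw [norm_mul]
      exact mul_le_of_le_one_right (norm_nonneg _) hy
    · filter_upwards [hns] with y hy
      exact hy.const_mul _
  have h0 : ∫ y, D x y * g y ∂μ = 0 := by
    refine tendsto_nhds_unique hlim ?_
    simp only [hx _ (hut _)]
    exact tendsto_const_nhds
  rw [← h0, ← integral_indicator hA]
  refine integral_congr_ae ?_
  filter_upwards [indicatorConstLp_coeFn (p := 2) (hs := hA) (hμs := measure_ne_top μ A)
    (c := (1 : ℂ))] with y hy
  rw [hg, hy]
  by_cases hyA : y ∈ A <;> simp [hyA]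

theorem testFunction_eq_zero (η : 𝓓(posTimes, ℝ)) {t : ℝ} (ht : ¬ 0 < t) : η t = 0 :=
  image_eq_zero_of_notMem_tsupport fun h => ht (η.tsupport_subset h)

namespace Parameters

variable {P : Parameters}

theorem integral_smul_solution (f : P.L2) (η : 𝓓(posTimes, ℝ)) :
    ∫ t : ℝ, η t • P.solution Complex.I f t =
      P.parsevalFrame.multiplier (fun n => timeCoeff η (P.freq n)) f := by
  have h1 := P.parsevalFrame.integral_smul_multiplier η.continuous η.hasCompactSupport
    (a := fun t => P.evolution Complex.I t) (C := 1)
    (fun t n => norm_evolution_le (by simp) t n) (fun n => continuous_evolution _ n) f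
  refine h1.trans ?_
  congr 1
  funext n
  refine integral_congr_ae (ae_of_all _ fun t => ?_)
  -- Test functions vanish for `t ≤ 0`, so the clamp in `evolution` is not seen.
  by_cases ht : 0 < t
  · simp only
    rw [evolution_of_nonneg _ ht.le, heatSeq]
    ring_nf
  · simp [testFunction_eq_zero η ht]

theorem isSchrodingerKernel_schrodingerKernel :
    P.IsSchrodingerKernel P.schrodingerKernel := by
  intro f
  refine ⟨P.solution Complex.I f, isUniqueSolution_solution (by simp) f, fun η => ?_⟩
  rw [integral_smul_solution]
  simp only [schrodingerKernel_apply]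
  exact multiplier_eq_integral_starKernel (quadDecay_timeCoeff η) f

/-- Both kernels represent the same time averages, since the solution is unique on `[0, ∞)`; their
difference represents the zero operator. -/
theorem IsSchrodingerKernel.ae_eq {ψ ψ' : P.FInf → P.FInf → 𝓓'(posTimes, ℂ)}
    (h : P.IsSchrodingerKernel ψ) (h' : P.IsSchrodingerKernel ψ') (η : 𝓓(posTimes, ℝ)) :
    ∀ᵐ x ∂P.muInf, ∀ᵐ y ∂P.muInf, ψ' x y η = ψ x y η := by
  have : SecondCountableTopology P.L2 := P.parsevalFrame.secondCountableTopology
  have key := ae_ae_eq_zero (μ := P.muInf) (D := fun x y => ψ' x y η - ψ x y η) fun f => ?_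
  · filter_upwards [key] with x hx
    filter_upwards [hx] with y hy
    exact sub_eq_zero.1 hy
  · obtain ⟨u, ⟨-, hu⟩, hk⟩ := h f
    obtain ⟨u', ⟨hu', -⟩, hk'⟩ := h' f
    have h1 : ∫ t : ℝ, η t • u' t = ∫ t : ℝ, η t • u t := by
      refine integral_congr_ae (ae_of_all _ fun t => ?_)
      by_cases ht : 0 < t
      · simp only
        rw [hu u' hu' (mem_Ici.2 ht.le)]
      · simp [testFunction_eq_zero η ht]
    filter_upwards [hk η, hk' η] with x hx hx'
    simp only [sub_mul]
    refine ⟨hx'.1.sub hx.1, ?_⟩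
    rw [integral_sub hx'.1 hx.1, ← hx.2, ← hx'.2, h1, sub_self]

/-- For `ε > 0` the integral is the multiplier `exp (-(ε + i t) k²)`. These are bounded by `1` and
converge for each `k`, so the operators converge strongly. -/
theorem tendsto_integral_pStar (f : P.L2) {u : ℝ → P.L2} (hu : P.IsSolution Complex.I f u) {t : ℝ}
    (ht : 0 < t) : Tendsto (fun ε : ℝ => eLpNorm
      (fun x => (∫ y, P.pStar (ε + Complex.I * t) x y * f y ∂P.muInf) - u t x) 2 P.muInf)
        (𝓝[>] 0) (𝓝 0) := by
  have h1 : Tendsto (fun ε : ℝ => P.parsevalFrame.multiplier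
      (fun n => heatSeq (ε + Complex.I * t) (P.freq n)) f) (𝓝[>] 0) (𝓝 (u t)) := by
    rw [hu.eq_solution (by simp) ht.le]
    refine P.parsevalFrame.tendsto_multiplier (C := 1) ?_ (norm_evolution_le (by simp) t)
      (fun n => ?_) f
    · filter_upwards [self_mem_nhdsWithin] with ε hε n
      rw [heatSeq_add, norm_mul, norm_heatSeq_I_mul, mul_one]
      exact norm_heatSeq_ofReal_le (le_of_lt hε) _
    · have h2 : Continuous fun ε : ℝ => heatSeq (ε + Complex.I * t) (P.freq n) :=
        continuous_heatSeq_comp (by fun_prop) _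
      have h3 := (h2.tendsto 0).mono_left (nhdsWithin_le_nhds (s := Ioi 0))
      rw [evolution_of_nonneg _ ht.le]
      convert! h3 using 2
      rw [heatSeq]
      push_cast
      ring_nf
  refine ((Lp.tendsto_Lp_iff_tendsto_eLpNorm' _ _).1 h1).congr' ?_
  filter_upwards [self_mem_nhdsWithin] with ε hε
  have hz : 0 < ((ε : ℂ) + Complex.I * t).re := by simpa using hε
  refine eLpNorm_congr_ae ?_
  filter_upwards [multiplier_eq_integral_starKernel (quadDecay_heatSeq hz) f] with x hx
  rw [Pi.sub_apply, hx.2]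
  simp only [pStar_eq_starKernel hz]

end Parameters
end DiamondFractal
end

theorem corollary2 (P : DiamondFractal.Parameters) (hP : P.Growth) :
    -- off the diagonal, `i_*` is a maximum
    (∀ x y : P.FInf, x ≠ y → BddAbove (P.bundleLevels x y)) ∧
    -- the heat kernel extends to complex times, and is given by `p^{F_{i_*}}`
    (P.IsHeatKernel fun t => P.pInf t) ∧
    (∀ x y : P.FInf, DifferentiableOn ℂ (fun z => P.pInf z x y) {z | 0 < z.re}) ∧
    (∀ z : ℂ, 0 < z.re → ∀ x y : P.FInf,
      Tendsto (fun i => P.p i z (P.Phi i x) (P.Phi i y)) atTop (𝓝 (P.pInf z x y)) ∧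
      (x ≠ y → P.pInf z x y = P.pStar z x y)) ∧
    -- the free Schrödinger kernel is obtained from it by Wick rotation, as a distribution in time
    (∃ ψ : P.FInf → P.FInf → 𝓓'(DiamondFractal.posTimes, ℂ),
      P.IsSchrodingerKernel ψ ∧
      (∀ x y : P.FInf, x ≠ y →
        DiamondFractal.IsWickRotation (fun z => P.pStar z x y) (ψ x y)) ∧
      ∀ ψ', P.IsSchrodingerKernel ψ' → ∀ η : 𝓓(DiamondFractal.posTimes, ℝ),
        ∀ᵐ x ∂P.muInf, ∀ᵐ y ∂P.muInf, ψ' x y η = ψ x y η) ∧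
    -- and, at each time, in the sense of operators on `L²`
    (∀ (f : P.L2) (u : ℝ → P.L2), P.IsSolution Complex.I f u → ∀ t : ℝ, 0 < t →
      (∀ ε : ℝ, 0 < ε → ∀ x : P.FInf,
        Integrable (fun y => P.pStar (ε + Complex.I * t) x y * f y) P.muInf) ∧
      Tendsto (fun ε : ℝ => eLpNorm
        (fun x => (∫ y, P.pStar (ε + Complex.I * t) x y * f y ∂P.muInf) - u t x) 2 P.muInf)
        (𝓝[>] 0) (𝓝 0)) := by
  open DiamondFractal DiamondFractal.Parameters in
  exact ⟨fun _ _ hxy => bddAbove_bundleLevels hxy, isHeatKernel_pInf hP, differentiableOn_pInf hP,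
    fun z hz x y => ⟨pInf_eq_tsum hP hz x y ▸ tendsto_p hP hz x y, fun hxy =>
      (pInf_eq_starKernel hP hz hxy).trans (pStar_eq_starKernel hz x y).symm⟩,
    ⟨P.schrodingerKernel, isSchrodingerKernel_schrodingerKernel,
      fun x y _ => isWickRotation_schrodingerKernel x y,
      fun _ hψ' η => isSchrodingerKernel_schrodingerKernel.ae_eq hψ' η⟩,
    fun f u hu t ht => ⟨fun ε hε x => integrable_pStar_mul hP (by simpa using hε) x f,
      tendsto_integral_pStar f hu ht⟩⟩
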